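/- Let $n\ge 0$ and let $\mathfrak g=\mathfrak{osp}(2|2n)$ be the complex Lie superalgebra of operators on the superspace $\mathbb C^{2|2n}$ preserving (in the graded sense) the even supersymmetric form given by $\begin{pmatrix}0&1\\1&0\end{pmatrix}$ on the even part and the standard symplectic form on the odd part. Let $U(\mathfrak g)$ be its enveloping algebra with its usual Hopf superalgebra structure, $U(\mathfrak g)^\circ$ the finite dual, and $\mathcal P:U(\mathfrak g)^\circ\to U(\mathfrak g_{\bar 0})^\circ$ the transpose of the map $U(\mathfrak g_{\bar 0})\to U(\mathfrak g)$ induced by inclusion. Let $t_{ab}\in U(\mathfrak g)^\circ$ ($a,b=1,\dots,2n+2$) be the matrix elements of the defining representation of $\mathfrak g$ in the standard basis, where the indices $i\in\{1,2\}$ are even and the indices $\mu\in\{3,\dots,2n+2\}$ are odd. Let $\mathfrak g_{\bar 1\pm}$ be the subspaces of $\mathfrak g_{\bar 1}$ on which $\mathrm{diag}(1,-1,0,\dots,0)$, which spans the $\mathfrak{gl}(1)$ summand of $\mathfrak g_{\bar 0}=\mathfrak{sp}(2n)\oplus\mathfrak{gl}(1)$, acts by $\pm1$. For a sub-Hopf-superalgebra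 $\mathcal B$ of a finite dual, a linear form $I$ on $\mathcal B$ is called a left (right) integral if $(\mathrm{id}\otimes I)\Delta=1\,I$ (respectively $(I\otimes\mathrm{id})\Delta=1\,I$). For $x\in U(\mathfrak g)$ let $\nu(x)$ be the linear form $\langle\nu(x),a\rangle=(-1)^{[x][a]}\langle a,x\rangle$. (1) The unital subalgebra $\mathcal A$ of $U(\mathfrak g)^*$ generated by the $t_{ab}$ is a sub-Hopf-superalgebra of $U(\mathfrak g)^\circ$, and it is dense in $U(\mathfrak g)^*$: for every $x\neq 0$ in $U(\mathfrak g)$ there is $a\in\mathcal A$ with $\langle a,x\rangle\ne0$. (2) $\mathcal A_e=\mathcal P(\mathcal A)$ is a sub-Hopf-superalgebra of $U(\mathfrak g_{\bar 0})^\circ$. It has a left integral $\int_0$ with $\int_0 1=1$, and every left integral on $\mathcal A_e$ is a scalar multiple of $\int_0$. (3) The subspaces of $U(\mathfrak g)$ spanned by the products of $2n$ elements of $\mathfrak g_{\bar 1+}$ and of $\mathfrak g_{\bar 1-}$, respectively, are one-dimensional. Let $\mathbb E$ and $\mathbb F$ be non-zero elements of them, and put $\Gamma=\mathbb E\,\mathbb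 F$. Then the linear form $\int=\nu(\Gamma)\cdot\int_0\mathcal P$ on $\mathcal A$ (product in $\mathcal A^*$) is a non-zero left and right integral on $\mathcal A$. (4) The odd elements $t_{i\mu}$ and $t_{\mu i}$ of $\mathcal A$ all anticommute with one another (in particular, their squares are $0$), and every product of more than $4n$ of them is zero. The products of $4n$ of the elements $t_{i\mu}$ span a one-dimensional space, so that the $4n$ elements $t_{i\mu}$ generate a Grassmann algebra with this space as its top degree part; the same holds for the $4n$ elements $t_{\mu i}$. If $\Theta$ is a non-zero element of the highest degree $4n$ in one of these two Grassmann algebras, then $\int\Theta\neq0$. -/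

import Mathlib

open scoped TensorProduct

noncomputable section

namespace OSP

/-! ### Superspaces

A complex superspace is a vector space `V` with an involution `σ` (the parity automorphism), whose
eigenspaces for the eigenvalues `1` and `-1` are the even and the odd part of `V`. -/

/-- The sign `(-1) ^ α`. -/
def sgn (α : ZMod 2) : ℂ := (-1) ^ α.val

section Superspace

variable {V : Type} [AddCommGroup V] [Module ℂ V]

/-- The homogeneous component of degree `α` of the superspace `(V, σ)`. -/
def homog (σ : V →ₗ[ℂ] V) (α : ZMod 2) : Submodule ℂ V :=
  LinearMap.ker (σ - sgn α • LinearMap.id)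

/-- The projection of the superspace `(V, σ)` onto its homogeneous component of degree `α`. -/
def proj (σ : V →ₗ[ℂ] V) (α : ZMod 2) : V →ₗ[ℂ] V :=
  (1 / 2 : ℂ) • (LinearMap.id + sgn α • σ)

theorem sgn_zero : sgn 0 = 1 := by simp [sgn]

theorem sgn_one : sgn 1 = -1 := by
  have h : (1 : ZMod 2).val = 1 := rfl
  simp [sgn, h]

theorem sgn_mul_self (α : ZMod 2) : sgn α * sgn α = 1 := by
  fin_cases α
  · change sgn 0 * sgn 0 = 1
    simp [sgn_zero]
  · change sgn 1 * sgn 1 = 1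
    simp [sgn_one]

theorem sgn_add (α β : ZMod 2) : sgn (α + β) = sgn α * sgn β := by
  fin_cases α <;> fin_cases β
  · change sgn 0 = sgn 0 * sgn 0
    simp [sgn_zero]
  · change sgn 1 = sgn 0 * sgn 1
    simp [sgn_zero]
  · change sgn 1 = sgn 1 * sgn 0
    simp [sgn_zero]
  · change sgn 0 = sgn 1 * sgn 1
    simp [sgn_zero, sgn_one]

theorem zmod_two_cases (α : ZMod 2) : α = 0 ∨ α = 1 := by
  fin_cases α
  · exact Or.inl rfl
  · exact Or.inr rfl

theorem sum_zmod_two {M : Type} [AddCommMonoid M] (f : ZMod 2 → M) :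
    ∑ α, f α = f 0 + f 1 := Fin.sum_univ_two f

theorem mem_homog {σ : V →ₗ[ℂ] V} {α : ZMod 2} {x : V} :
    x ∈ homog σ α ↔ σ x = sgn α • x := by
  simp [homog, sub_eq_zero]

theorem proj_apply (σ : V →ₗ[ℂ] V) (α : ZMod 2) (x : V) :
    proj σ α x = (1 / 2 : ℂ) • (x + sgn α • σ x) := rfl

theorem proj_mem {σ : V →ₗ[ℂ] V} (hσ : ∀ x, σ (σ x) = x) (α : ZMod 2) (x : V) :
    proj σ α x ∈ homog σ α := by
  rw [mem_homog, proj_apply]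
  simp only [map_smul, map_add, hσ, smul_add, smul_smul]
  rw [show sgn α * (1 / 2 * sgn α) = 1 / 2 by
    rw [mul_left_comm, sgn_mul_self, mul_one]]
  rw [mul_comm (1 / 2 : ℂ) (sgn α), add_comm]

theorem sum_proj (σ : V →ₗ[ℂ] V) (x : V) : proj σ 0 x + proj σ 1 x = x := by
  rw [proj_apply, proj_apply, sgn_zero, sgn_one]
  module

theorem proj_of_mem {σ : V →ₗ[ℂ] V} {α : ZMod 2} {x : V} (hx : x ∈ homog σ α) (β : ZMod 2) :
    proj σ β x = if β = α then x else 0 := by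
  rw [mem_homog] at hx
  rw [proj_apply, hx]
  rcases zmod_two_cases α with rfl | rfl <;> rcases zmod_two_cases β with rfl | rfl <;>
    simp only [sgn_zero, sgn_one, if_true, one_ne_zero, zero_ne_one, if_false] <;> module

theorem eq_zero_of_mem_homog_id {x : V} (hx : x ∈ homog (LinearMap.id : V →ₗ[ℂ] V) 1) :
    x = 0 := by
  have h := mem_homog.mp hx
  rw [sgn_one, LinearMap.id_apply] at h
  have h2 : (2 : ℂ) • x = 0 := by
    rw [two_smul]
    nth_rewrite 1 [h]
    simp
  simpa using h2

theorem ext_homog {W : Type} [AddCommGroup W] [Module ℂ W] {σ : V →ₗ[ℂ] V}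
    (hσ : ∀ x, σ (σ x) = x) {f h : V →ₗ[ℂ] W}
    (H : ∀ α, ∀ x ∈ homog σ α, f x = h x) : f = h := by
  ext x
  rw [← sum_proj σ x, map_add, map_add, H 0 _ (proj_mem hσ 0 x), H 1 _ (proj_mem hσ 1 x)]

/-- The linear map `x ⊗ y ↦ (-1) ^ ([x] [y]) x ⊗ y`. -/
def superTwist (σ : V →ₗ[ℂ] V) : V ⊗[ℂ] V →ₗ[ℂ] V ⊗[ℂ] V :=
  ∑ α, ∑ β, sgn (α * β) • TensorProduct.map (proj σ α) (proj σ β)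

theorem superTwist_tmul {σ : V →ₗ[ℂ] V} {α β : ZMod 2} {x y : V}
    (hx : x ∈ homog σ α) (hy : y ∈ homog σ β) :
    superTwist σ (x ⊗ₜ y) = sgn (α * β) • (x ⊗ₜ[ℂ] y) := by
  simp only [superTwist, LinearMap.sum_apply, LinearMap.smul_apply, TensorProduct.map_tmul,
    proj_of_mem hx, proj_of_mem hy]
  rw [Finset.sum_eq_single α, Finset.sum_eq_single β]
  · simp
  · intro b _ hb
    simp [hb]
  · simp
  · intro b _ hb
    simp [hb]
  · simp

theorem superTwist_superTwist {σ : V →ₗ[ℂ] V} (hσ : ∀ x, σ (σ x) = x) (T : V ⊗[ℂ] V) :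
    superTwist σ (superTwist σ T) = T := by
  suffices h : superTwist σ ∘ₗ superTwist σ = LinearMap.id from LinearMap.congr_fun h T
  apply TensorProduct.ext
  refine ext_homog hσ fun α x hx => ?_
  refine ext_homog hσ fun β y hy => ?_
  simp [superTwist_tmul hx hy, smul_smul, sgn_mul_self]

/-- The pairing between `V* ⊗ V*` and `V ⊗ V` in the graded sense,
`⟨f ⊗ g, x ⊗ y⟩ = (-1) ^ ([g] [x]) f x * g y`. (As `g y` vanishes unless `[g] = [y]`, the sign
is `(-1) ^ ([x] [y])`.) -/
def superPairing (σ : V →ₗ[ℂ] V) :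
    Module.Dual ℂ V ⊗[ℂ] Module.Dual ℂ V →ₗ[ℂ] Module.Dual ℂ (V ⊗[ℂ] V) :=
  (superTwist σ).dualMap ∘ₗ TensorProduct.dualDistrib ℂ V V

theorem dualDistrib_injective : Function.Injective (TensorProduct.dualDistrib ℂ V V) := by
  rw [← LinearMap.ker_eq_bot, LinearMap.ker_eq_bot']
  intro T hT
  classical
  let b := Module.Basis.ofVectorSpace ℂ (Module.Dual ℂ V)
  let e := TensorProduct.equivFinsuppOfBasisRight (M := Module.Dual ℂ V) b
  obtain ⟨c, rfl⟩ := e.symm.surjective T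
  have hc : e.symm c = c.sum fun i f => f ⊗ₜ b i := by
    simp [e, TensorProduct.equivFinsuppOfBasisRight_symm_apply]
  suffices h : c = 0 by simp [h]
  ext i x
  have key : c.sum (fun i f => f x • b i) = 0 := by
    ext y
    have := LinearMap.congr_fun hT (x ⊗ₜ y)
    rw [hc] at this
    simpa [Finsupp.sum, LinearMap.sum_apply, map_sum] using this
  have hli := b.linearIndependent
  rw [linearIndependent_iff'] at hli
  by_cases hi : i ∈ c.support
  · exact hli c.support (fun i => c i x) key i hi
  · simp [Finsupp.notMem_support_iff.mp hi]

theorem superPairing_injective {σ : V →ₗ[ℂ] V} (hσ : ∀ x, σ (σ x) = x) :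
    Function.Injective (superPairing σ) := by
  intro S T h
  apply dualDistrib_injective
  ext1
  ext x y
  have := LinearMap.congr_fun h (superTwist σ (x ⊗ₜ y))
  simpa [superPairing, superTwist_superTwist hσ] using this

end Superspace

/-! ### Lie superalgebras -/

/-- A complex Lie superalgebra. -/
class LieSuperalgebra (g : Type) [AddCommGroup g] [Module ℂ g] where
  /-- The parity automorphism. -/
  parity : g →ₗ[ℂ] g
  parity_parity : ∀ x, parity (parity x) = x
  /-- The super bracket. -/
  bracket : g →ₗ[ℂ] g →ₗ[ℂ] g
  parity_bracket : ∀ x y, parity (bracket x y) = bracket (parity x) (parity y)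
  skew : ∀ α β, ∀ x ∈ homog parity α, ∀ y ∈ homog parity β,
    bracket x y = -(sgn (α * β) • bracket y x)
  jacobi : ∀ α β, ∀ x ∈ homog parity α, ∀ y ∈ homog parity β, ∀ z,
    bracket x (bracket y z) = bracket (bracket x y) z + sgn (α * β) • bracket y (bracket x z)

open LieSuperalgebra

section Associative

variable {R : Type} [Ring R] [Algebra ℂ R]

/-- The super commutator of an associative superalgebra: the bilinear map which is equal to
`x y - (-1) ^ (α β) y x` on elements `x`, `y` of degrees `α`, `β`. -/
def superCommutator (σ : R →ₗ[ℂ] R) : R →ₗ[ℂ] R →ₗ[ℂ] R :=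
  ∑ α, ∑ β, ((LinearMap.mul ℂ R).compl₁₂ (proj σ α) (proj σ β) -
    sgn (α * β) • ((LinearMap.mul ℂ R).flip.compl₁₂ (proj σ α) (proj σ β)))

theorem superCommutator_apply {σ : R →ₗ[ℂ] R} {α β : ZMod 2} {x y : R}
    (hx : x ∈ homog σ α) (hy : y ∈ homog σ β) :
    superCommutator σ x y = x * y - sgn (α * β) • (y * x) := by
  simp only [superCommutator, LinearMap.sum_apply, LinearMap.sub_apply, LinearMap.smul_apply,
    LinearMap.compl₁₂_apply, LinearMap.flip_apply, LinearMap.mul_apply', proj_of_mem hx,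
    proj_of_mem hy]
  rw [Finset.sum_eq_single α, Finset.sum_eq_single β]
  · simp
  · intro b _ hb
    simp [hb]
  · simp
  · intro b _ hb
    simp [hb]
  · simp

theorem mul_mem_homog {σ : R →ₗ[ℂ] R} (hm : ∀ x y, σ (x * y) = σ x * σ y) {α β : ZMod 2} {x y : R}
    (hx : x ∈ homog σ α) (hy : y ∈ homog σ β) : x * y ∈ homog σ (α + β) := by
  rw [mem_homog] at *
  rw [hm, hx, hy, sgn_add, smul_mul_smul_comm]

theorem superCommutator_mem {σ : R →ₗ[ℂ] R} (hm : ∀ x y, σ (x * y) = σ x * σ y) {α β : ZMod 2}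
    {x y : R} (hx : x ∈ homog σ α) (hy : y ∈ homog σ β) :
    superCommutator σ x y ∈ homog σ (α + β) := by
  rw [superCommutator_apply hx hy]
  refine sub_mem (mul_mem_homog hm hx hy) (Submodule.smul_mem _ _ ?_)
  rw [add_comm]
  exact mul_mem_homog hm hy hx

theorem superCommutator_jacobi {σ : R →ₗ[ℂ] R} (hσ : ∀ x, σ (σ x) = x)
    (hm : ∀ x y, σ (x * y) = σ x * σ y) {α β : ZMod 2} {x y : R}
    (hx : x ∈ homog σ α) (hy : y ∈ homog σ β) (z : R) :
    superCommutator σ x (superCommutator σ y z) = superCommutator σ (superCommutator σ x y) z +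
      sgn (α * β) • superCommutator σ y (superCommutator σ x z) := by
  suffices h : superCommutator σ x ∘ₗ superCommutator σ y =
      superCommutator σ (superCommutator σ x y) +
        sgn (α * β) • (superCommutator σ y ∘ₗ superCommutator σ x) from LinearMap.congr_fun h z
  refine ext_homog hσ fun γ z hz => ?_
  simp only [LinearMap.comp_apply, LinearMap.add_apply, LinearMap.smul_apply]
  rw [superCommutator_apply hx (superCommutator_mem hm hy hz),
    superCommutator_apply (superCommutator_mem hm hx hy) hz,
    superCommutator_apply hy (superCommutator_mem hm hx hz),
    superCommutator_apply hx hy, superCommutator_apply hx hz, superCommutator_apply hy hz]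
  have h1 : sgn (β * α) = sgn (α * β) := by rw [mul_comm]
  have h2 := sgn_mul_self (α * β)
  simp only [mul_add, add_mul, sgn_add, h1, mul_sub, sub_mul, smul_sub, smul_mul_assoc,
    mul_smul_comm, smul_smul, mul_assoc]
  rw [show sgn (α * β) * (sgn (α * β) * sgn (β * γ)) = sgn (β * γ) by
    rw [← mul_assoc, h2, one_mul]]
  rw [show sgn (α * β) * (sgn (α * β) * (sgn (β * γ) * sgn (α * γ))) =
      sgn (α * γ) * sgn (β * γ) by
    rw [← mul_assoc, h2, one_mul, mul_comm]]
  module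

/-- A subspace of an associative superalgebra that is stable under the parity automorphism and
under the super commutator is a Lie superalgebra. -/
abbrev lieSuperalgebraOfSubmodule (σ : R →ₗ[ℂ] R) (hσ : ∀ x, σ (σ x) = x)
    (hm : ∀ x y, σ (x * y) = σ x * σ y) (L : Submodule ℂ R) (hL : ∀ x ∈ L, σ x ∈ L)
    (hB : ∀ x ∈ L, ∀ y ∈ L, superCommutator σ x y ∈ L) : LieSuperalgebra L where
  parity := σ.restrict hL
  parity_parity x := Subtype.ext (hσ x)
  bracket := LinearMap.mk₂ ℂ (fun x y => ⟨superCommutator σ x y, hB x x.2 y y.2⟩)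
    (fun x y z => Subtype.ext (by simp)) (fun c x y => Subtype.ext (by simp))
    (fun x y z => Subtype.ext (by simp)) (fun c x y => Subtype.ext (by simp))
  parity_bracket x y := by
    apply Subtype.ext
    have H : σ ∘ₗ superCommutator σ x = superCommutator σ (σ x) ∘ₗ σ := by
      suffices H' : (superCommutator σ).compr₂ σ = (superCommutator σ).compl₁₂ σ σ from
        LinearMap.congr_fun H' x
      refine ext_homog hσ fun α x hx => ?_
      refine ext_homog hσ fun β y hy => ?_
      simp only [LinearMap.compr₂_apply, LinearMap.compl₁₂_apply]
      rw [mem_homog.mp (superCommutator_mem hm hx hy), mem_homog.mp hx, mem_homog.mp hy]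
      simp [sgn_add, smul_smul, mul_comm]
    exact LinearMap.congr_fun H y
  skew α β x hx y hy := by
    have hx' : (x : R) ∈ homog σ α := mem_homog.mpr (congrArg Subtype.val (mem_homog.mp hx))
    have hy' : (y : R) ∈ homog σ β := mem_homog.mpr (congrArg Subtype.val (mem_homog.mp hy))
    apply Subtype.ext
    simp only [LinearMap.mk₂_apply, Submodule.coe_neg, Submodule.coe_smul]
    rw [superCommutator_apply hx' hy', superCommutator_apply hy' hx', mul_comm β α, smul_sub,
      smul_smul, sgn_mul_self, one_smul, neg_sub]
  jacobi α β x hx y hy z := by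
    have hx' : (x : R) ∈ homog σ α := mem_homog.mpr (congrArg Subtype.val (mem_homog.mp hx))
    have hy' : (y : R) ∈ homog σ β := mem_homog.mpr (congrArg Subtype.val (mem_homog.mp hy))
    exact Subtype.ext (superCommutator_jacobi hσ hm hx' hy' z)

end Associative

section EvenPart

variable (g : Type) [AddCommGroup g] [Module ℂ g] [LieSuperalgebra g]

/-- The even part of a Lie superalgebra. -/
abbrev evenPart : Submodule ℂ g := homog (parity (g := g)) 0

variable {g} in
theorem evenPart_bracket_mem (x y : evenPart g) :
    bracket (x : g) (y : g) ∈ evenPart g := by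
  have hx := mem_homog.mp x.2
  have hy := mem_homog.mp y.2
  rw [sgn_zero, one_smul] at hx hy
  rw [mem_homog, sgn_zero, one_smul, parity_bracket, hx, hy]

/-- The even part of a Lie superalgebra is a Lie algebra, i.e., a Lie superalgebra with vanishing
odd part. -/
instance : LieSuperalgebra (evenPart g) where
  parity := LinearMap.id
  parity_parity _ := rfl
  bracket := LinearMap.mk₂ ℂ (fun x y => ⟨bracket (x : g) (y : g), evenPart_bracket_mem x y⟩)
    (fun x y z => Subtype.ext (by simp)) (fun c x y => Subtype.ext (by simp))
    (fun x y z => Subtype.ext (by simp)) (fun c x y => Subtype.ext (by simp))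
  parity_bracket _ _ := rfl
  skew α β x hx y hy := by
    rcases zmod_two_cases α with rfl | rfl
    · have := skew 0 0 (x : g) x.2 (y : g) y.2
      apply Subtype.ext
      simpa using this
    · have hx0 : x = 0 :=
        eq_zero_of_mem_homog_id hx
      subst hx0
      simp
  jacobi α β x hx y hy z := by
    rcases zmod_two_cases α with rfl | rfl
    · have := jacobi 0 0 (x : g) x.2 (y : g) y.2 (z : g)
      apply Subtype.ext
      simpa using this
    · have hx0 : x = 0 :=
        eq_zero_of_mem_homog_id hx
      subst hx0
      apply Subtype.ext
      simp

end EvenPart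

/-! ### The enveloping algebra as a Hopf superalgebra -/

section Enveloping

variable (g : Type) [AddCommGroup g] [Module ℂ g] [LieSuperalgebra g]

/-- The relations `x y - (-1) ^ (α β) y x = [x, y]`, for `x`, `y` in `g` of degrees `α`, `β`. -/
inductive URel : TensorAlgebra ℂ g → TensorAlgebra ℂ g → Prop
  | rel (α β : ZMod 2) (x y : g) (hx : x ∈ homog parity α) (hy : y ∈ homog parity β) :
    URel (TensorAlgebra.ι ℂ x * TensorAlgebra.ι ℂ y -
        sgn (α * β) • (TensorAlgebra.ι ℂ y * TensorAlgebra.ι ℂ x))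
      (TensorAlgebra.ι ℂ (bracket x y))

/-- The enveloping algebra `U(g)` of a Lie superalgebra `g`. -/
def U : Type := RingQuot (URel g)

instance : Ring (U g) := inferInstanceAs (Ring (RingQuot (URel g)))

instance : Algebra ℂ (U g) := inferInstanceAs (Algebra ℂ (RingQuot (URel g)))

namespace U

/-- The canonical map `g → U(g)`. -/
def ι : g →ₗ[ℂ] U g :=
  (RingQuot.mkAlgHom ℂ (URel g)).toLinearMap ∘ₗ TensorAlgebra.ι ℂ

variable {g}

theorem ι_rel {α β : ZMod 2} {x y : g} (hx : x ∈ homog parity α) (hy : y ∈ homog parity β) :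
    ι g x * ι g y - sgn (α * β) • (ι g y * ι g x) = ι g (bracket x y) := by
  have h := RingQuot.mkAlgHom_rel ℂ (URel.rel α β x y hx hy)
  rw [map_sub, map_smul, map_mul, map_mul] at h
  exact h

/-- The universal property of `U(g)`. -/
def lift {R : Type} [Ring R] [Algebra ℂ R] (f : g →ₗ[ℂ] R)
    (hf : ∀ α β, ∀ x ∈ homog (parity (g := g)) α, ∀ y ∈ homog (parity (g := g)) β,
      f x * f y - sgn (α * β) • (f y * f x) = f (bracket x y)) : U g →ₐ[ℂ] R :=
  RingQuot.liftAlgHom ℂ ⟨TensorAlgebra.lift ℂ f, by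
    rintro _ _ ⟨α, β, x, y, hx, hy⟩
    simpa using hf α β x hx y hy⟩

@[simp]
theorem lift_ι {R : Type} [Ring R] [Algebra ℂ R] (f : g →ₗ[ℂ] R)
    (hf : ∀ α β, ∀ x ∈ homog (parity (g := g)) α, ∀ y ∈ homog (parity (g := g)) β,
      f x * f y - sgn (α * β) • (f y * f x) = f (bracket x y)) (x : g) :
    lift f hf (ι g x) = f x := by
  have h : lift f hf (ι g x) = TensorAlgebra.lift ℂ f (TensorAlgebra.ι ℂ x) :=
    RingQuot.liftAlgHom_mkAlgHom_apply ..
  rw [h, TensorAlgebra.lift_ι_apply]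

theorem algHom_ext {R : Type} [Ring R] [Algebra ℂ R] {f h : U g →ₐ[ℂ] R}
    (H : ∀ x, f (ι g x) = h (ι g x)) : f = h := by
  apply RingQuot.ringQuot_ext'
  apply TensorAlgebra.hom_ext
  ext x
  exact H x

theorem parity_mem_homog {α : ZMod 2} {x : g} (hx : x ∈ homog (parity (g := g)) α) :
    parity x ∈ homog (parity (g := g)) α := by
  rw [mem_homog.mp hx]
  exact Submodule.smul_mem _ _ hx

/-- The parity automorphism of `U(g)`. -/
def parityHom : U g →ₐ[ℂ] U g :=
  lift (ι g ∘ₗ parity) fun _ _ x hx y hy => by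
    simp only [LinearMap.comp_apply]
    rw [ι_rel (parity_mem_homog hx) (parity_mem_homog hy), parity_bracket]

theorem parityHom_parityHom (u : U g) : parityHom (parityHom u) = u := by
  suffices h : parityHom.comp parityHom = AlgHom.id ℂ (U g) from DFunLike.congr_fun h u
  apply algHom_ext
  intro x
  simp [parityHom, parity_parity]

variable (g) in
/-- The parity automorphism of `U(g)`, as a linear map. -/
abbrev σ : U g →ₗ[ℂ] U g := parityHom.toLinearMap

theorem σ_σ (u : U g) : σ g (σ g u) = u := parityHom_parityHom u

theorem ι_mem {α : ZMod 2} {x : g} (hx : x ∈ homog (parity (g := g)) α) :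
    ι g x ∈ homog (σ g) α := by
  rw [mem_homog] at *
  simp [parityHom, hx]

variable (g) in
/-- The `ℤ₂`-grading of `U(g)`. -/
abbrev gr : ZMod 2 → Submodule ℂ (U g) := homog (σ g)

instance : SetLike.GradedMonoid (gr g) where
  one_mem := by
    rw [mem_homog]
    simp [sgn_zero]
  mul_mem _ _ _ _ hx hy := mul_mem_homog (fun x y => map_mul parityHom x y) hx hy

theorem sum_of_proj (β : ZMod 2) (x : gr g β) :
    ∑ α, DirectSum.of (fun α => gr g α) α ⟨proj (σ g) α (x : U g), proj_mem σ_σ α (x : U g)⟩ =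
      DirectSum.of (fun α => gr g α) β x := by
  rw [Finset.sum_eq_single β]
  · congr 1
    exact Subtype.ext ((proj_of_mem x.2 β).trans (if_pos rfl))
  · intro α _ hα
    rw [← map_zero (DirectSum.of (fun α => gr g α) α)]
    congr 1
    exact Subtype.ext ((proj_of_mem x.2 α).trans (if_neg hα))
  · simp

instance : DirectSum.Decomposition (gr g) where
  decompose' u := ∑ α, DirectSum.of (fun α => gr g α) α ⟨proj (σ g) α u, proj_mem σ_σ α u⟩
  left_inv u := by
    simp only [sum_zmod_two, map_add, DirectSum.coeAddMonoidHom_of]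
    exact sum_proj _ u
  right_inv v := by
    let D : U g →+ DirectSum (ZMod 2) fun α => gr g α :=
      { toFun := fun u =>
          ∑ α, DirectSum.of (fun α => gr g α) α ⟨proj (σ g) α u, proj_mem σ_σ α u⟩
        map_zero' := by
          refine Finset.sum_eq_zero fun α _ => ?_
          rw [← map_zero (DirectSum.of (fun α => gr g α) α)]
          congr 1
          exact Subtype.ext (by simp)
        map_add' := fun u v => by
          rw [← Finset.sum_add_distrib]
          refine Finset.sum_congr rfl fun α _ => ?_
          rw [← map_add]
          congr 1
          exact Subtype.ext (by simp) }
    suffices h : D.comp (DirectSum.coeAddMonoidHom (gr g)) = AddMonoidHom.id _ from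
      DFunLike.congr_fun h v
    refine DirectSum.addHom_ext fun β x => ?_
    rw [AddMonoidHom.comp_apply, DirectSum.coeAddMonoidHom_of]
    exact sum_of_proj β x

instance : GradedAlgebra (gr g) where

open GradedTensorProduct in
/-- The coproduct of `U(g)`: the algebra homomorphism into the graded tensor product
`U(g) ⊗ U(g)` with `Δ x = x ⊗ 1 + 1 ⊗ x` for `x` in `g`. -/
def comul : U g →ₐ[ℂ] gr g ᵍ⊗[ℂ] gr g :=
  lift ((includeLeft (gr g) (gr g)).toLinearMap ∘ₗ ι g +
      (includeRight (gr g) (gr g)).toLinearMap ∘ₗ ι g) fun α β x hx y hy => by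
    have h1 : ∀ {α β : ZMod 2} {x y : g}, x ∈ homog parity α → y ∈ homog parity β →
        ((1 : U g) ᵍ⊗ₜ[ℂ] ι g x * (ι g y) ᵍ⊗ₜ[ℂ] (1 : U g) : gr g ᵍ⊗[ℂ] gr g) =
          sgn (α * β) • ((ι g y) ᵍ⊗ₜ[ℂ] ι g x) := by
      intro α β x y hx hy
      have h := tmul_coe_mul_coe_tmul (R := ℂ) (gr g) (gr g) (1 : U g) ⟨ι g x, ι_mem hx⟩
        ⟨ι g y, ι_mem hy⟩ (1 : U g)
      rw [one_mul, mul_one] at h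
      rw [h]
      rcases zmod_two_cases α with rfl | rfl <;> rcases zmod_two_cases β with rfl | rfl <;>
        simp [sgn_zero, sgn_one]
    have h2 : ∀ x y : g,
        ((ι g x) ᵍ⊗ₜ[ℂ] (1 : U g) * (1 : U g) ᵍ⊗ₜ[ℂ] ι g y : gr g ᵍ⊗[ℂ] gr g) =
          (ι g x) ᵍ⊗ₜ[ℂ] ι g y := fun x y => tmul_one_mul_one_tmul (gr g) (gr g) _ _
    simp only [LinearMap.add_apply, LinearMap.comp_apply, AlgHom.toLinearMap_apply]
    rw [← ι_rel hx hy]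
    simp only [map_sub, map_smul, map_mul, add_mul, mul_add, smul_add]
    simp only [includeLeft_apply, includeRight_apply, h1 hx hy, h1 hy hx, h2, smul_smul,
      mul_comm β α, sgn_mul_self, one_smul]
    module

/-- The coproduct of `U(g)`, as a linear map into `U(g) ⊗ U(g)`. -/
def comulₗ : U g →ₗ[ℂ] U g ⊗[ℂ] U g :=
  (GradedTensorProduct.of ℂ (gr g) (gr g)).symm.toLinearMap ∘ₗ comul.toLinearMap

/-- The counit of `U(g)`. -/
def counit : U g →ₐ[ℂ] ℂ := lift 0 (by simp)

variable (g) in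
/-- The bilinear map with `(x, v) ↦ -(-1) ^ ([x] [v]) v x` for `x` in `g` and `v` in `U(g)`. -/
def negSignedRight : g →ₗ[ℂ] Module.End ℂ (U g) :=
  -(∑ α, ∑ β, sgn (α * β) •
    (LinearMap.mul ℂ (U g)).flip.compl₁₂ (ι g ∘ₗ proj parity α) (proj (σ g) β))

theorem negSignedRight_apply {α β : ZMod 2} {x : g} {v : U g}
    (hx : x ∈ homog (parity (g := g)) α) (hv : v ∈ gr g β) :
    negSignedRight g x v = -(sgn (α * β) • (v * ι g x)) := by
  simp only [negSignedRight, LinearMap.neg_apply, LinearMap.sum_apply, LinearMap.smul_apply,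
    LinearMap.compl₁₂_apply, LinearMap.flip_apply, LinearMap.mul_apply', LinearMap.comp_apply,
    proj_of_mem hx, proj_of_mem hv]
  rw [Finset.sum_eq_single α, Finset.sum_eq_single β]
  · simp
  · intro b _ hb
    simp [hb]
  · simp
  · intro b _ hb
    simp [hb]
  · simp

/-- The action of `U(g)` on `U(g)` in which `x` in `g` acts by `v ↦ -(-1) ^ ([x] [v]) v x`. -/
def antipodeAction : U g →ₐ[ℂ] Module.End ℂ (U g) :=
  lift (negSignedRight g) fun α β x hx y hy => by
    refine ext_homog σ_σ fun γ v hv => ?_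
    have hm : ∀ x y : U g, σ g (x * y) = σ g x * σ g y := fun x y => map_mul parityHom x y
    have hxy : bracket x y ∈ homog (parity (g := g)) (α + β) := by
      rw [mem_homog, parity_bracket, mem_homog.mp hx, mem_homog.mp hy]
      simp [sgn_add, smul_smul, mul_comm]
    have hvx := mul_mem_homog hm hv (ι_mem hx)
    have hvy := mul_mem_homog hm hv (ι_mem hy)
    simp only [LinearMap.sub_apply, LinearMap.smul_apply, Module.End.mul_apply]
    rw [negSignedRight_apply hxy hv, negSignedRight_apply hx hv, negSignedRight_apply hy hv,
      ← ι_rel hx hy]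
    simp only [map_neg, map_smul, negSignedRight_apply hx hvy, negSignedRight_apply hy hvx,
      smul_neg, neg_neg, smul_smul, mul_add, add_mul, sgn_add, mul_comm β α, mul_sub, smul_sub,
      mul_smul_comm, mul_assoc]
    have h := sgn_mul_self (α * β)
    rw [show sgn (α * β) * (sgn (α * γ) * (sgn (β * γ) * sgn (α * β))) =
      sgn (α * γ) * sgn (β * γ) by linear_combination (sgn (α * γ) * sgn (β * γ)) * h]
    module

/-- The antipode of `U(g)`: the linear map with `S 1 = 1`, `S x = -x` for `x` in `g`, and
`S (u v) = (-1) ^ ([u] [v]) S v * S u`. -/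
def antipode : U g →ₗ[ℂ] U g :=
  (LinearMap.applyₗ (1 : U g)) ∘ₗ antipodeAction.toLinearMap

end U

end Enveloping

/-! ### The finite dual of `U(g)` and its sub-Hopf-superalgebras -/

section Dual

variable {g : Type} [AddCommGroup g] [Module ℂ g] [LieSuperalgebra g]

open U

/-- The product of `U(g)*`: the graded transpose of the coproduct of `U(g)`. -/
def dualMul (f h : Module.Dual ℂ (U g)) : Module.Dual ℂ (U g) :=
  superPairing (σ g) (f ⊗ₜ h) ∘ₗ comulₗ

/-- The unit element of `U(g)*`: the counit of `U(g)`. -/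
def dualOne : Module.Dual ℂ (U g) := counit.toLinearMap

/-- The product in `U(g)*` of a list of linear forms. -/
def dualProd (l : List (Module.Dual ℂ (U g))) : Module.Dual ℂ (U g) :=
  l.foldr dualMul dualOne

/-- The span of all products in `U(g)*` of `d` elements of `S`. -/
def dualDegreePart (S : Set (Module.Dual ℂ (U g))) (d : ℕ) : Submodule ℂ (Module.Dual ℂ (U g)) :=
  Submodule.span ℂ {f | ∃ l : List (Module.Dual ℂ (U g)),
    l.length = d ∧ (∀ t ∈ l, t ∈ S) ∧ f = dualProd l}

/-- The unital subalgebra of `U(g)*` generated by `S`. -/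
def generatedSubalgebra (S : Set (Module.Dual ℂ (U g))) : Submodule ℂ (Module.Dual ℂ (U g)) :=
  sInf {M | S ⊆ M ∧ dualOne ∈ M ∧ ∀ f ∈ M, ∀ h ∈ M, dualMul f h ∈ M}

/-- Membership in the finite dual `U(g)°`: the linear form vanishes on a two-sided ideal of finite
codimension. -/
def InFiniteDual (f : Module.Dual ℂ (U g)) : Prop :=
  ∃ J : Ideal (U g), J.IsTwoSided ∧ Module.Finite ℂ (U g ⧸ J) ∧ ∀ u ∈ J, f u = 0

variable (g) in
/-- A sub-Hopf-superalgebra of `U(g)°`. The structure maps of `U(g)°` are the (graded) transposes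
of those of `U(g)`. In particular, the coproduct of `a` is the element `T` of the tensor product
with `⟨T, x ⊗ y⟩ = a (x y)`. -/
structure SubHopfSuperalgebra extends Submodule ℂ (Module.Dual ℂ (U g)) where
  inFiniteDual : ∀ a ∈ toSubmodule, InFiniteDual a
  parity_mem : ∀ a ∈ toSubmodule, a ∘ₗ σ g ∈ toSubmodule
  one_mem : dualOne ∈ toSubmodule
  mul_mem : ∀ a ∈ toSubmodule, ∀ b ∈ toSubmodule, dualMul a b ∈ toSubmodule
  comul_mem : ∀ a ∈ toSubmodule, ∃ T : toSubmodule ⊗[ℂ] toSubmodule,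
    superPairing (σ g) (TensorProduct.map toSubmodule.subtype toSubmodule.subtype T) =
      a ∘ₗ LinearMap.mul' ℂ (U g)
  antipode_mem : ∀ a ∈ toSubmodule, a ∘ₗ antipode ∈ toSubmodule

namespace SubHopfSuperalgebra

variable (A : SubHopfSuperalgebra g)

/-- The unit element of `A`. -/
def one : A.toSubmodule := ⟨dualOne, A.one_mem⟩

/-- The parity automorphism of `A`. -/
def parity : A.toSubmodule →ₗ[ℂ] A.toSubmodule :=
  (σ g).dualMap.restrict A.parity_mem

/-- The pairing of `A ⊗ A` with `U(g) ⊗ U(g)`. -/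
def pairing : A.toSubmodule ⊗[ℂ] A.toSubmodule →ₗ[ℂ] Module.Dual ℂ (U g ⊗[ℂ] U g) :=
  superPairing (σ g) ∘ₗ TensorProduct.map A.toSubmodule.subtype A.toSubmodule.subtype

theorem pairing_injective : Function.Injective A.pairing := by
  refine (superPairing_injective σ_σ).comp ?_
  exact TensorProduct.map_injective_of_flat_flat _ _ A.toSubmodule.injective_subtype
    A.toSubmodule.injective_subtype

theorem mul_mem_range (a : A.toSubmodule) :
    (LinearMap.mul' ℂ (U g)).dualMap a.1 ∈ LinearMap.range A.pairing := by
  obtain ⟨T, hT⟩ := A.comul_mem a.1 a.2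
  exact ⟨T, hT⟩

/-- The coproduct of `A`. -/
def comul : A.toSubmodule →ₗ[ℂ] A.toSubmodule ⊗[ℂ] A.toSubmodule :=
  (LinearEquiv.ofInjective A.pairing A.pairing_injective).symm.toLinearMap ∘ₗ
    LinearMap.codRestrict _ ((LinearMap.mul' ℂ (U g)).dualMap ∘ₗ A.toSubmodule.subtype)
      A.mul_mem_range

theorem pairing_comul (a : A.toSubmodule) (x y : U g) :
    A.pairing (A.comul a) (x ⊗ₜ y) = a.1 (x * y) := by
  have h : A.pairing (A.comul a) = (LinearMap.mul' ℂ (U g)).dualMap a.1 :=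
    congrArg Subtype.val (LinearEquiv.apply_symm_apply
      (LinearEquiv.ofInjective A.pairing A.pairing_injective)
      ⟨(LinearMap.mul' ℂ (U g)).dualMap a.1, A.mul_mem_range a⟩)
  rw [h]
  simp

/-- Left integrals on `A`: `(id ⊗ I) Δ a = I a • 1` for all `a`. -/
def IsLeftIntegral (I : Module.Dual ℂ A.toSubmodule) : Prop :=
  ∀ a, TensorProduct.rid ℂ _ (TensorProduct.map LinearMap.id I (A.comul a)) = I a • A.one

/-- Right integrals on `A`: `(I ⊗ id) Δ a = I a • 1` for all `a`. -/
def IsRightIntegral (I : Module.Dual ℂ A.toSubmodule) : Prop :=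
  ∀ a, TensorProduct.lid ℂ _ (TensorProduct.map I LinearMap.id (A.comul a)) = I a • A.one

/-- Density of `A` in `U(g)*`. -/
def IsDense : Prop := ∀ x : U g, x ≠ 0 → ∃ a ∈ A.toSubmodule, a x ≠ 0

/-- The product of `A*`: the graded transpose of the coproduct of `A`. -/
def formMul (φ ψ : Module.Dual ℂ A.toSubmodule) : Module.Dual ℂ A.toSubmodule :=
  superPairing A.parity (φ ⊗ₜ ψ) ∘ₗ A.comul

/-- The natural map `ν` from `U(g)` to `A*`, with `⟨ν x, a⟩ = (-1) ^ ([x] [a]) a x`. (As `a x`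
vanishes unless `[a] = [x]`, this is `a (σ x)`, where `σ` is the parity automorphism.) -/
def nu (x : U g) : Module.Dual ℂ A.toSubmodule :=
  Module.Dual.eval ℂ (U g) (σ g x) ∘ₗ A.toSubmodule.subtype

end SubHopfSuperalgebra

variable (g) in
/-- The homomorphism `U(g₀) → U(g)` induced by the inclusion of the even part `g₀` in `g`. -/
def evenInclusion : U (evenPart g) →ₐ[ℂ] U g :=
  lift (ι g ∘ₗ (evenPart g).subtype) fun α β x hx y hy => by
    simp only [LinearMap.comp_apply]
    rcases zmod_two_cases α with rfl | rfl
    · rcases zmod_two_cases β with rfl | rfl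
      · exact ι_rel x.2 y.2
      · rw [eq_zero_of_mem_homog_id hy]
        simp
    · rw [eq_zero_of_mem_homog_id hx]
      simp

variable (g) in
/-- The transpose `𝒫 : U(g)* → U(g₀)*` of the map `U(g₀) → U(g)`. -/
def evenRestriction : Module.Dual ℂ (U g) →ₗ[ℂ] Module.Dual ℂ (U (evenPart g)) :=
  (evenInclusion g).toLinearMap.dualMap

/-- The restriction of `𝒫` to a map from `A` to `Ae`, for `Ae = 𝒫(A)`. -/
def restrictToEven (A : SubHopfSuperalgebra g) (Ae : SubHopfSuperalgebra (evenPart g))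
    (h : Ae.toSubmodule = A.toSubmodule.map (evenRestriction g)) :
    A.toSubmodule →ₗ[ℂ] Ae.toSubmodule :=
  (evenRestriction g).restrict fun _ ha => h ▸ Submodule.mem_map_of_mem ha

end Dual

/-! ### The Lie superalgebra `osp(2|2n)` -/

section Osp

/-- The index set of the standard basis of `ℂ^(2|2n)`. -/
abbrev Idx (n : ℕ) : Type := Fin 2 ⊕ (Fin n ⊕ Fin n)

/-- The algebra of linear operators on `ℂ^(2|2n)`. -/
abbrev Mat (n : ℕ) : Type := Matrix (Idx n) (Idx n) ℂ

/-- The degrees of the basis vectors. -/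
def deg {n : ℕ} : Idx n → ZMod 2 := Sum.elim (fun _ => 0) (fun _ => 1)

/-- The matrix `diag(1, -1)` of the parity automorphism of `ℂ^(2|2n)`. -/
def parityMatrix (n : ℕ) : Mat n := Matrix.diagonal fun a => sgn (deg a)

theorem parityMatrix_mul_self (n : ℕ) : parityMatrix n * parityMatrix n = 1 := by
  simp [parityMatrix, sgn_mul_self]

/-- The parity automorphism `X ↦ D X D` of the algebra of operators on `ℂ^(2|2n)`, where
`D = diag(1, -1)`. -/
def matParity (n : ℕ) : Mat n →ₗ[ℂ] Mat n :=
  LinearMap.mulLeft ℂ (parityMatrix n) ∘ₗ LinearMap.mulRight ℂ (parityMatrix n)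

theorem matParity_apply {n : ℕ} (X : Mat n) :
    matParity n X = parityMatrix n * X * parityMatrix n := by
  simp [matParity, mul_assoc]

theorem matParity_matParity {n : ℕ} (X : Mat n) : matParity n (matParity n X) = X := by
  rw [matParity_apply, matParity_apply]
  simp only [mul_assoc]
  rw [parityMatrix_mul_self, mul_one, ← mul_assoc, parityMatrix_mul_self, one_mul]

theorem matParity_mul {n : ℕ} (X Y : Mat n) :
    matParity n (X * Y) = matParity n X * matParity n Y := by
  simp only [matParity_apply, mul_assoc]
  rw [← mul_assoc (parityMatrix n) (parityMatrix n), parityMatrix_mul_self, one_mul]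

/-- The Gram matrix of the supersymmetric bilinear form `B` on `ℂ^(2|2n)`: symmetric on the even
part, skew-symmetric on the odd part. -/
def form (n : ℕ) : Mat n := Matrix.fromBlocks !![0, 1; 1, 0] 0 0 (Matrix.J (Fin n) ℂ)

/-- `osp(2|2n)`: the operators `X` whose homogeneous components `X_α` satisfy
`B(X_α e_a, e_b) + (-1) ^ (α [a]) B(e_a, X_α e_b) = 0`. -/
def osp (n : ℕ) : Submodule ℂ (Mat n) where
  carrier := {X | ∀ α a b, ((proj (matParity n) α X).transpose * form n) a b +
    sgn (α * deg a) * (form n * proj (matParity n) α X) a b = 0}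
  add_mem' {X Y} hX hY α a b := by
    have h1 := hX α a b
    have h2 := hY α a b
    simp only [map_add, Matrix.transpose_add, Matrix.add_mul, Matrix.mul_add, Matrix.add_apply]
    linear_combination h1 + h2
  zero_mem' α a b := by simp
  smul_mem' c X hX α a b := by
    have h1 := hX α a b
    simp only [map_smul, Matrix.transpose_smul, Matrix.smul_mul, Matrix.mul_smul, Matrix.smul_apply,
      smul_eq_mul]
    linear_combination c * h1

theorem mem_osp {n : ℕ} {X : Mat n} : X ∈ osp n ↔ ∀ α a b,
    ((proj (matParity n) α X).transpose * form n) a b +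
      sgn (α * deg a) * (form n * proj (matParity n) α X) a b = 0 := Iff.rfl

theorem mem_osp_of_homog {n : ℕ} {α : ZMod 2} {X : Mat n} (hX : X ∈ homog (matParity n) α) :
    X ∈ osp n ↔ X.transpose * form n =
      -(Matrix.diagonal (fun a => sgn (α * deg a)) * (form n * X)) := by
  rw [mem_osp, ← Matrix.ext_iff]
  simp only [Matrix.neg_apply, Matrix.diagonal_mul]
  constructor
  · intro h a b
    have := h α a b
    rw [proj_of_mem hX, if_pos rfl] at this
    linear_combination this
  · intro h β a b
    rw [proj_of_mem hX]
    split_ifs with hβ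
    · subst hβ
      linear_combination h a b
    · simp

theorem proj_mem_osp {n : ℕ} {X : Mat n} (hX : X ∈ osp n) (α : ZMod 2) :
    proj (matParity n) α X ∈ osp n := by
  intro β a b
  rw [proj_of_mem (proj_mem matParity_matParity α X)]
  split_ifs with hβ
  · subst hβ
    exact hX β a b
  · simp

theorem matParity_mem_osp {n : ℕ} : ∀ X ∈ osp n, matParity n X ∈ osp n := by
  intro X hX
  rw [← sum_proj (matParity n) X, map_add,
    mem_homog.mp (proj_mem matParity_matParity 0 X),
    mem_homog.mp (proj_mem matParity_matParity 1 X)]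
  exact add_mem (Submodule.smul_mem _ _ (proj_mem_osp hX 0))
    (Submodule.smul_mem _ _ (proj_mem_osp hX 1))

theorem transpose_mul_diagonal {n : ℕ} {β : ZMod 2} {Y : Mat n} (hY : Y ∈ homog (matParity n) β)
    (α : ZMod 2) : Y.transpose * Matrix.diagonal (fun a => sgn (α * deg a)) =
      sgn (α * β) • (Matrix.diagonal (fun a => sgn (α * deg a)) * Y.transpose) := by
  rcases zmod_two_cases α with rfl | rfl
  · simp [sgn_zero]
  · have h := mem_homog.mp hY
    rw [matParity_apply] at h
    simp only [one_mul]
    change Y.transpose * parityMatrix n = sgn β • (parityMatrix n * Y.transpose)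
    have hD : (parityMatrix n).transpose = parityMatrix n := Matrix.diagonal_transpose _
    have h2 := congrArg (fun Z => (parityMatrix n * Z).transpose) h
    beta_reduce at h2
    rw [← mul_assoc, ← mul_assoc, parityMatrix_mul_self, one_mul, Matrix.transpose_mul,
      Matrix.transpose_mul, hD, Matrix.transpose_smul, Matrix.smul_mul] at h2
    have h3 := congrArg (fun Z => sgn β • (Z : Mat n)) h2
    simp only [smul_smul, sgn_mul_self, one_smul] at h3
    exact h3.symm

theorem superCommutator_mem_osp {n : ℕ} : ∀ X ∈ osp n, ∀ Y ∈ osp n,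
    superCommutator (matParity n) X Y ∈ osp n := by
  have key : ∀ α β, ∀ X ∈ osp n, X ∈ homog (matParity n) α → ∀ Y ∈ osp n,
      Y ∈ homog (matParity n) β → superCommutator (matParity n) X Y ∈ osp n := by
    intro α β X hX hXα Y hY hYβ
    have prod : ∀ {α β : ZMod 2} {X Y : Mat n}, X ∈ osp n → X ∈ homog (matParity n) α →
        Y ∈ osp n → Y ∈ homog (matParity n) β → (X * Y).transpose * form n =
          sgn (α * β) • (Matrix.diagonal (fun a => sgn ((α + β) * deg a)) *
            (form n * (Y * X))) := by
      intro α β X Y hX hXα hY hYβ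
      have hd : (Matrix.diagonal (fun a => sgn ((α + β) * deg a)) : Mat n) =
          Matrix.diagonal (fun a => sgn (α * deg a)) *
            Matrix.diagonal (fun a => sgn (β * deg a)) := by
        rw [Matrix.diagonal_mul_diagonal]
        simp [add_mul, sgn_add]
      rw [Matrix.transpose_mul, mul_assoc, (mem_osp_of_homog hXα).mp hX, mul_neg, ← mul_assoc,
        transpose_mul_diagonal hYβ, Matrix.smul_mul, mul_assoc, ← mul_assoc Y.transpose,
        (mem_osp_of_homog hYβ).mp hY, hd]
      simp only [Matrix.neg_mul, Matrix.mul_neg, smul_neg, neg_neg, mul_assoc]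
    rw [mem_osp_of_homog (superCommutator_mem matParity_mul hXα hYβ),
      superCommutator_apply hXα hYβ, Matrix.transpose_sub, Matrix.transpose_smul, Matrix.sub_mul,
      Matrix.smul_mul, prod hX hXα hY hYβ, prod hY hYβ hX hXα, mul_comm β α, add_comm β α,
      smul_smul, sgn_mul_self, one_smul]
    simp only [Matrix.mul_sub, Matrix.mul_smul]
    abel
  intro X hX Y hY
  rw [← sum_proj (matParity n) X, ← sum_proj (matParity n) Y]
  simp only [map_add, LinearMap.add_apply]
  have H := fun α β => key α β _ (proj_mem_osp hX α) (proj_mem matParity_matParity α X)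
    _ (proj_mem_osp hY β) (proj_mem matParity_matParity β Y)
  exact add_mem (add_mem (H _ _) (H _ _)) (add_mem (H _ _) (H _ _))

/-- The Lie superalgebra structure of `osp(2|2n)`. -/
instance (n : ℕ) : LieSuperalgebra (osp n) :=
  lieSuperalgebraOfSubmodule (matParity n) matParity_matParity matParity_mul (osp n)
    matParity_mem_osp superCommutator_mem_osp

/-- The generator `diag(1, -1, 0, …, 0)` of the center `gl(1)` of the even part of `osp(2|2n)`. -/
def center (n : ℕ) : Mat n := Matrix.diagonal (Sum.elim ![1, -1] 0)

/-- The subspace of the odd part of `osp(2|2n)` on which the center acts by the scalar `c`. The odd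
part is the direct sum of these subspaces for `c = 1` and `c = -1`. -/
def oddPart (n : ℕ) (c : ℂ) : Submodule ℂ (osp n) where
  carrier := {X | X ∈ homog (parity (g := osp n)) 1 ∧
    center n * (X : Mat n) - (X : Mat n) * center n = c • (X : Mat n)}
  add_mem' {X Y} hX hY := by
    refine ⟨add_mem hX.1 hY.1, ?_⟩
    rw [Submodule.coe_add, mul_add, add_mul, smul_add, ← hX.2, ← hY.2]
    abel
  zero_mem' := ⟨zero_mem _, by simp⟩
  smul_mem' k X hX := by
    refine ⟨Submodule.smul_mem _ _ hX.1, ?_⟩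
    rw [Submodule.coe_smul, mul_smul_comm, smul_mul_assoc, ← smul_sub, hX.2, smul_comm]

/-- The span in `U(osp(2|2n))` of the products of `2n` elements of `oddPart n c`, i.e., the subspace
of highest degree of the Grassmann algebra `U(oddPart n c)`. -/
def topDegree (n : ℕ) (c : ℂ) : Submodule ℂ (U (osp n)) :=
  (oddPart n c).map (U.ι (osp n)) ^ (2 * n)

/-- The defining representation of `osp(2|2n)`. -/
def vectorRep (n : ℕ) : U (osp n) →ₐ[ℂ] Mat n :=
  U.lift (osp n).subtype fun α β X hX Y hY =>
    have hX' : (X : Mat n) ∈ homog (matParity n) α :=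
      mem_homog.mpr (congrArg Subtype.val (mem_homog.mp hX))
    have hY' : (Y : Mat n) ∈ homog (matParity n) β :=
      mem_homog.mpr (congrArg Subtype.val (mem_homog.mp hY))
    (superCommutator_apply hX' hY').symm

/-- The matrix elements `t_ab` of the defining representation. -/
def t {n : ℕ} (a b : Idx n) : Module.Dual ℂ (U (osp n)) :=
  Matrix.entryLinearMap ℂ ℂ a b ∘ₗ (vectorRep n).toLinearMap

/-- The set of the odd matrix elements `t_iμ`. -/
def upperOdd (n : ℕ) : Set (Module.Dual ℂ (U (osp n))) :=
  Set.range fun p : Fin 2 × (Fin n ⊕ Fin n) => t (Sum.inl p.1) (Sum.inr p.2)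

/-- The set of the odd matrix elements `t_μi`. -/
def lowerOdd (n : ℕ) : Set (Module.Dual ℂ (U (osp n))) :=
  Set.range fun p : (Fin n ⊕ Fin n) × Fin 2 => t (Sum.inr p.1) (Sum.inl p.2)

end Osp

end OSP

set_option linter.unusedSectionVars false

/-! Linear forms on `U g` are handled through translations. Left and right translations by elements
of `g` are twisted derivations of the algebra `U(g)*`, and a form is zero as soon as all its
translates vanish at `1`. Every algebraic identity needed in `U(g)*` is proved in this way
(`dual_eq_zero_of_translR`). The matrix elements span a finite-dimensional space stable under
translations, parity and antipode, so the algebra they generate is a Hopf superalgebra.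

Density needs no PBW theorem. The vector representation is faithful on `g`, so the algebra contains
forms that vanish at `1` and restrict to coordinates on `g`. The transposes of multiplication by
these forms lower the degree in `U(g)`, and the Euler operator built from them is multiplication by
`k` in degree `k`, up to lower degree. The annihilator of the algebra is stable under these
transposes, hence is zero by induction on the degree (`eq_zero_of_contractL_mem`).

The integral on the even part is Weyl's unitary trick in algebraic form. The even part is stable
under the conjugate transpose, so its coordinate algebra consists of coefficients of star
representations. The image of the augmentation ideal in such a representation is a matrix algebra
stable under adjoints, hence has a unit (`exists_unit_of_star`), and the complementary idempotent
projects onto the invariants (`SubHopfSuperalgebra.exists_haar`).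

Let `E`, `F` be the top products of the odd generators of weight `1` and `-1`, and `Γ = E F`. The
even part acts on `E` and `F` by opposite scalars, so it commutes with `Γ`. The heart of the matter
is that `g Γ` lies in the left ideal `U g₀`, and `Γ g` in the right ideal `g₀ U`
(`ι_mul_gammaGen_mem`, `gammaGen_mul_ι_mem`). For `x` of weight `1` one has `x E = 0`. For `x` of
weight `-1`, commuting `x` through `E` gives `x Γ = w F` modulo `U g₀`, with `w` one degree below
the top in the weight `1` generators; multiplication by any such generator sends `w F` into `U g₀`,
and as `Γ` is not in `U g₀`, nondegeneracy of the Grassmann product forces `w = 0`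
(`Anticomm.mul_listProd_mul_mem`). The invariance of the even integral then gives the invariance of
the form with value `I₀ (𝒫 (a (Γ ·)))` at `a`.

All nonvanishing statements come from one computation: a top product `Θ` of odd matrix elements
pairs with `Γ` to a nonzero number, because the odd matrix elements are dual, up to scalars, to the
odd generators (`listProd_apply_listProd`). Since `g₀` has trace zero in the relevant actions, it
annihilates `Θ` by translations. Therefore `Γ` avoids both ideals, and the integral of `Θ` is `Θ Γ`
up to a nonzero factor (`gammaForm_eq`). -/

namespace OSP

open LieSuperalgebra U

/-! ### Coproduct of the enveloping algebra and translations of linear forms. -/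

section EnvelopingBasics

variable {g : Type} [AddCommGroup g] [Module ℂ g] [LieSuperalgebra g]

namespace U

theorem adjoin_range_ι : Algebra.adjoin ℂ (Set.range (ι g)) = ⊤ := by
  let S := Algebra.adjoin ℂ (Set.range (ι g))
  let f : g →ₗ[ℂ] S := (ι g).codRestrict (Subalgebra.toSubmodule S)
    fun x => Algebra.subset_adjoin ⟨x, rfl⟩
  let F : U g →ₐ[ℂ] S := lift f fun α β x hx y hy => Subtype.ext (ι_rel hx hy)
  have h : S.val.comp F = AlgHom.id ℂ (U g) := by
    apply algHom_ext
    intro x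
    simp [F, f]
    rfl
  rw [eq_top_iff]
  intro u _
  have := DFunLike.congr_fun h u
  rw [AlgHom.id_apply] at this
  rw [← this]
  exact (F u).2

/-- A subspace that contains `1` and is stable under left multiplication by homogeneous elements
of `g` is everything. -/
theorem eq_top_of_mul_left {W : Submodule ℂ (U g)} (h1 : (1 : U g) ∈ W)
    (hW : ∀ α, ∀ x ∈ homog (parity (g := g)) α, ∀ w ∈ W, ι g x * w ∈ W) : W = ⊤ := by
  rw [eq_top_iff]
  rintro u -
  suffices h : ∀ w ∈ W, u * w ∈ W by simpa using h 1 h1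
  have hu : u ∈ Algebra.adjoin ℂ (Set.range (ι g)) := by rw [adjoin_range_ι]; trivial
  induction hu using Algebra.adjoin_induction with
  | mem u hu =>
    obtain ⟨x, rfl⟩ := hu
    intro w hw
    rw [← sum_proj parity x, map_add, add_mul]
    exact add_mem (hW 0 _ (proj_mem parity_parity 0 x) w hw)
      (hW 1 _ (proj_mem parity_parity 1 x) w hw)
  | algebraMap r =>
    intro w hw
    rw [← Algebra.smul_def]
    exact W.smul_mem _ hw
  | add u v _ _ hu hv =>
    intro w hw
    rw [add_mul]
    exact add_mem (hu w hw) (hv w hw)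
  | mul u v _ _ hu hv =>
    intro w hw
    rw [mul_assoc]
    exact hu _ (hv w hw)

theorem eq_top_of_mul_right {W : Submodule ℂ (U g)} (h1 : (1 : U g) ∈ W)
    (hW : ∀ α, ∀ x ∈ homog (parity (g := g)) α, ∀ w ∈ W, w * ι g x ∈ W) : W = ⊤ := by
  rw [eq_top_iff]
  rintro u -
  suffices h : ∀ w ∈ W, w * u ∈ W by simpa using h 1 h1
  have hu : u ∈ Algebra.adjoin ℂ (Set.range (ι g)) := by rw [adjoin_range_ι]; trivial
  induction hu using Algebra.adjoin_induction with
  | mem u hu =>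
    obtain ⟨x, rfl⟩ := hu
    intro w hw
    rw [← sum_proj parity x, map_add, mul_add]
    exact add_mem (hW 0 _ (proj_mem parity_parity 0 x) w hw)
      (hW 1 _ (proj_mem parity_parity 1 x) w hw)
  | algebraMap r =>
    intro w hw
    rw [← Algebra.commutes, ← Algebra.smul_def]
    exact W.smul_mem _ hw
  | add u v _ _ hu hv =>
    intro w hw
    rw [mul_add]
    exact add_mem (hu w hw) (hv w hw)
  | mul u v _ _ hu hv =>
    intro w hw
    rw [← mul_assoc]
    exact hv _ (hu w hw)

/-- The automorphism `u ↦ (-1) ^ (α [u]) u` of `U(g)`. -/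
def tw (α : ZMod 2) : U g →ₐ[ℂ] U g := if α = 0 then AlgHom.id ℂ _ else parityHom

@[simp] theorem tw_zero : tw (g := g) 0 = AlgHom.id ℂ _ := if_pos rfl

theorem tw_one : tw (g := g) 1 = parityHom := if_neg one_ne_zero

theorem tw_of_mem (α : ZMod 2) {β : ZMod 2} {u : U g} (hu : u ∈ homog (σ g) β) :
    tw α u = sgn (α * β) • u := by
  rcases zmod_two_cases α with rfl | rfl
  · simp [sgn_zero]
  · rw [tw_one, one_mul, ← mem_homog.mp hu]
    rfl

theorem tw_ι (α : ZMod 2) {β : ZMod 2} {x : g} (hx : x ∈ homog (parity (g := g)) β) :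
    tw α (ι g x) = sgn (α * β) • ι g x := tw_of_mem α (ι_mem hx)

theorem tw_tw (α : ZMod 2) (u : U g) : tw α (tw α u) = u := by
  rcases zmod_two_cases α with rfl | rfl
  · simp
  · rw [tw_one, parityHom_parityHom]

theorem tw_mem (α : ZMod 2) {β : ZMod 2} {u : U g} (hu : u ∈ homog (σ g) β) :
    tw α u ∈ homog (σ g) β := by
  rw [tw_of_mem α hu]
  exact Submodule.smul_mem _ _ hu

theorem σ_mul (u v : U g) : σ g (u * v) = σ g u * σ g v := map_mul parityHom u v

theorem mul_mem_gr {α β : ZMod 2} {u v : U g} (hu : u ∈ homog (σ g) α) (hv : v ∈ homog (σ g) β) :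
    u * v ∈ homog (σ g) (α + β) := mul_mem_homog σ_mul hu hv

theorem one_mem_gr : (1 : U g) ∈ homog (σ g) 0 := by
  rw [mem_homog, sgn_zero, one_smul]
  exact map_one parityHom

theorem ext_tensor {W : Type} [AddCommGroup W] [Module ℂ W] {F G : U g ⊗[ℂ] U g →ₗ[ℂ] W}
    (H : ∀ α β, ∀ u ∈ homog (σ g) α, ∀ v ∈ homog (σ g) β, F (u ⊗ₜ v) = G (u ⊗ₜ v)) : F = G := by
  apply TensorProduct.ext
  refine ext_homog σ_σ fun α u hu => ?_
  refine ext_homog σ_σ fun β v hv => ?_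
  exact H α β u hu v hv

open GradedTensorProduct

theorem gradedTensor_mul {α β γ δ : ZMod 2} {a b c d : U g} (_ : a ∈ homog (σ g) α)
    (hb : b ∈ homog (σ g) β) (hc : c ∈ homog (σ g) γ) (_ : d ∈ homog (σ g) δ) :
    ((a ᵍ⊗ₜ[ℂ] b) * (c ᵍ⊗ₜ[ℂ] d) : gr g ᵍ⊗[ℂ] gr g) =
      sgn (β * γ) • ((a * c) ᵍ⊗ₜ[ℂ] (b * d)) := by
  have h := tmul_coe_mul_coe_tmul (R := ℂ) (gr g) (gr g) a ⟨b, hb⟩ ⟨c, hc⟩ d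
  refine h.trans ?_
  rcases zmod_two_cases β with rfl | rfl <;> rcases zmod_two_cases γ with rfl | rfl <;>
    simp [sgn_zero, sgn_one]

theorem comulₗ_apply (u : U g) : comulₗ u = (of ℂ (gr g) (gr g)).symm (comul u) := rfl

@[simp] theorem comulₗ_one : comulₗ (1 : U g) = 1 ⊗ₜ 1 := by
  rw [comulₗ_apply, map_one]
  rfl

theorem comul_ι (x : g) : comul (ι g x) =
    ((ι g x) ᵍ⊗ₜ[ℂ] (1 : U g) + (1 : U g) ᵍ⊗ₜ[ℂ] (ι g x) : gr g ᵍ⊗[ℂ] gr g) := by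
  rw [comul, lift_ι]
  rfl

/-- The coproduct is multiplicative for the graded tensor product; the factor `tw α` is the sign
produced when `x` in the second slot passes the first tensor factor. Together with the value at `1`,
this recursion is all that is used of the coproduct on the left side. -/
theorem comulₗ_ι_mul {α : ZMod 2} {x : g} (hx : x ∈ homog (parity (g := g)) α) (u : U g) :
    comulₗ (ι g x * u) =
      TensorProduct.map (LinearMap.mulLeft ℂ (ι g x)) LinearMap.id (comulₗ u) +
      TensorProduct.map (tw α).toLinearMap (LinearMap.mulLeft ℂ (ι g x)) (comulₗ u) := by
  have key : (of ℂ (gr g) (gr g)).symm.toLinearMap ∘ₗ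
      LinearMap.mulLeft ℂ (comul (ι g x)) ∘ₗ (of ℂ (gr g) (gr g)).toLinearMap =
      TensorProduct.map (LinearMap.mulLeft ℂ (ι g x)) LinearMap.id +
      TensorProduct.map (tw α).toLinearMap (LinearMap.mulLeft ℂ (ι g x)) := by
    refine ext_tensor fun β γ u hu v hv => ?_
    have h1 := gradedTensor_mul (ι_mem hx) one_mem_gr hu hv
    have h2 := gradedTensor_mul one_mem_gr (ι_mem hx) hu hv
    simp only [LinearMap.comp_apply, LinearMap.mulLeft_apply, LinearMap.add_apply,
      TensorProduct.map_tmul, LinearMap.id_apply, AlgHom.toLinearMap_apply, tw_of_mem α hu]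
    rw [comul_ι, add_mul]
    change (of ℂ (gr g) (gr g)).symm _ = _
    rw [map_add]
    refine congrArg₂ (· + ·) ?_ ?_
    · refine (congrArg (of ℂ (gr g) (gr g)).symm h1).trans ?_
      simp only [zero_mul, sgn_zero, one_smul, one_mul]
      rfl
    · refine (congrArg (of ℂ (gr g) (gr g)).symm h2).trans ?_
      rw [one_mul, ← TensorProduct.smul_tmul']
      rfl
  have := LinearMap.congr_fun key (comulₗ u)
  rw [LinearMap.add_apply] at this
  rw [← this, comulₗ_apply, map_mul]
  rfl

theorem comulₗ_mul_ι {α : ZMod 2} {x : g} (hx : x ∈ homog (parity (g := g)) α) (u : U g) :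
    comulₗ (u * ι g x) =
      TensorProduct.map (LinearMap.mulRight ℂ (ι g x)) (tw α).toLinearMap (comulₗ u) +
      TensorProduct.map LinearMap.id (LinearMap.mulRight ℂ (ι g x)) (comulₗ u) := by
  have key : (of ℂ (gr g) (gr g)).symm.toLinearMap ∘ₗ
      LinearMap.mulRight ℂ (comul (ι g x)) ∘ₗ (of ℂ (gr g) (gr g)).toLinearMap =
      TensorProduct.map (LinearMap.mulRight ℂ (ι g x)) (tw α).toLinearMap +
      TensorProduct.map LinearMap.id (LinearMap.mulRight ℂ (ι g x)) := by
    refine ext_tensor fun β γ u hu v hv => ?_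
    have h1 := gradedTensor_mul hu hv (ι_mem hx) one_mem_gr
    have h2 := gradedTensor_mul hu hv one_mem_gr (ι_mem hx)
    simp only [LinearMap.comp_apply, LinearMap.mulRight_apply, LinearMap.add_apply,
      TensorProduct.map_tmul, LinearMap.id_apply, AlgHom.toLinearMap_apply, tw_of_mem α hv]
    rw [comul_ι]
    change (of ℂ (gr g) (gr g)).symm _ = _
    rw [mul_add, map_add]
    refine congrArg₂ (· + ·) ?_ ?_
    · refine (congrArg (of ℂ (gr g) (gr g)).symm h1).trans ?_
      rw [mul_one, TensorProduct.tmul_smul, mul_comm γ α]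
      rfl
    · refine (congrArg (of ℂ (gr g) (gr g)).symm h2).trans ?_
      simp only [mul_zero, sgn_zero, one_smul, mul_one]
      rfl
  have := LinearMap.congr_fun key (comulₗ u)
  rw [LinearMap.add_apply] at this
  rw [← this, comulₗ_apply, map_mul]
  rfl

@[simp] theorem counit_ι (x : g) : counit (ι g x) = 0 := by simp [counit]

theorem counit_tw (α : ZMod 2) (u : U g) : counit (tw α u) = counit u := by
  rcases zmod_two_cases α with rfl | rfl
  · simp
  · rw [tw_one]
    suffices h : counit.comp parityHom = counit (g := g) from DFunLike.congr_fun h u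
    apply algHom_ext
    intro x
    simp [parityHom]

/-- The linear form `f (x ·)`. -/
def translL (x : U g) : Module.Dual ℂ (U g) →ₗ[ℂ] Module.Dual ℂ (U g) :=
  (LinearMap.mulLeft ℂ x).dualMap

/-- The linear form `f (· x)`. -/
def translR (x : U g) : Module.Dual ℂ (U g) →ₗ[ℂ] Module.Dual ℂ (U g) :=
  (LinearMap.mulRight ℂ x).dualMap

/-- The linear form `f ∘ tw α`. -/
def dtw (α : ZMod 2) : Module.Dual ℂ (U g) →ₗ[ℂ] Module.Dual ℂ (U g) :=
  (tw α).toLinearMap.dualMap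

@[simp] theorem translL_apply (x : U g) (f : Module.Dual ℂ (U g)) (u : U g) :
    translL x f u = f (x * u) := rfl

@[simp] theorem translR_apply (x : U g) (f : Module.Dual ℂ (U g)) (u : U g) :
    translR x f u = f (u * x) := rfl

@[simp] theorem dtw_apply (α : ZMod 2) (f : Module.Dual ℂ (U g)) (u : U g) :
    dtw α f u = f (tw α u) := rfl

theorem dtw_zero (f : Module.Dual ℂ (U g)) : dtw 0 f = f := by
  ext u
  simp

theorem dtw_one (f : Module.Dual ℂ (U g)) : dtw 1 f = f ∘ₗ σ g := by
  ext u
  simp [tw_one]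

theorem dtw_dtw (α : ZMod 2) (f : Module.Dual ℂ (U g)) : dtw α (dtw α f) = f := by
  ext u
  simp [tw_tw]

/-- The linear map `u ↦ ∑ ± f u₁ u₂`, the transpose of left multiplication by `f`. -/
def contractL (f : Module.Dual ℂ (U g)) : U g →ₗ[ℂ] U g :=
  (TensorProduct.lid ℂ (U g)).toLinearMap ∘ₗ TensorProduct.map f LinearMap.id ∘ₗ
    superTwist (σ g) ∘ₗ comulₗ

theorem dualMul_apply_eq (f h : Module.Dual ℂ (U g)) (u : U g) :
    dualMul f h u = TensorProduct.dualDistrib ℂ _ _ (f ⊗ₜ h) (superTwist (σ g) (comulₗ u)) := rfl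

/-- Contraction by `f` is the transpose of left multiplication by `f`. Hence the annihilator of an
algebra of forms is stable under contraction by its members, which is what the density argument
needs. -/
theorem apply_contractL (f h : Module.Dual ℂ (U g)) (u : U g) :
    h (contractL f u) = dualMul f h u := by
  rw [dualMul_apply_eq]
  simp only [contractL, LinearMap.comp_apply]
  generalize superTwist (σ g) (comulₗ u) = T
  induction T with
  | zero => simp
  | tmul x y => simp
  | add x y hx hy => simp only [map_add, hx, hy]

/-- Passing to the sign convention of the ungraded pairing moves the parity twist from the term with
`x` in the second slot to the term with `x` in the first slot. -/
theorem superTwist_ι_mul {α : ZMod 2} {x : g} (hx : x ∈ homog (parity (g := g)) α) (u : U g) :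
    superTwist (σ g) (comulₗ (ι g x * u)) =
      TensorProduct.map (LinearMap.mulLeft ℂ (ι g x)) (tw α).toLinearMap
        (superTwist (σ g) (comulₗ u)) +
      TensorProduct.map LinearMap.id (LinearMap.mulLeft ℂ (ι g x))
        (superTwist (σ g) (comulₗ u)) := by
  rw [comulₗ_ι_mul hx, map_add]
  generalize comulₗ u = T
  refine congrArg₂ (· + ·) ?_ ?_
  · suffices h : superTwist (σ g) ∘ₗ
        TensorProduct.map (LinearMap.mulLeft ℂ (ι g x)) LinearMap.id =
        TensorProduct.map (LinearMap.mulLeft ℂ (ι g x)) (tw α).toLinearMap ∘ₗ superTwist (σ g)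
      from LinearMap.congr_fun h T
    refine ext_tensor fun β γ u hu v hv => ?_
    simp only [LinearMap.comp_apply, TensorProduct.map_tmul, LinearMap.mulLeft_apply,
      LinearMap.id_apply, superTwist_tmul hu hv, map_smul, AlgHom.toLinearMap_apply]
    rw [superTwist_tmul (mul_mem_gr (ι_mem hx) hu) hv, tw_of_mem α hv, TensorProduct.tmul_smul,
      smul_smul, add_mul, sgn_add, mul_comm]
  · suffices h : superTwist (σ g) ∘ₗ
        TensorProduct.map (tw α).toLinearMap (LinearMap.mulLeft ℂ (ι g x)) =
        TensorProduct.map LinearMap.id (LinearMap.mulLeft ℂ (ι g x)) ∘ₗ superTwist (σ g)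
      from LinearMap.congr_fun h T
    refine ext_tensor fun β γ u hu v hv => ?_
    simp only [LinearMap.comp_apply, TensorProduct.map_tmul, LinearMap.mulLeft_apply,
      LinearMap.id_apply, superTwist_tmul hu hv, map_smul, AlgHom.toLinearMap_apply]
    rw [superTwist_tmul (tw_mem α hu) (mul_mem_gr (ι_mem hx) hv), tw_of_mem α hu,
      ← TensorProduct.smul_tmul', smul_smul, mul_add, sgn_add, mul_comm β α, mul_right_comm,
      sgn_mul_self, one_mul]

theorem superTwist_mul_ι {α : ZMod 2} {x : g} (hx : x ∈ homog (parity (g := g)) α) (u : U g) :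
    superTwist (σ g) (comulₗ (u * ι g x)) =
      TensorProduct.map (LinearMap.mulRight ℂ (ι g x)) LinearMap.id
        (superTwist (σ g) (comulₗ u)) +
      TensorProduct.map (tw α).toLinearMap (LinearMap.mulRight ℂ (ι g x))
        (superTwist (σ g) (comulₗ u)) := by
  rw [comulₗ_mul_ι hx, map_add]
  generalize comulₗ u = T
  refine congrArg₂ (· + ·) ?_ ?_
  · suffices h : superTwist (σ g) ∘ₗ
        TensorProduct.map (LinearMap.mulRight ℂ (ι g x)) (tw α).toLinearMap =
        TensorProduct.map (LinearMap.mulRight ℂ (ι g x)) LinearMap.id ∘ₗ superTwist (σ g)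
      from LinearMap.congr_fun h T
    refine ext_tensor fun β γ u hu v hv => ?_
    simp only [LinearMap.comp_apply, TensorProduct.map_tmul, LinearMap.mulRight_apply,
      LinearMap.id_apply, superTwist_tmul hu hv, map_smul, AlgHom.toLinearMap_apply]
    rw [superTwist_tmul (mul_mem_gr hu (ι_mem hx)) (tw_mem α hv), tw_of_mem α hv,
      TensorProduct.tmul_smul, smul_smul, add_mul, sgn_add, mul_assoc, sgn_mul_self, mul_one]
  · suffices h : superTwist (σ g) ∘ₗ
        TensorProduct.map LinearMap.id (LinearMap.mulRight ℂ (ι g x)) =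
        TensorProduct.map (tw α).toLinearMap (LinearMap.mulRight ℂ (ι g x)) ∘ₗ superTwist (σ g)
      from LinearMap.congr_fun h T
    refine ext_tensor fun β γ u hu v hv => ?_
    simp only [LinearMap.comp_apply, TensorProduct.map_tmul, LinearMap.mulRight_apply,
      LinearMap.id_apply, superTwist_tmul hu hv, map_smul, AlgHom.toLinearMap_apply]
    rw [superTwist_tmul hu (mul_mem_gr hv (ι_mem hx)), tw_of_mem α hu,
      ← TensorProduct.smul_tmul', smul_smul, mul_add, sgn_add, mul_comm β α]

theorem dualDistrib_map {V : Type} [AddCommGroup V] [Module ℂ V]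
    (p q : V →ₗ[ℂ] V) (f h : Module.Dual ℂ V) (T : V ⊗[ℂ] V) :
    TensorProduct.dualDistrib ℂ _ _ (f ⊗ₜ h) (TensorProduct.map p q T) =
      TensorProduct.dualDistrib ℂ _ _ ((f ∘ₗ p) ⊗ₜ (h ∘ₗ q)) T := by
  induction T with
  | zero => simp
  | tmul x y => simp
  | add x y hx hy => simp only [map_add, hx, hy]

theorem contractL_one (f : Module.Dual ℂ (U g)) : contractL f 1 = f 1 • 1 := by
  simp [contractL, superTwist_tmul one_mem_gr one_mem_gr, sgn_zero]

/-- A Leibniz rule: either `f` absorbs `x`, or `x` is left in front. The degree estimates for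
contractions all rest on it. -/
theorem contractL_ι_mul {α : ZMod 2} {x : g} (hx : x ∈ homog (parity (g := g)) α)
    (f : Module.Dual ℂ (U g)) (u : U g) :
    contractL f (ι g x * u) = tw α (contractL (translL (ι g x) f) u) + ι g x * contractL f u := by
  simp only [contractL, LinearMap.comp_apply]
  rw [superTwist_ι_mul hx]
  generalize superTwist (σ g) (comulₗ u) = T
  induction T with
  | zero => simp
  | tmul x y => simp
  | add x y hx hy =>
    simp only [map_add, mul_add] at hx hy ⊢
    rw [add_add_add_comm, hx, hy, add_add_add_comm]

theorem dualMul_apply_one (f h : Module.Dual ℂ (U g)) : dualMul f h 1 = f 1 * h 1 := by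
  simp [dualMul_apply_eq, superTwist_tmul one_mem_gr one_mem_gr, sgn_zero]

/-- Left translation by `x` is a twisted derivation, with the twist on the right factor; for right
translations the twist is on the left factor. -/
theorem translL_dualMul {α : ZMod 2} {x : g} (hx : x ∈ homog (parity (g := g)) α)
    (f h : Module.Dual ℂ (U g)) : translL (ι g x) (dualMul f h) =
      dualMul (translL (ι g x) f) (dtw α h) + dualMul f (translL (ι g x) h) := by
  ext u
  rw [LinearMap.add_apply, translL_apply, dualMul_apply_eq, superTwist_ι_mul hx, map_add,
    dualDistrib_map, dualDistrib_map]
  rfl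

theorem translR_dualMul {α : ZMod 2} {x : g} (hx : x ∈ homog (parity (g := g)) α)
    (f h : Module.Dual ℂ (U g)) : translR (ι g x) (dualMul f h) =
      dualMul (translR (ι g x) f) h + dualMul (dtw α f) (translR (ι g x) h) := by
  ext u
  rw [LinearMap.add_apply, translR_apply, dualMul_apply_eq, superTwist_mul_ι hx, map_add,
    dualDistrib_map, dualDistrib_map]
  rfl

end U

end EnvelopingBasics

/-! ### The dual of the enveloping algebra as a supercommutative algebra. -/

section DualAlgebra

variable {g : Type} [AddCommGroup g] [Module ℂ g] [LieSuperalgebra g]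

namespace U

/-- A form is determined by the values at `1` of its iterated translates. To prove an identity one
takes for `S` the set of all differences of its two sides, over all values of the variables. What
remains is to evaluate at `1` and to write the translate of a difference as a combination of
differences. -/
theorem dual_eq_zero_of_translR {S : Set (Module.Dual ℂ (U g))} (h1 : ∀ f ∈ S, f 1 = 0)
    (hS : ∀ α, ∀ x ∈ homog (parity (g := g)) α, ∀ f ∈ S,
      translR (ι g x) f ∈ Submodule.span ℂ S) : ∀ f ∈ S, f = 0 := by
  have h1' : ∀ f ∈ Submodule.span ℂ S, f 1 = 0 := by
    intro f hf
    induction hf using Submodule.span_induction with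
    | mem f hf => exact h1 f hf
    | zero => rfl
    | add f h _ _ hf hh => simp [hf, hh]
    | smul c f _ hf => simp [hf]
  have hS' : ∀ α, ∀ x ∈ homog (parity (g := g)) α, ∀ f ∈ Submodule.span ℂ S,
      translR (ι g x) f ∈ Submodule.span ℂ S := by
    intro α x hx f hf
    induction hf using Submodule.span_induction with
    | mem f hf => exact hS α x hx f hf
    | zero => simp
    | add f h _ _ hf hh => rw [map_add]; exact add_mem hf hh
    | smul c f _ hf => rw [map_smul]; exact Submodule.smul_mem _ _ hf
  let W : Submodule ℂ (U g) :=
    { carrier := {u | ∀ f ∈ Submodule.span ℂ S, f u = 0}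
      add_mem' := fun ha hb f hf => by rw [map_add, ha f hf, hb f hf, add_zero]
      zero_mem' := fun f _ => map_zero f
      smul_mem' := fun c u hu f hf => by rw [map_smul, hu f hf, smul_zero] }
  have hW : W = ⊤ := eq_top_of_mul_right h1' fun α x hx w hw f hf => hw _ (hS' α x hx f hf)
  intro f hf
  ext u
  have hu : u ∈ W := hW ▸ trivial
  exact hu f (Submodule.subset_span hf)

theorem dual_eq_zero_of_translL {S : Set (Module.Dual ℂ (U g))} (h1 : ∀ f ∈ S, f 1 = 0)
    (hS : ∀ α, ∀ x ∈ homog (parity (g := g)) α, ∀ f ∈ S,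
      translL (ι g x) f ∈ Submodule.span ℂ S) : ∀ f ∈ S, f = 0 := by
  have h1' : ∀ f ∈ Submodule.span ℂ S, f 1 = 0 := by
    intro f hf
    induction hf using Submodule.span_induction with
    | mem f hf => exact h1 f hf
    | zero => rfl
    | add f h _ _ hf hh => simp [hf, hh]
    | smul c f _ hf => simp [hf]
  have hS' : ∀ α, ∀ x ∈ homog (parity (g := g)) α, ∀ f ∈ Submodule.span ℂ S,
      translL (ι g x) f ∈ Submodule.span ℂ S := by
    intro α x hx f hf
    induction hf using Submodule.span_induction with
    | mem f hf => exact hS α x hx f hf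
    | zero => simp
    | add f h _ _ hf hh => rw [map_add]; exact add_mem hf hh
    | smul c f _ hf => rw [map_smul]; exact Submodule.smul_mem _ _ hf
  let W : Submodule ℂ (U g) :=
    { carrier := {u | ∀ f ∈ Submodule.span ℂ S, f u = 0}
      add_mem' := fun ha hb f hf => by rw [map_add, ha f hf, hb f hf, add_zero]
      zero_mem' := fun f _ => map_zero f
      smul_mem' := fun c u hu f hf => by rw [map_smul, hu f hf, smul_zero] }
  have hW : W = ⊤ := eq_top_of_mul_left h1' fun α x hx w hw f hf => hw _ (hS' α x hx f hf)
  intro f hf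
  ext u
  have hu : u ∈ W := hW ▸ trivial
  exact hu f (Submodule.subset_span hf)

theorem dualMul_add (f h k : Module.Dual ℂ (U g)) :
    dualMul f (h + k) = dualMul f h + dualMul f k := by
  simp only [dualMul, TensorProduct.tmul_add, map_add, LinearMap.add_comp]

theorem add_dualMul (f h k : Module.Dual ℂ (U g)) :
    dualMul (f + h) k = dualMul f k + dualMul h k := by
  simp only [dualMul, TensorProduct.add_tmul, map_add, LinearMap.add_comp]

theorem dualMul_smul (c : ℂ) (f h : Module.Dual ℂ (U g)) :
    dualMul f (c • h) = c • dualMul f h := by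
  simp only [dualMul, TensorProduct.tmul_smul, map_smul, LinearMap.smul_comp]

theorem smul_dualMul (c : ℂ) (f h : Module.Dual ℂ (U g)) :
    dualMul (c • f) h = c • dualMul f h := by
  simp only [dualMul, ← TensorProduct.smul_tmul', map_smul, LinearMap.smul_comp]

theorem zero_dualMul (f : Module.Dual ℂ (U g)) : dualMul 0 f = 0 := by
  simpa using smul_dualMul 0 0 f

theorem dualMul_zero (f : Module.Dual ℂ (U g)) : dualMul f 0 = 0 := by
  simpa using dualMul_smul 0 f 0

theorem dualOne_apply (u : U g) : (dualOne : Module.Dual ℂ (U g)) u = counit u := rfl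

theorem translR_dualOne (x : g) : translR (ι g x) dualOne = 0 := by
  ext u
  simp [dualOne_apply]

theorem translL_dualOne (x : g) : translL (ι g x) dualOne = 0 := by
  ext u
  simp [dualOne_apply]

theorem dtw_dualOne (α : ZMod 2) : dtw α (dualOne : Module.Dual ℂ (U g)) = dualOne := by
  ext u
  simp [dualOne_apply, counit_tw]

theorem translR_dtw (α : ZMod 2) {β : ZMod 2} {x : g} (hx : x ∈ homog (parity (g := g)) β)
    (f : Module.Dual ℂ (U g)) :
    translR (ι g x) (dtw α f) = sgn (α * β) • dtw α (translR (ι g x) f) := by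
  ext u
  simp [tw_ι α hx]

theorem dtw_dualMul (α : ZMod 2) (f h : Module.Dual ℂ (U g)) :
    dtw α (dualMul f h) = dualMul (dtw α f) (dtw α h) := by
  have H := dual_eq_zero_of_translR (g := g)
    (S := {F | ∃ f h, F = dtw α (dualMul f h) - dualMul (dtw α f) (dtw α h)}) ?_ ?_ _ ⟨f, h, rfl⟩
  · exact sub_eq_zero.mp H
  · rintro _ ⟨f, h, rfl⟩
    simp [dualMul_apply_one]
  · rintro β x hx _ ⟨f, h, rfl⟩
    have e : translR (ι g x) (dtw α (dualMul f h) - dualMul (dtw α f) (dtw α h)) =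
        sgn (α * β) • (dtw α (dualMul (translR (ι g x) f) h) -
          dualMul (dtw α (translR (ι g x) f)) (dtw α h)) +
        sgn (α * β) • (dtw α (dualMul (dtw β f) (translR (ι g x) h)) -
          dualMul (dtw α (dtw β f)) (dtw α (translR (ι g x) h))) := by
      have hc : dtw β (dtw α f) = dtw α (dtw β f) := by
        rcases zmod_two_cases α with rfl | rfl <;> rcases zmod_two_cases β with rfl | rfl <;>
          simp [dtw_zero]
      rw [map_sub, translR_dtw α hx, translR_dualMul hx, translR_dualMul hx, translR_dtw α hx,
        translR_dtw α hx, map_add, smul_dualMul, dualMul_smul, hc]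
      module
    rw [e]
    exact add_mem (Submodule.smul_mem _ _ (Submodule.subset_span ⟨_, _, rfl⟩))
      (Submodule.smul_mem _ _ (Submodule.subset_span ⟨_, _, rfl⟩))

theorem dualOne_dualMul (f : Module.Dual ℂ (U g)) : dualMul dualOne f = f := by
  have H := dual_eq_zero_of_translR (g := g)
    (S := {F | ∃ f, F = dualMul dualOne f - f}) ?_ ?_ _ ⟨f, rfl⟩
  · exact sub_eq_zero.mp H
  · rintro _ ⟨f, rfl⟩
    simp [dualMul_apply_one, dualOne_apply]
  · rintro β x hx _ ⟨f, rfl⟩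
    rw [map_sub, translR_dualMul hx, translR_dualOne, zero_dualMul, zero_add, dtw_dualOne]
    exact Submodule.subset_span ⟨_, rfl⟩

theorem dualMul_dualOne (f : Module.Dual ℂ (U g)) : dualMul f dualOne = f := by
  have H := dual_eq_zero_of_translR (g := g)
    (S := {F | ∃ f, F = dualMul f dualOne - f}) ?_ ?_ _ ⟨f, rfl⟩
  · exact sub_eq_zero.mp H
  · rintro _ ⟨f, rfl⟩
    simp [dualMul_apply_one, dualOne_apply]
  · rintro β x hx _ ⟨f, rfl⟩
    rw [map_sub, translR_dualMul hx, translR_dualOne, dualMul_zero, add_zero]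
    exact Submodule.subset_span ⟨_, rfl⟩

theorem dualMul_assoc (f h k : Module.Dual ℂ (U g)) :
    dualMul (dualMul f h) k = dualMul f (dualMul h k) := by
  have H := dual_eq_zero_of_translR (g := g)
    (S := {F | ∃ f h k, F = dualMul (dualMul f h) k - dualMul f (dualMul h k)}) ?_ ?_ _
    ⟨f, h, k, rfl⟩
  · exact sub_eq_zero.mp H
  · rintro _ ⟨f, h, k, rfl⟩
    simp [dualMul_apply_one, mul_assoc]
  · rintro β x hx _ ⟨f, h, k, rfl⟩
    have e : translR (ι g x) (dualMul (dualMul f h) k - dualMul f (dualMul h k)) =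
        (dualMul (dualMul (translR (ι g x) f) h) k - dualMul (translR (ι g x) f) (dualMul h k)) +
        (dualMul (dualMul (dtw β f) (translR (ι g x) h)) k -
          dualMul (dtw β f) (dualMul (translR (ι g x) h) k)) +
        (dualMul (dualMul (dtw β f) (dtw β h)) (translR (ι g x) k) -
          dualMul (dtw β f) (dualMul (dtw β h) (translR (ι g x) k))) := by
      simp only [map_sub, translR_dualMul hx, dualMul_add, add_dualMul, dtw_dualMul]
      abel
    rw [e]
    exact add_mem (add_mem (Submodule.subset_span ⟨_, _, _, rfl⟩)
      (Submodule.subset_span ⟨_, _, _, rfl⟩)) (Submodule.subset_span ⟨_, _, _, rfl⟩)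

/-- `U(g)*` as an associative algebra. -/
instance : Ring (Module.Dual ℂ (U g)) where
  __ := (inferInstance : AddCommGroup (Module.Dual ℂ (U g)))
  mul := dualMul
  one := dualOne
  mul_assoc := dualMul_assoc
  one_mul := dualOne_dualMul
  mul_one := dualMul_dualOne
  left_distrib := dualMul_add
  right_distrib := add_dualMul
  zero_mul := zero_dualMul
  mul_zero := dualMul_zero

instance : Algebra ℂ (Module.Dual ℂ (U g)) :=
  Algebra.ofModule smul_dualMul dualMul_smul

theorem dualMul_eq (f h : Module.Dual ℂ (U g)) : dualMul f h = f * h := rfl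

theorem one_apply (u : U g) : (1 : Module.Dual ℂ (U g)) u = counit u := rfl

theorem mul_apply_one (f h : Module.Dual ℂ (U g)) : (f * h) 1 = f 1 * h 1 :=
  dualMul_apply_one f h

theorem translL_mul {α : ZMod 2} {x : g} (hx : x ∈ homog (parity (g := g)) α)
    (f h : Module.Dual ℂ (U g)) :
    translL (ι g x) (f * h) = translL (ι g x) f * dtw α h + f * translL (ι g x) h :=
  translL_dualMul hx f h

theorem translR_mul {α : ZMod 2} {x : g} (hx : x ∈ homog (parity (g := g)) α)
    (f h : Module.Dual ℂ (U g)) :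
    translR (ι g x) (f * h) = translR (ι g x) f * h + dtw α f * translR (ι g x) h :=
  translR_dualMul hx f h

theorem translR_one (x : g) : translR (ι g x) 1 = 0 := translR_dualOne x

theorem translL_one (x : g) : translL (ι g x) 1 = 0 := translL_dualOne x

theorem dtw_mul (α : ZMod 2) (f h : Module.Dual ℂ (U g)) :
    dtw α (f * h) = dtw α f * dtw α h := dtw_dualMul α f h

theorem dtw_map_one (α : ZMod 2) : dtw α (1 : Module.Dual ℂ (U g)) = 1 := dtw_dualOne α

theorem dualProd_eq (l : List (Module.Dual ℂ (U g))) : dualProd l = l.prod := by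
  induction l with
  | nil => rfl
  | cons f l ih => rw [List.prod_cons, ← ih]; rfl

/-- Homogeneous linear forms. -/
abbrev dualGr (α : ZMod 2) : Submodule ℂ (Module.Dual ℂ (U g)) := homog (σ g).dualMap α

theorem dtw_of_mem (α : ZMod 2) {β : ZMod 2} {f : Module.Dual ℂ (U g)} (hf : f ∈ dualGr β) :
    dtw α f = sgn (α * β) • f := by
  rcases zmod_two_cases α with rfl | rfl
  · simp [sgn_zero, dtw_zero]
  · rw [one_mul, ← mem_homog.mp hf, dtw_one]
    rfl

theorem translR_mem_dualGr {α β : ZMod 2} {x : g} (hx : x ∈ homog (parity (g := g)) β)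
    {f : Module.Dual ℂ (U g)} (hf : f ∈ dualGr α) : translR (ι g x) f ∈ dualGr (α + β) := by
  have h := translR_dtw 1 hx f
  rw [mem_homog] at hf ⊢
  have e : ∀ f : Module.Dual ℂ (U g), (σ g).dualMap f = dtw 1 f := fun f => (dtw_one f).symm
  rw [e] at hf ⊢
  have h2 := congrArg (fun F => sgn β • F) h
  simp only [one_mul, smul_smul, sgn_mul_self, one_smul] at h2
  rw [← h2, hf, map_smul, smul_smul, sgn_add, mul_comm]

/-- `U(g)*` is supercommutative. -/
theorem dual_superComm {α β : ZMod 2} {f h : Module.Dual ℂ (U g)} (hf : f ∈ dualGr α)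
    (hh : h ∈ dualGr β) : f * h = sgn (α * β) • (h * f) := by
  have H := dual_eq_zero_of_translR (g := g)
    (S := {F | ∃ α β f h, f ∈ dualGr α ∧ h ∈ dualGr β ∧ F = f * h - sgn (α * β) • (h * f)})
    ?_ ?_ _ ⟨α, β, f, h, hf, hh, rfl⟩
  · exact sub_eq_zero.mp H
  · rintro _ ⟨α, β, f, h, hf, hh, rfl⟩
    -- The unit of `U(g)` is even, so odd forms vanish there. At `1` the claim thus reduces to
    -- commutativity of `ℂ`, with sign `1` when `α = 0`.
    have hz : ∀ {f : Module.Dual ℂ (U g)}, f ∈ dualGr 1 → f 1 = 0 := by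
      intro f hf
      have := LinearMap.congr_fun (mem_homog.mp hf) 1
      simp [sgn_one] at this
      have h2 : (2 : ℂ) * f 1 = 0 := by linear_combination this
      simpa using h2
    simp only [LinearMap.sub_apply, LinearMap.smul_apply, mul_apply_one, smul_eq_mul]
    rcases zmod_two_cases α with rfl | rfl
    · simp [sgn_zero, mul_comm]
    · simp [hz hf]
  · rintro γ x hx _ ⟨α, β, f, h, hf, hh, rfl⟩
    have e : translR (ι g x) (f * h - sgn (α * β) • (h * f)) =
        (translR (ι g x) f * h - sgn ((α + γ) * β) • (h * translR (ι g x) f)) +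
        sgn (γ * α) • (f * translR (ι g x) h - sgn (α * (β + γ)) • (translR (ι g x) h * f)) := by
      rw [map_sub, map_smul, translR_mul hx, translR_mul hx, dtw_of_mem γ hf, dtw_of_mem γ hh,
        add_mul, mul_add, sgn_add, sgn_add, mul_comm γ α, smul_mul_assoc, smul_mul_assoc]
      have h1 := sgn_mul_self (α * γ)
      rw [smul_sub, smul_smul, mul_left_comm, h1, mul_one]
      module
    rw [e]
    exact add_mem (Submodule.subset_span ⟨_, _, _, _, translR_mem_dualGr hx hf, hh, rfl⟩)
      (Submodule.smul_mem _ _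
        (Submodule.subset_span ⟨_, _, _, _, hf, translR_mem_dualGr hx hh, rfl⟩))

theorem antipode_one : antipode (1 : U g) = 1 := by
  simp [antipode]

theorem negSignedRight_eq {α : ZMod 2} {x : g} (hx : x ∈ homog (parity (g := g)) α) (v : U g) :
    negSignedRight g x v = -(tw α v * ι g x) := by
  suffices h : negSignedRight g x = -(LinearMap.mulRight ℂ (ι g x) ∘ₗ (tw α).toLinearMap) from
    LinearMap.congr_fun h v
  refine ext_homog σ_σ fun β v hv => ?_
  rw [negSignedRight_apply hx hv]
  simp [tw_of_mem α hv]

theorem antipode_ι_mul {α : ZMod 2} {x : g} (hx : x ∈ homog (parity (g := g)) α) (v : U g) :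
    antipode (ι g x * v) = -(tw α (antipode v) * ι g x) := by
  rw [← negSignedRight_eq hx]
  simp [antipode, antipodeAction]

theorem antipode_tw (β : ZMod 2) (u : U g) : antipode (tw β u) = tw β (antipode u) := by
  suffices h : LinearMap.eqLocus (antipode ∘ₗ (tw β).toLinearMap)
      ((tw β).toLinearMap ∘ₗ antipode (g := g)) = ⊤ by
    have : u ∈ LinearMap.eqLocus (antipode ∘ₗ (tw β).toLinearMap)
      ((tw β).toLinearMap ∘ₗ antipode (g := g)) := h ▸ trivial
    exact this
  apply eq_top_of_mul_left
  · simp [antipode_one]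
  · intro α x hx w hw
    simp only [LinearMap.mem_eqLocus, LinearMap.comp_apply, AlgHom.toLinearMap_apply] at hw ⊢
    have hc : ∀ w : U g, tw β (tw α w) = tw α (tw β w) := by
      intro w
      rcases zmod_two_cases α with rfl | rfl <;> rcases zmod_two_cases β with rfl | rfl <;>
        simp
    rw [map_mul, tw_ι β hx, smul_mul_assoc, map_smul, antipode_ι_mul hx, antipode_ι_mul hx, hw,
      map_neg, map_mul, tw_ι β hx, hc, mul_smul_comm, smul_neg]

/-- The linear form `f ∘ S`. -/
def dualAntipode : Module.Dual ℂ (U g) →ₗ[ℂ] Module.Dual ℂ (U g) := antipode.dualMap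

theorem dualAntipode_apply (f : Module.Dual ℂ (U g)) (u : U g) :
    dualAntipode f u = f (antipode u) := rfl

theorem translL_dualAntipode {α : ZMod 2} {x : g} (hx : x ∈ homog (parity (g := g)) α)
    (f : Module.Dual ℂ (U g)) :
    translL (ι g x) (dualAntipode f) = -dualAntipode (dtw α (translR (ι g x) f)) := by
  ext u
  simp [dualAntipode_apply, antipode_ι_mul hx]

theorem dualAntipode_dtw (α : ZMod 2) (f : Module.Dual ℂ (U g)) :
    dualAntipode (dtw α f) = dtw α (dualAntipode f) := by
  ext u
  simp [dualAntipode_apply, antipode_tw]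

theorem dualAntipode_one : dualAntipode (1 : Module.Dual ℂ (U g)) = 1 := by
  ext u
  suffices h : LinearMap.eqLocus (counit.toLinearMap ∘ₗ antipode)
      (counit (g := g)).toLinearMap = ⊤ by
    have : u ∈ LinearMap.eqLocus (counit.toLinearMap ∘ₗ antipode)
      (counit (g := g)).toLinearMap := h ▸ trivial
    exact this
  apply eq_top_of_mul_left
  · simp [antipode_one]
  · intro α x hx w hw
    simp [antipode_ι_mul hx]

/-- The transposed antipode is multiplicative without reversal of the factors, as `U(g)` is
supercocommutative. Left translations are used for the check because `antipode_ι_mul` turns them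
into right translations. -/
theorem dualAntipode_mul (f h : Module.Dual ℂ (U g)) :
    dualAntipode (f * h) = dualAntipode f * dualAntipode h := by
  have H := dual_eq_zero_of_translL (g := g)
    (S := {F | ∃ f h, F = dualAntipode (f * h) - dualAntipode f * dualAntipode h}) ?_ ?_ _
    ⟨f, h, rfl⟩
  · exact sub_eq_zero.mp H
  · rintro _ ⟨f, h, rfl⟩
    simp [mul_apply_one, dualAntipode_apply, antipode_one]
  · rintro α x hx _ ⟨f, h, rfl⟩
    have e : translL (ι g x) (dualAntipode (f * h) - dualAntipode f * dualAntipode h) =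
        -(dualAntipode (dtw α (translR (ι g x) f) * dtw α h) -
          dualAntipode (dtw α (translR (ι g x) f)) * dualAntipode (dtw α h)) -
        (dualAntipode (f * dtw α (translR (ι g x) h)) -
          dualAntipode f * dualAntipode (dtw α (translR (ι g x) h))) := by
      rw [map_sub, translL_dualAntipode hx, translL_mul hx, translL_dualAntipode hx,
        translL_dualAntipode hx, translR_mul hx, map_add, map_add, dtw_mul, dtw_mul, dtw_dtw,
        dualAntipode_dtw α h, neg_mul, mul_neg]
      abel
    rw [e]
    exact sub_mem (neg_mem (Submodule.subset_span ⟨_, _, rfl⟩))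
      (Submodule.subset_span ⟨_, _, rfl⟩)

end U

theorem parity_evenPart (x : evenPart g) : parity x = x := rfl

theorem eq_zero_of_mem_evenPart_one {x : evenPart g}
    (hx : x ∈ homog (parity (g := evenPart g)) 1) : x = 0 :=
  eq_zero_of_mem_homog_id hx

@[simp] theorem evenInclusion_ι (x : evenPart g) :
    evenInclusion g (ι (evenPart g) x) = ι g (x : g) := by
  simp [evenInclusion]

theorem evenRestriction_apply (f : Module.Dual ℂ (U g)) (u : U (evenPart g)) :
    evenRestriction g f u = f (evenInclusion g u) := rfl

theorem translR_evenRestriction (u : U (evenPart g)) (f : Module.Dual ℂ (U g)) :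
    translR u (evenRestriction g f) = evenRestriction g (translR (evenInclusion g u) f) := by
  ext v
  simp [evenRestriction_apply]

theorem translL_evenRestriction (u : U (evenPart g)) (f : Module.Dual ℂ (U g)) :
    translL u (evenRestriction g f) = evenRestriction g (translL (evenInclusion g u) f) := by
  ext v
  simp [evenRestriction_apply]

theorem counit_evenInclusion (u : U (evenPart g)) : counit (evenInclusion g u) = counit u := by
  suffices h : counit.comp (evenInclusion g) = counit from DFunLike.congr_fun h u
  apply algHom_ext
  intro x
  simp

theorem evenRestriction_one : evenRestriction g 1 = 1 := by
  ext u
  exact counit_evenInclusion u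

theorem evenRestriction_mul (f h : Module.Dual ℂ (U g)) :
    evenRestriction g (f * h) = evenRestriction g f * evenRestriction g h := by
  have H := dual_eq_zero_of_translR (g := evenPart g)
    (S := {F | ∃ f h, F = evenRestriction g (f * h) - evenRestriction g f * evenRestriction g h})
    ?_ ?_ _ ⟨f, h, rfl⟩
  · exact sub_eq_zero.mp H
  · rintro _ ⟨f, h, rfl⟩
    simp [mul_apply_one, evenRestriction_apply]
  · rintro α x hx _ ⟨f, h, rfl⟩
    rcases zmod_two_cases α with rfl | rfl
    · have e : translR (ι _ x)
          (evenRestriction g (f * h) - evenRestriction g f * evenRestriction g h) =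
          (evenRestriction g (translR (ι g x) f * h) -
            evenRestriction g (translR (ι g x) f) * evenRestriction g h) +
          (evenRestriction g (f * translR (ι g x) h) -
            evenRestriction g f * evenRestriction g (translR (ι g x) h)) := by
        rw [map_sub, translR_mul hx, translR_evenRestriction, translR_evenRestriction,
          translR_evenRestriction, evenInclusion_ι, translR_mul x.2, map_add, dtw_zero, dtw_zero]
        abel
      rw [e]
      exact add_mem (Submodule.subset_span ⟨_, _, rfl⟩) (Submodule.subset_span ⟨_, _, rfl⟩)
    · rw [eq_zero_of_mem_evenPart_one hx, map_zero]
      have : translR (0 : U (evenPart g)) = 0 := by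
        ext f u
        simp
      rw [this]
      exact zero_mem _

variable (g) in
/-- The map `𝒫`, as an algebra homomorphism. -/
def evenRestrictionHom : Module.Dual ℂ (U g) →ₐ[ℂ] Module.Dual ℂ (U (evenPart g)) :=
  AlgHom.ofLinearMap (evenRestriction g) evenRestriction_one evenRestriction_mul

theorem evenInclusion_antipode (u : U (evenPart g)) :
    evenInclusion g (antipode u) = antipode (evenInclusion g u) := by
  suffices h : LinearMap.eqLocus ((evenInclusion g).toLinearMap ∘ₗ antipode)
      (antipode ∘ₗ (evenInclusion g).toLinearMap) = ⊤ by
    have : u ∈ LinearMap.eqLocus ((evenInclusion g).toLinearMap ∘ₗ antipode)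
      (antipode ∘ₗ (evenInclusion g).toLinearMap) := h ▸ trivial
    exact this
  apply eq_top_of_mul_left
  · simp [antipode_one]
  · intro α x hx w hw
    simp only [LinearMap.mem_eqLocus, LinearMap.comp_apply, AlgHom.toLinearMap_apply] at hw ⊢
    rcases zmod_two_cases α with rfl | rfl
    · rw [antipode_ι_mul hx, map_mul, evenInclusion_ι, antipode_ι_mul x.2, ← hw]
      simp
    · rw [eq_zero_of_mem_evenPart_one hx]
      simp

end DualAlgebra

/-! ### Hopf superalgebras of linear forms; integrals as translation-invariant forms. -/

section HopfDual

/-- The sign differs from `1` only when the second factor is odd, and there the even form `I`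
vanishes. So the sign convention in the coproduct is invisible to an even integral. -/
theorem map_id_superTwist {V : Type} [AddCommGroup V] [Module ℂ V] {τ : V →ₗ[ℂ] V}
    (hτ : ∀ x, τ (τ x) = x) {I : Module.Dual ℂ V} (hI : I ∘ₗ τ = I) (T : V ⊗[ℂ] V) :
    TensorProduct.map (LinearMap.id (M := V)) I (superTwist τ T) =
      TensorProduct.map (LinearMap.id (M := V)) I T := by
  suffices h : TensorProduct.map (LinearMap.id (M := V)) I ∘ₗ superTwist τ =
      TensorProduct.map (LinearMap.id (M := V)) I from LinearMap.congr_fun h T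
  apply TensorProduct.ext
  refine ext_homog hτ fun α a ha => ?_
  refine ext_homog hτ fun β b hb => ?_
  change TensorProduct.map (LinearMap.id (M := V)) I (superTwist τ (a ⊗ₜ b)) =
    TensorProduct.map (LinearMap.id (M := V)) I (a ⊗ₜ b)
  rw [superTwist_tmul ha hb, map_smul, TensorProduct.map_tmul]
  rcases zmod_two_cases β with rfl | rfl
  · simp [sgn_zero]
  · have h1 : I b = -I b := by
      have h := LinearMap.congr_fun hI b
      rw [LinearMap.comp_apply, mem_homog.mp hb, map_smul, sgn_one] at h
      simpa using h.symm
    have h2 : I b = 0 := by linear_combination h1 / 2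
    simp [h2]

theorem map_superTwist_id {V : Type} [AddCommGroup V] [Module ℂ V] {τ : V →ₗ[ℂ] V}
    (hτ : ∀ x, τ (τ x) = x) {I : Module.Dual ℂ V} (hI : I ∘ₗ τ = I) (T : V ⊗[ℂ] V) :
    TensorProduct.map I (LinearMap.id (M := V)) (superTwist τ T) =
      TensorProduct.map I (LinearMap.id (M := V)) T := by
  suffices h : TensorProduct.map I (LinearMap.id (M := V)) ∘ₗ superTwist τ =
      TensorProduct.map I (LinearMap.id (M := V)) from LinearMap.congr_fun h T
  apply TensorProduct.ext
  refine ext_homog hτ fun β b hb => ?_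
  refine ext_homog hτ fun α a ha => ?_
  change TensorProduct.map I (LinearMap.id (M := V)) (superTwist τ (b ⊗ₜ a)) =
    TensorProduct.map I (LinearMap.id (M := V)) (b ⊗ₜ a)
  rw [superTwist_tmul hb ha, map_smul, TensorProduct.map_tmul]
  rcases zmod_two_cases β with rfl | rfl
  · simp [sgn_zero]
  · have h1 : I b = -I b := by
      have h := LinearMap.congr_fun hI b
      rw [LinearMap.comp_apply, mem_homog.mp hb, map_smul, sgn_one] at h
      simpa using h.symm
    have h2 : I b = 0 := by linear_combination h1 / 2
    simp [h2]

variable {g : Type} [AddCommGroup g] [Module ℂ g] [LieSuperalgebra g]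

namespace U

theorem translL_mem {M : Submodule ℂ (Module.Dual ℂ (U g))}
    (hM : ∀ x : g, ∀ f ∈ M, translL (ι g x) f ∈ M) (u : U g) : ∀ f ∈ M, translL u f ∈ M := by
  let W : Submodule ℂ (U g) :=
    { carrier := {u | ∀ f ∈ M, translL u f ∈ M}
      add_mem' := fun {a b} ha hb f hf => by
        have : translL (a + b) f = translL a f + translL b f := by ext; simp [add_mul]
        rw [this]
        exact add_mem (ha f hf) (hb f hf)
      zero_mem' := fun f _ => by
        have : translL 0 f = 0 := by ext; simp
        rw [this]
        exact zero_mem _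
      smul_mem' := fun c a ha f hf => by
        have : translL (c • a) f = c • translL a f := by ext; simp
        rw [this]
        exact M.smul_mem _ (ha f hf) }
  have hW : W = ⊤ := by
    refine eq_top_of_mul_left (fun f hf => ?_) fun α x _ w hw f hf => ?_
    · have : translL 1 f = f := by ext; simp
      rwa [this]
    · have : translL (ι g x * w) f = translL w (translL (ι g x) f) := by ext; simp [mul_assoc]
      rw [this]
      exact hw _ (hM x f hf)
  have hu : u ∈ W := hW ▸ trivial
  exact hu

theorem translR_mem {M : Submodule ℂ (Module.Dual ℂ (U g))}
    (hM : ∀ x : g, ∀ f ∈ M, translR (ι g x) f ∈ M) (u : U g) : ∀ f ∈ M, translR u f ∈ M := by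
  let W : Submodule ℂ (U g) :=
    { carrier := {u | ∀ f ∈ M, translR u f ∈ M}
      add_mem' := fun {a b} ha hb f hf => by
        have : translR (a + b) f = translR a f + translR b f := by ext; simp [mul_add]
        rw [this]
        exact add_mem (ha f hf) (hb f hf)
      zero_mem' := fun f _ => by
        have : translR 0 f = 0 := by ext; simp
        rw [this]
        exact zero_mem _
      smul_mem' := fun c a ha f hf => by
        have : translR (c • a) f = c • translR a f := by ext; simp
        rw [this]
        exact M.smul_mem _ (ha f hf) }
  have hW : W = ⊤ := by
    refine eq_top_of_mul_left (fun f hf => ?_) fun α x _ w hw f hf => ?_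
    · have : translR 1 f = f := by ext; simp
      rwa [this]
    · have : translR (ι g x * w) f = translR (ι g x) (translR w f) := by ext; simp [mul_assoc]
      rw [this]
      exact hM x _ (hw f hf)
  have hu : u ∈ W := hW ▸ trivial
  exact hu

/-- The action of `U(g)` by right translations on a stable space of linear forms. -/
def translRHom (N : Submodule ℂ (Module.Dual ℂ (U g)))
    (hN : ∀ x : g, ∀ f ∈ N, translR (ι g x) f ∈ N) : U g →ₐ[ℂ] Module.End ℂ N where
  toFun u := (translR u).restrict (translR_mem hN u)
  map_one' := by
    ext f u
    simp
  map_mul' u v := by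
    ext f w
    simp [mul_assoc]
  map_zero' := by
    ext f u
    simp
  map_add' u v := by
    ext f w
    simp [mul_add]
  commutes' c := by
    ext f w
    simp [Algebra.algebraMap_eq_smul_one]

theorem finite_quotient_ker {V : Type} [AddCommGroup V] [Module ℂ V] [FiniteDimensional ℂ V]
    (ρ : U g →ₐ[ℂ] Module.End ℂ V) : Module.Finite ℂ (U g ⧸ RingHom.ker ρ) := by
  have h1 : Module.Finite ℂ (U g ⧸ LinearMap.ker ρ.toLinearMap) :=
    Module.Finite.equiv ρ.toLinearMap.quotKerEquivRange.symm
  have h2 : (RingHom.ker ρ).restrictScalars ℂ = LinearMap.ker ρ.toLinearMap := by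
    ext u
    rfl
  rw [← h2] at h1
  exact Module.Finite.equiv (Submodule.Quotient.restrictScalarsEquiv ℂ _)

/-- The kernel of the action of `U(g)` on `N` by right translations is a two-sided ideal of finite
codimension, and `a u` is the value at `1` of the translate of `a` by `u`. -/
theorem inFiniteDual_of_stable {N : Submodule ℂ (Module.Dual ℂ (U g))}
    (hN : ∀ x : g, ∀ f ∈ N, translR (ι g x) f ∈ N) [FiniteDimensional ℂ N]
    {a : Module.Dual ℂ (U g)} (ha : a ∈ N) : InFiniteDual a := by
  refine ⟨RingHom.ker (translRHom N hN), inferInstance, ?_, fun u hu => ?_⟩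
  · exact finite_quotient_ker (translRHom N hN)
  · have h1 : translRHom N hN u = 0 := hu
    have h2 := congrArg (fun F : Module.End ℂ N => (F ⟨a, ha⟩ : Module.Dual ℂ (U g)) 1) h1
    simpa [translRHom] using h2

/-- Expanding the translate `a (· v)` in a basis of `N` gives `a (u v) = ∑ b i (u) * c i (v)`. Each
coordinate of `N` is evaluation at some `x i`, so `c i` is the left translate `a (x i ·)`, which
stays in `M`. -/
theorem exists_coprod {N : Submodule ℂ (Module.Dual ℂ (U g))}
    (hN : ∀ x : g, ∀ f ∈ N, translR (ι g x) f ∈ N) [FiniteDimensional ℂ N]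
    {M : Submodule ℂ (Module.Dual ℂ (U g))} (hNM : N ≤ M)
    (hM : ∀ x : g, ∀ f ∈ M, translL (ι g x) f ∈ M)
    {a : Module.Dual ℂ (U g)} (ha : a ∈ N) :
    ∃ T : M ⊗[ℂ] M, ∀ x y, TensorProduct.dualDistrib ℂ _ _
      (TensorProduct.map M.subtype M.subtype T) (x ⊗ₜ y) = a (x * y) := by
  let ev : U g →ₗ[ℂ] Module.Dual ℂ N := N.subtype.flip
  -- Evaluations separate the points of the finite-dimensional space `N`, so they exhaust its dual.
  have hev : Function.Surjective ev := by
    rw [← LinearMap.dualMap_injective_iff, injective_iff_map_eq_zero]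
    intro F hF
    obtain ⟨f, rfl⟩ := (Module.evalEquiv ℂ N).surjective F
    have : f = 0 := by
      ext u
      exact LinearMap.congr_fun hF u
    rw [this, map_zero]
  let b := Module.finBasis ℂ N
  choose x hx using fun i => hev (b.coord i)
  refine ⟨∑ i, (⟨b i, hNM (b i).2⟩ : M) ⊗ₜ ⟨translL (x i) a, translL_mem hM _ a (hNM ha)⟩, ?_⟩
  intro u v
  have key := b.sum_repr ⟨translR v a, translR_mem hN v a ha⟩
  have key2 := congrArg (fun f : N => (f : Module.Dual ℂ (U g)) u) key
  simp only [Submodule.coe_sum, Submodule.coe_smul, LinearMap.sum_apply, LinearMap.smul_apply,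
    translR_apply, smul_eq_mul] at key2
  rw [← key2, map_sum, map_sum, LinearMap.sum_apply]
  refine Finset.sum_congr rfl fun i _ => ?_
  have h := LinearMap.congr_fun (hx i) ⟨translR v a, translR_mem hN v a ha⟩
  have h' : a (x i * v) = (b.repr ⟨translR v a, translR_mem hN v a ha⟩) i := h
  simp [← h', mul_comm]

theorem dualDistrib_superTwist (S : Module.Dual ℂ (U g) ⊗[ℂ] Module.Dual ℂ (U g))
    (z : U g ⊗[ℂ] U g) :
    TensorProduct.dualDistrib ℂ _ _ (superTwist (σ g).dualMap S) z =
      TensorProduct.dualDistrib ℂ _ _ S (superTwist (σ g) z) := by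
  induction S with
  | zero => simp
  | add S T hS hT => simp only [map_add, LinearMap.add_apply, hS, hT]
  | tmul f h =>
    induction z with
    | zero => simp
    | add y z hy hz => simp only [map_add, hy, hz]
    | tmul x y => simp [superTwist, sum_zmod_two, proj]

theorem map_subtype_superTwist {M : Submodule ℂ (Module.Dual ℂ (U g))}
    (hM : ∀ a ∈ M, a ∘ₗ σ g ∈ M) (T : M ⊗[ℂ] M) :
    TensorProduct.map M.subtype M.subtype (superTwist ((σ g).dualMap.restrict hM) T) =
      superTwist (σ g).dualMap (TensorProduct.map M.subtype M.subtype T) := by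
  have hp : ∀ α (a : M), (proj ((σ g).dualMap.restrict hM) α a : Module.Dual ℂ (U g)) =
      proj (σ g).dualMap α a := fun α a => rfl
  induction T with
  | zero => simp
  | add S T hS hT => simp only [map_add, hS, hT]
  | tmul f h => simp [superTwist, sum_zmod_two, hp]

theorem restrict_dualMap_involutive {M : Submodule ℂ (Module.Dual ℂ (U g))}
    (hM : ∀ a ∈ M, a ∘ₗ σ g ∈ M) (a : M) :
    (σ g).dualMap.restrict hM ((σ g).dualMap.restrict hM a) = a := by
  apply Subtype.ext
  ext u
  change (a : Module.Dual ℂ (U g)) (σ g (σ g u)) = _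
  rw [σ_σ]

/-- A space of linear forms that is stable under all operations and under translations, and locally
finite under right translations, is a sub-Hopf-superalgebra. -/
def subHopfOfStable (M : Submodule ℂ (Module.Dual ℂ (U g)))
    (hσ : ∀ a ∈ M, a ∘ₗ σ g ∈ M) (h1 : 1 ∈ M) (hmul : ∀ a ∈ M, ∀ b ∈ M, a * b ∈ M)
    (hL : ∀ x : g, ∀ f ∈ M, translL (ι g x) f ∈ M)
    (hfin : ∀ a ∈ M, ∃ N : Submodule ℂ (Module.Dual ℂ (U g)), N ≤ M ∧ a ∈ N ∧
      FiniteDimensional ℂ N ∧ ∀ x : g, ∀ f ∈ N, translR (ι g x) f ∈ N)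
    (hS : ∀ a ∈ M, dualAntipode a ∈ M) : SubHopfSuperalgebra g where
  toSubmodule := M
  inFiniteDual a ha := by
    obtain ⟨N, _, haN, hN, hR⟩ := hfin a ha
    exact inFiniteDual_of_stable hR haN
  parity_mem := hσ
  one_mem := h1
  mul_mem := hmul
  comul_mem a ha := by
    obtain ⟨N, hNM, haN, hN, hR⟩ := hfin a ha
    obtain ⟨T, hT⟩ := exists_coprod hR hNM hL haN
    -- The tensor `T` represents the product for the ungraded pairing; the twist cancels the sign
    -- built into `superPairing`.
    refine ⟨superTwist ((σ g).dualMap.restrict hσ) T, ?_⟩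
    rw [map_subtype_superTwist]
    ext x y
    simp only [superPairing, TensorProduct.AlgebraTensorModule.curry_apply,
      TensorProduct.curry_apply, LinearMap.coe_restrictScalars, LinearMap.comp_apply,
      LinearMap.dualMap_apply, LinearMap.mul'_apply]
    rw [dualDistrib_superTwist, superTwist_superTwist σ_σ, hT]
  antipode_mem := hS

end U

namespace SubHopfSuperalgebra

variable (A : SubHopfSuperalgebra g)

theorem parity_parity (a : A.toSubmodule) : A.parity (A.parity a) = a :=
  restrict_dualMap_involutive A.parity_mem a

/-- The coproduct of `A`, with the sign convention in which `⟨T, x ⊗ y⟩ = a (x y)` for the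
ungraded pairing. -/
def coprod (a : A.toSubmodule) : A.toSubmodule ⊗[ℂ] A.toSubmodule :=
  superTwist A.parity (A.comul a)

theorem superTwist_coprod (a : A.toSubmodule) : superTwist A.parity (A.coprod a) = A.comul a :=
  superTwist_superTwist A.parity_parity _

theorem dualDistrib_coprod (a : A.toSubmodule) (x y : U g) :
    TensorProduct.dualDistrib ℂ _ _
      (TensorProduct.map A.toSubmodule.subtype A.toSubmodule.subtype (A.coprod a)) (x ⊗ₜ y) =
      a.1 (x * y) := by
  rw [coprod, parity, map_subtype_superTwist, dualDistrib_superTwist, ← A.pairing_comul]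
  rfl

theorem lid_coprod (a : A.toSubmodule) (x : U g) :
    (TensorProduct.lid ℂ A.toSubmodule (TensorProduct.map (Module.Dual.eval ℂ (U g) x ∘ₗ
      A.toSubmodule.subtype) LinearMap.id (A.coprod a))).1 =
      translL x a.1 := by
  ext y
  rw [translL_apply, ← dualDistrib_coprod]
  generalize A.coprod a = T
  induction T with
  | zero => simp
  | tmul x y => simp
  | add x y hx hy => simp only [map_add, LinearMap.add_apply, Submodule.coe_add, hx, hy]

theorem rid_coprod (a : A.toSubmodule) (y : U g) :
    (TensorProduct.rid ℂ A.toSubmodule (TensorProduct.map LinearMap.id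
      (Module.Dual.eval ℂ (U g) y ∘ₗ A.toSubmodule.subtype) (A.coprod a))).1 =
      translR y a.1 := by
  ext x
  rw [translR_apply, ← dualDistrib_coprod]
  generalize A.coprod a = T
  induction T with
  | zero => simp
  | tmul x y => simp [mul_comm]
  | add x y hx hy => simp only [map_add, LinearMap.add_apply, Submodule.coe_add, hx, hy]

theorem translL_mem (x : U g) : ∀ a ∈ A.toSubmodule, translL x a ∈ A.toSubmodule := by
  intro a ha
  rw [← A.lid_coprod ⟨a, ha⟩]
  exact Subtype.prop _

theorem translR_mem (x : U g) : ∀ a ∈ A.toSubmodule, translR x a ∈ A.toSubmodule := by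
  intro a ha
  rw [← A.rid_coprod ⟨a, ha⟩]
  exact Subtype.prop _

/-- Left translation on `A`. -/
def transL (x : U g) : A.toSubmodule →ₗ[ℂ] A.toSubmodule := (translL x).restrict (A.translL_mem x)

/-- Right translation on `A`. -/
def transR (x : U g) : A.toSubmodule →ₗ[ℂ] A.toSubmodule := (translR x).restrict (A.translR_mem x)

@[simp] theorem transL_apply (x : U g) (a : A.toSubmodule) (u : U g) :
    (A.transL x a).1 u = a.1 (x * u) := rfl

@[simp] theorem transR_apply (x : U g) (a : A.toSubmodule) (u : U g) :
    (A.transR x a).1 u = a.1 (u * x) := rfl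

theorem dualDistrib_nu (a : A.toSubmodule) (x : U g) (ψ : Module.Dual ℂ A.toSubmodule) :
    TensorProduct.dualDistrib ℂ _ _
      ((Module.Dual.eval ℂ (U g) x ∘ₗ A.toSubmodule.subtype) ⊗ₜ ψ) (A.coprod a) =
      ψ (A.transL x a) := by
  have h : A.transL x a = TensorProduct.lid ℂ A.toSubmodule (TensorProduct.map
      (Module.Dual.eval ℂ (U g) x ∘ₗ A.toSubmodule.subtype) LinearMap.id (A.coprod a)) :=
    Subtype.ext (A.lid_coprod a x).symm
  rw [h]
  generalize A.coprod a = T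
  induction T with
  | zero => simp
  | tmul x y => simp
  | add x y hx hy => simp only [map_add, hx, hy]

/-- For even `x` the sign in `ν` disappears, and multiplication by `ν x` is the transpose of left
translation by `x`. This turns the form defining the integral into an explicit expression in `a (Γ
·)`. -/
theorem formMul_nu {x : U g} (hx : σ g x = x) (ψ : Module.Dual ℂ A.toSubmodule)
    (a : A.toSubmodule) : A.formMul (A.nu x) ψ a = ψ (A.transL x a) := by
  rw [← dualDistrib_nu, nu, hx]
  rfl

/-- Both sides of the defining identity lie in `A`, hence are forms on `U(g)`, and may be compared
at each `x`. Evenness of `I` is what removes the signs of the graded coproduct. -/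
theorem isLeftIntegral_iff {I : Module.Dual ℂ A.toSubmodule} (hI : I ∘ₗ A.parity = I) :
    A.IsLeftIntegral I ↔ ∀ x a, I (A.transL x a) = counit x * I a := by
  have key : ∀ a x, (TensorProduct.rid ℂ _ (TensorProduct.map LinearMap.id I (A.comul a))).1 x =
      I (A.transL x a) := by
    intro a x
    rw [← superTwist_coprod, map_id_superTwist A.parity_parity hI, ← dualDistrib_nu]
    generalize A.coprod a = T
    induction T with
    | zero => simp
    | tmul x y => simp [mul_comm]
    | add x y hx hy => simp only [map_add, LinearMap.add_apply, Submodule.coe_add, hx, hy]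
  constructor
  · intro h x a
    rw [← key, h a]
    simp [one, dualOne_apply, mul_comm]
  · intro h a
    apply Subtype.ext
    ext x
    rw [key, h]
    simp [one, dualOne_apply, mul_comm]

theorem isRightIntegral_iff {I : Module.Dual ℂ A.toSubmodule} (hI : I ∘ₗ A.parity = I) :
    A.IsRightIntegral I ↔ ∀ x a, I (A.transR x a) = counit x * I a := by
  have key : ∀ a x, (TensorProduct.lid ℂ _ (TensorProduct.map I LinearMap.id (A.comul a))).1 x =
      I (A.transR x a) := by
    intro a x
    have h : A.transR x a = TensorProduct.rid ℂ A.toSubmodule (TensorProduct.map LinearMap.id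
      (Module.Dual.eval ℂ (U g) x ∘ₗ A.toSubmodule.subtype) (A.coprod a)) :=
      Subtype.ext (A.rid_coprod a x).symm
    rw [← superTwist_coprod, map_superTwist_id A.parity_parity hI, h]
    generalize A.coprod a = T
    induction T with
    | zero => simp
    | tmul x y => simp [mul_comm]
    | add x y hx hy => simp only [map_add, LinearMap.add_apply, Submodule.coe_add, hx, hy]
  constructor
  · intro h x a
    rw [← key, h a]
    simp [one, dualOne_apply, mul_comm]
  · intro h a
    apply Subtype.ext
    ext x
    rw [key, h]
    simp [one, dualOne_apply, mul_comm]

/-- It suffices to check invariance under left translations by elements of `g`. -/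
theorem transL_eq_counit {I : Module.Dual ℂ A.toSubmodule}
    (hI : ∀ α, ∀ x ∈ homog (LieSuperalgebra.parity (g := g)) α, ∀ a, I (A.transL (ι g x) a) = 0)
    (x : U g) (a : A.toSubmodule) : I (A.transL x a) = counit x * I a := by
  let W : Submodule ℂ (U g) :=
    { carrier := {u | ∀ a, I (A.transL u a) = counit u * I a}
      add_mem' := fun {u v} hu hv a => by
        have : A.transL (u + v) a = A.transL u a + A.transL v a := by
          apply Subtype.ext; ext; simp [add_mul]
        rw [this, map_add, hu, hv, map_add, add_mul]
      zero_mem' := fun a => by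
        have : A.transL 0 a = 0 := by apply Subtype.ext; ext; simp
        rw [this]
        simp
      smul_mem' := fun c u hu a => by
        have : A.transL (c • u) a = c • A.transL u a := by apply Subtype.ext; ext; simp
        rw [this, map_smul, hu, map_smul, smul_mul_assoc] }
  have hW : W = ⊤ := by
    refine eq_top_of_mul_right (fun a => ?_) fun α x hx w _ a => ?_
    · have : A.transL 1 a = a := by apply Subtype.ext; ext; simp
      rw [this]
      simp
    · have : A.transL (w * ι g x) a = A.transL (ι g x) (A.transL w a) := by
        apply Subtype.ext; ext; simp [mul_assoc]
      rw [this, hI α x hx]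
      simp
  have hx : x ∈ W := hW ▸ trivial
  exact hx a

theorem transR_eq_counit {I : Module.Dual ℂ A.toSubmodule}
    (hI : ∀ α, ∀ x ∈ homog (LieSuperalgebra.parity (g := g)) α, ∀ a, I (A.transR (ι g x) a) = 0)
    (x : U g) (a : A.toSubmodule) : I (A.transR x a) = counit x * I a := by
  let W : Submodule ℂ (U g) :=
    { carrier := {u | ∀ a, I (A.transR u a) = counit u * I a}
      add_mem' := fun {u v} hu hv a => by
        have : A.transR (u + v) a = A.transR u a + A.transR v a := by
          apply Subtype.ext; ext; simp [mul_add]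
        rw [this, map_add, hu, hv, map_add, add_mul]
      zero_mem' := fun a => by
        have : A.transR 0 a = 0 := by apply Subtype.ext; ext; simp
        rw [this]
        simp
      smul_mem' := fun c u hu a => by
        have : A.transR (c • u) a = c • A.transR u a := by apply Subtype.ext; ext; simp
        rw [this, map_smul, hu, map_smul, smul_mul_assoc] }
  have hW : W = ⊤ := by
    refine eq_top_of_mul_left (fun a => ?_) fun α x hx w _ a => ?_
    · have : A.transR 1 a = a := by apply Subtype.ext; ext; simp
      rw [this]
      simp
    · have : A.transR (ι g x * w) a = A.transR (ι g x) (A.transR w a) := by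
        apply Subtype.ext; ext; simp [mul_assoc]
      rw [this, hI α x hx]
      simp
  have hx : x ∈ W := hW ▸ trivial
  exact hx a

end SubHopfSuperalgebra

end HopfDual

/-! ### Filtrations of the enveloping algebra, orders of vanishing, and density. -/

section Filtration

variable {g : Type} [AddCommGroup g] [Module ℂ g] [LieSuperalgebra g]

namespace U

/-- The increasing filtration of `U(g)` that starts with the subspace `B`, and in which left
multiplication by elements of `s` raises the degree by one. -/
def filt (s : Set g) (B : Submodule ℂ (U g)) : ℕ → Submodule ℂ (U g)
  | 0 => B
  | k + 1 => filt s B k ⊔ Submodule.span ℂ (ι g '' s) * filt s B k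

variable {s : Set g} {B : Submodule ℂ (U g)}

theorem filt_le_succ (k : ℕ) : filt s B k ≤ filt s B (k + 1) := le_sup_left

theorem mul_mem_filt {k : ℕ} {x : U g} (hx : x ∈ Submodule.span ℂ (ι g '' s)) {u : U g}
    (hu : u ∈ filt s B k) : x * u ∈ filt s B (k + 1) :=
  le_sup_right (a := filt s B k) (Submodule.mul_mem_mul hx hu)

theorem ι_mul_mem_filt {k : ℕ} {x : g} (hx : x ∈ s) {u : U g} (hu : u ∈ filt s B k) :
    ι g x * u ∈ filt s B (k + 1) :=
  mul_mem_filt (Submodule.subset_span ⟨x, hx, rfl⟩) hu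

theorem filt_succ_le {k : ℕ} {W : Submodule ℂ (U g)} (h1 : filt s B k ≤ W)
    (h2 : ∀ x ∈ s, ∀ u ∈ filt s B k, ι g x * u ∈ W) : filt s B (k + 1) ≤ W := by
  refine sup_le h1 (Submodule.mul_le.mpr fun m hm u hu => ?_)
  induction hm using Submodule.span_induction with
  | mem m hm =>
    obtain ⟨x, hx, rfl⟩ := hm
    exact h2 x hx u hu
  | zero => simp
  | add m m' _ _ hm hm' => rw [add_mul]; exact add_mem hm hm'
  | smul c m _ hm => rw [smul_mul_assoc]; exact W.smul_mem c hm

theorem tw_mem_filt (hs : ∀ x ∈ s, ∃ α, x ∈ homog (parity (g := g)) α)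
    (hB : ∀ α, ∀ u ∈ B, tw α u ∈ B) (k : ℕ) : ∀ α, ∀ u ∈ filt s B k, tw α u ∈ filt s B k := by
  induction k with
  | zero => exact hB
  | succ k ih =>
    intro α
    refine filt_succ_le (W := (filt s B (k + 1)).comap (tw α).toLinearMap)
      (fun u hu => filt_le_succ k (ih α u hu)) fun x hx u hu => ?_
    obtain ⟨β, hβ⟩ := hs x hx
    rw [Submodule.mem_comap, AlgHom.toLinearMap_apply, map_mul, tw_ι α hβ, smul_mul_assoc]
    exact Submodule.smul_mem _ _ (ι_mul_mem_filt hx (ih α u hu))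

variable (s B) in
/-- The linear forms that vanish in all degrees smaller than `d`. -/
def vanishing (d : ℕ) : Submodule ℂ (Module.Dual ℂ (U g)) where
  carrier := {f | ∀ k < d, ∀ u ∈ filt s B k, f u = 0}
  add_mem' := fun hf hh k hk u hu => by simp [hf k hk u hu, hh k hk u hu]
  zero_mem' := fun _ _ _ _ => rfl
  smul_mem' := fun c f hf k hk u hu => by simp [hf k hk u hu]

theorem mem_vanishing_one {f : Module.Dual ℂ (U g)} :
    f ∈ vanishing s B 1 ↔ ∀ u ∈ B, f u = 0 := by
  constructor
  · intro h u hu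
    exact h 0 zero_lt_one u hu
  · intro h k hk u hu
    obtain rfl : k = 0 := by omega
    exact h u hu

theorem mem_vanishing_zero (f : Module.Dual ℂ (U g)) : f ∈ vanishing s B 0 :=
  fun k hk => absurd hk (Nat.not_lt_zero k)

theorem translL_mem_vanishing {d : ℕ} {f : Module.Dual ℂ (U g)} (hf : f ∈ vanishing s B d)
    {x : g} (hx : x ∈ s) : translL (ι g x) f ∈ vanishing s B (d - 1) :=
  fun k hk u hu => hf (k + 1) (by omega) _ (ι_mul_mem_filt hx hu)

/-- Orders of vanishing add, as for functions vanishing on a subvariety: translation by an element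
of `s` is a twisted derivation and lowers the order of just one factor by one. The hypothesis `hB'`
is the case of degree zero. -/
theorem mul_mem_vanishing (hs : ∀ x ∈ s, ∃ α, x ∈ homog (parity (g := g)) α)
    (hB : ∀ α, ∀ u ∈ B, tw α u ∈ B)
    (hB' : ∀ f h : Module.Dual ℂ (U g), ((∀ u ∈ B, f u = 0) ∨ ∀ u ∈ B, h u = 0) →
      ∀ u ∈ B, (f * h) u = 0) {c d : ℕ} {f h : Module.Dual ℂ (U g)}
    (hf : f ∈ vanishing s B c) (hh : h ∈ vanishing s B d) : f * h ∈ vanishing s B (c + d) := by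
  suffices H : ∀ k c d, ∀ f ∈ vanishing s B c, ∀ h ∈ vanishing s B d, k < c + d →
      filt s B k ≤ LinearMap.ker (f * h) from fun k hk u hu => H k c d f hf h hh hk hu
  intro k
  induction k with
  | zero =>
    intro c d f hf h hh hk u hu
    refine hB' f h ?_ u hu
    rcases Nat.eq_zero_or_pos c with rfl | hc
    · exact Or.inr (hh 0 (by omega))
    · exact Or.inl (hf 0 hc)
  | succ k ih =>
    intro c d f hf h hh hk
    refine filt_succ_le (ih c d f hf h hh (by omega)) fun x hx u hu => ?_
    obtain ⟨α, hα⟩ := hs x hx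
    have h1 : dtw α h ∈ vanishing s B d :=
      fun j hj v hv => hh j hj _ (tw_mem_filt hs hB j α v hv)
    -- Truncated subtraction is harmless: for `c = 0` the hypothesis already gives `k + 1 < d`, and
    -- likewise for `d = 0` below.
    have h2 := ih (c - 1) d _ (translL_mem_vanishing hf hx) _ h1 (by omega) hu
    have h3 := ih c (d - 1) _ hf _ (translL_mem_vanishing hh hx) (by omega) hu
    rw [LinearMap.mem_ker] at h2 h3 ⊢
    rw [← translL_apply, translL_mul hα, LinearMap.add_apply, h2, h3, add_zero]

theorem list_prod_mem_vanishing (hs : ∀ x ∈ s, ∃ α, x ∈ homog (parity (g := g)) α)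
    (hB : ∀ α, ∀ u ∈ B, tw α u ∈ B)
    (hB' : ∀ f h : Module.Dual ℂ (U g), ((∀ u ∈ B, f u = 0) ∨ ∀ u ∈ B, h u = 0) →
      ∀ u ∈ B, (f * h) u = 0) (l : List (Module.Dual ℂ (U g)))
    (hl : ∀ f ∈ l, f ∈ vanishing s B 1) : l.prod ∈ vanishing s B l.length := by
  induction l with
  | nil => exact mem_vanishing_zero _
  | cons f l ih =>
    rw [List.prod_cons, List.length_cons, add_comm]
    exact mul_mem_vanishing hs hB hB' (hl f (by simp)) (ih fun h hh => hl h (by simp [hh]))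

/-! #### The filtration by the length of products, and density -/

theorem mul_apply_one_span (f h : Module.Dual ℂ (U g))
    (H : (∀ u ∈ (1 : Submodule ℂ (U g)), f u = 0) ∨ ∀ u ∈ (1 : Submodule ℂ (U g)), h u = 0) :
    ∀ u ∈ (1 : Submodule ℂ (U g)), (f * h) u = 0 := by
  intro u hu
  obtain ⟨c, rfl⟩ := Submodule.mem_one.mp hu
  have h1 : (1 : U g) ∈ (1 : Submodule ℂ (U g)) := Submodule.one_le.mp le_rfl
  rw [Algebra.algebraMap_eq_smul_one, map_smul, mul_apply_one]
  rcases H with H | H <;> simp [H 1 h1]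

theorem tw_mem_one (α : ZMod 2) : ∀ u ∈ (1 : Submodule ℂ (U g)), tw α u ∈
    (1 : Submodule ℂ (U g)) := by
  intro u hu
  obtain ⟨c, rfl⟩ := Submodule.mem_one.mp hu
  rw [AlgHom.commutes]
  exact hu

section Density

variable {ι' : Type} {b : ι' → g} {d : ι' → ZMod 2}
  {f : ι' → Module.Dual ℂ (U g)}

variable (b) in
/-- The step before `k` in the filtration of `U(g)` by the length of products. -/
def filtPred : ℕ → Submodule ℂ (U g)
  | 0 => ⊥
  | k + 1 => filt (Set.range b) 1 k

theorem filtPred_le (k : ℕ) : filtPred b k ≤ filt (Set.range b) 1 k := by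
  cases k with
  | zero => exact bot_le
  | succ k => exact filt_le_succ k

theorem mul_mem_filtPred (hb : Submodule.span ℂ (Set.range b) = ⊤) (x : g) {k : ℕ} {u : U g}
    (hu : u ∈ filtPred b k) : ι g x * u ∈ filt (Set.range b) 1 k := by
  cases k with
  | zero =>
    obtain rfl : u = 0 := hu
    simp
  | succ k =>
    refine mul_mem_filt ?_ hu
    rw [Submodule.span_image, hb]
    exact Submodule.mem_map_of_mem trivial

theorem tw_mem_filtPred (hd : ∀ i, b i ∈ homog (parity (g := g)) (d i)) (α : ZMod 2) (k : ℕ)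
    {u : U g} (hu : u ∈ filtPred b k) : tw α u ∈ filtPred b k := by
  cases k with
  | zero =>
    obtain rfl : u = 0 := hu
    simp [filtPred]
  | succ k =>
    refine tw_mem_filt ?_ tw_mem_one k α u hu
    rintro _ ⟨i, rfl⟩
    exact ⟨_, hd i⟩

theorem contractL_mem_filt (hd : ∀ i, b i ∈ homog (parity (g := g)) (d i)) (k : ℕ) :
    ∀ h : Module.Dual ℂ (U g), ∀ u ∈ filt (Set.range b) 1 k,
      contractL h u ∈ filt (Set.range b) 1 k := by
  induction k with
  | zero =>
    intro h u hu
    obtain ⟨c, rfl⟩ := Submodule.mem_one.mp hu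
    rw [Algebra.algebraMap_eq_smul_one, map_smul, contractL_one]
    exact Submodule.smul_mem _ _ (Submodule.smul_mem _ _ (Submodule.one_le.mp le_rfl))
  | succ k ih =>
    intro h
    refine filt_succ_le (W := (filt (Set.range b) 1 (k + 1)).comap (contractL h))
      (fun u hu => filt_le_succ k (ih h u hu)) ?_
    rintro _ ⟨i, rfl⟩ u hu
    rw [Submodule.mem_comap, contractL_ι_mul (hd i)]
    refine add_mem (filt_le_succ k (tw_mem_filt ?_ tw_mem_one k _ _ (ih _ u hu)))
      (ι_mul_mem_filt (Set.mem_range_self i) (ih h u hu))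
    rintro _ ⟨i, rfl⟩
    exact ⟨_, hd i⟩

/-- Up to lower degree, contraction by `h` is multiplication by the scalar `h 1`; when this is zero
the degree drops. -/
theorem contractL_mem_filtPred (hb : Submodule.span ℂ (Set.range b) = ⊤)
    (hd : ∀ i, b i ∈ homog (parity (g := g)) (d i)) {h : Module.Dual ℂ (U g)}
    (hh : h 1 = 0) (k : ℕ) : ∀ u ∈ filt (Set.range b) 1 k, contractL h u ∈ filtPred b k := by
  induction k with
  | zero =>
    intro u hu
    obtain ⟨c, rfl⟩ := Submodule.mem_one.mp hu
    rw [Algebra.algebraMap_eq_smul_one, map_smul, contractL_one, hh]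
    simp
  | succ k ih =>
    refine filt_succ_le (W := (filt (Set.range b) 1 k).comap (contractL h))
      (fun u hu => filtPred_le k (ih u hu)) ?_
    rintro _ ⟨i, rfl⟩ u hu
    rw [Submodule.mem_comap, contractL_ι_mul (hd i)]
    refine add_mem (tw_mem_filt ?_ tw_mem_one k _ _ (contractL_mem_filt hd k _ u hu))
      (mul_mem_filtPred hb _ (ih u hu))
    rintro _ ⟨i, rfl⟩
    exact ⟨_, hd i⟩

theorem contractL_add (f h : Module.Dual ℂ (U g)) (u : U g) :
    contractL (f + h) u = contractL f u + contractL h u := by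
  simp [contractL, TensorProduct.map_add_left]

theorem contractL_smul (c : ℂ) (f : Module.Dual ℂ (U g)) (u : U g) :
    contractL (c • f) u = c • contractL f u := by
  simp [contractL, TensorProduct.map_smul_left]

theorem contractL_dualOne (u : U g) : contractL 1 u = u := by
  suffices h : LinearMap.eqLocus (contractL (1 : Module.Dual ℂ (U g))) LinearMap.id = ⊤ by
    have : u ∈ LinearMap.eqLocus (contractL (1 : Module.Dual ℂ (U g))) LinearMap.id :=
      h ▸ trivial
    exact this
  apply eq_top_of_mul_left
  · simp [contractL_one, one_apply]
  · intro α x hx w hw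
    rw [LinearMap.mem_eqLocus, LinearMap.id_apply] at hw ⊢
    rw [contractL_ι_mul hx, translL_one, hw]
    have : contractL (0 : Module.Dual ℂ (U g)) w = 0 := by simpa using contractL_smul 0 0 w
    rw [this, map_zero, zero_add]

theorem exists_mem_filt (hb : Submodule.span ℂ (Set.range b) = ⊤) (u : U g) :
    ∃ k, u ∈ filt (Set.range b) 1 k := by
  have hmono : Monotone (filt (Set.range b) (1 : Submodule ℂ (U g))) :=
    monotone_nat_of_le_succ filt_le_succ
  have hW : (⨆ k, filt (Set.range b) (1 : Submodule ℂ (U g)) k) = ⊤ := by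
    apply eq_top_of_mul_left
    · exact Submodule.mem_iSup_of_mem 0 (Submodule.one_le.mp le_rfl)
    · intro α x _ w hw
      obtain ⟨k, hk⟩ := (Submodule.mem_iSup_of_directed _ hmono.directed_le).mp hw
      exact Submodule.mem_iSup_of_mem (k + 1) (mul_mem_filtPred hb x (k := k + 1) hk)
  exact (Submodule.mem_iSup_of_directed _ hmono.directed_le).mp (hW ▸ trivial)

variable [Fintype ι']

variable (b d f) in
/-- The operator `u ↦ ∑ᵢ bᵢ (± u ↼ fᵢ)`, which is multiplication by the degree up to terms of
lower degree. -/
def euler : U g →ₗ[ℂ] U g :=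
  ∑ i, LinearMap.mulLeft ℂ (ι g (b i)) ∘ₗ (tw (d i)).toLinearMap ∘ₗ contractL (f i)

theorem euler_apply (u : U g) :
    euler b d f u = ∑ i, ι g (b i) * tw (d i) (contractL (f i) u) := by
  simp [euler]

variable [DecidableEq ι']

/-- The analogue of Euler's identity for homogeneous polynomials, with `f i` dual to `b i`. On `b j
* u` the contraction by `f j` hits `b j` and returns one copy of `b j * u`. Otherwise the
contraction passes to `u`, and moving `b i` past `b j` costs a bracket, which is of lower degree
because the contraction has already lowered the degree of `u`. -/
theorem euler_sub_mem (hb : Submodule.span ℂ (Set.range b) = ⊤)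
    (hd : ∀ i, b i ∈ homog (parity (g := g)) (d i)) (hf1 : ∀ i, f i 1 = 0)
    (hf : ∀ i j, f i (ι g (b j)) = if i = j then 1 else 0) (k : ℕ) :
    ∀ u ∈ filt (Set.range b) 1 k, euler b d f u - (k : ℂ) • u ∈ filtPred b k := by
  induction k with
  | zero =>
    intro u hu
    have : ∀ i, contractL (f i) u = 0 := fun i => contractL_mem_filtPred hb hd (hf1 i) 0 u hu
    simp [euler_apply, this]
  | succ k ih =>
    refine filt_succ_le (W := (filt (Set.range b) 1 k).comap
      (euler b d f - ((k + 1 : ℕ) : ℂ) • LinearMap.id)) (fun u hu => ?_) ?_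
    · have h1 := filtPred_le k (ih u hu)
      have e : (euler b d f - ((k + 1 : ℕ) : ℂ) • LinearMap.id : U g →ₗ[ℂ] U g) u =
          (euler b d f u - (k : ℂ) • u) - u := by
        simp only [LinearMap.sub_apply, LinearMap.smul_apply, LinearMap.id_apply, Nat.cast_add,
          Nat.cast_one]
        module
      rw [Submodule.mem_comap, e]
      exact sub_mem h1 hu
    · rintro _ ⟨j, rfl⟩ u hu
      rw [Submodule.mem_comap]
      -- The translate of `f i` by `b j` is split into its value at `1`, a Kronecker delta, and a
      -- form vanishing at `1`, whose contraction is of lower degree.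
      have e1 : ∀ i, translL (ι g (b j)) (f i) = (if i = j then (1 : ℂ) else 0) • 1 +
          (translL (ι g (b j)) (f i) - (if i = j then (1 : ℂ) else 0) • 1) := fun i => by abel
      have hv : ∀ i, contractL (translL (ι g (b j)) (f i) -
          (if i = j then (1 : ℂ) else 0) • 1) u ∈ filtPred b k := by
        intro i
        refine contractL_mem_filtPred hb hd ?_ k u hu
        simp only [LinearMap.sub_apply, LinearMap.smul_apply, translL_apply, mul_one, hf,
          one_apply, map_one, smul_eq_mul, sub_self]
      obtain ⟨w, hw⟩ : ∃ w, (fun i => contractL (translL (ι g (b j)) (f i) -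
          (if i = j then (1 : ℂ) else 0) • 1) u) = w := ⟨_, rfl⟩
      have hw' : ∀ i, contractL (translL (ι g (b j)) (f i) -
          (if i = j then (1 : ℂ) else 0) • 1) u = w i := fun i => congrFun hw i
      have e2 : ∀ i, contractL (translL (ι g (b j)) (f i)) u =
          (if i = j then (1 : ℂ) else 0) • u + w i := by
        intro i
        rw [e1 i, contractL_add, contractL_smul, contractL_dualOne, ← hw' i]
      -- The last term sums over `i` to `b j` times the Euler operator on `u`, the first to one
      -- extra copy of `b j * u`; the terms between are of lower degree.
      have e3 : ∀ i, ι g (b i) * tw (d i) (contractL (f i) (ι g (b j) * u)) =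
          (if i = j then (1 : ℂ) else 0) • (ι g (b j) * u) +
          (ι g (b i) * tw (d i) (tw (d j) (w i)) +
          sgn (d i * d j) • (ι g (bracket (b i) (b j)) * tw (d i) (contractL (f i) u))) +
          ι g (b j) * (ι g (b i) * tw (d i) (contractL (f i) u)) := by
        intro i
        rw [contractL_ι_mul (hd j), e2, map_add, map_add, map_add, map_mul, tw_ι _ (hd j),
          ← ι_rel (hd i) (hd j), map_smul, map_smul, mul_add, mul_add, mul_smul_comm,
          smul_mul_assoc, mul_smul_comm, sub_mul, smul_sub, smul_mul_assoc, smul_smul,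
          sgn_mul_self, one_smul, mul_assoc, mul_assoc]
        have : (if i = j then (1 : ℂ) else 0) • (ι g (b i) * tw (d i) (tw (d j) u)) =
            (if i = j then (1 : ℂ) else 0) • (ι g (b j) * u) := by
          split_ifs with hij
          · subst hij
            rw [tw_tw]
          · simp
        rw [this]
        abel
      have e : (euler b d f - ((k + 1 : ℕ) : ℂ) • LinearMap.id : U g →ₗ[ℂ] U g) (ι g (b j) * u) =
          ι g (b j) * (euler b d f u - (k : ℂ) • u) +
          ∑ i, (ι g (b i) * tw (d i) (tw (d j) (w i)) +
          sgn (d i * d j) • (ι g (bracket (b i) (b j)) * tw (d i) (contractL (f i) u))) := by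
        simp only [LinearMap.sub_apply, LinearMap.smul_apply, LinearMap.id_apply, euler_apply, e3,
          Finset.sum_add_distrib, ← Finset.sum_smul, Finset.sum_ite_eq', Finset.mem_univ, if_true,
          mul_sub, Finset.mul_sum, mul_smul_comm, Nat.cast_add, Nat.cast_one]
        module
      rw [e]
      refine add_mem (mul_mem_filtPred hb _ (ih u hu)) (sum_mem fun i _ => add_mem ?_ ?_)
      · exact mul_mem_filtPred hb _ (tw_mem_filtPred hd _ k (tw_mem_filtPred hd _ k (hw' i ▸ hv i)))
      · refine Submodule.smul_mem _ _ (mul_mem_filtPred hb _ (tw_mem_filtPred hd _ k ?_))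
        exact contractL_mem_filtPred hb hd (hf1 i) k u hu

/-- A subspace of the augmentation ideal that is stable under the parity automorphism and under
the transposes of the multiplications by a system of coordinates vanishes. -/
theorem eq_zero_of_contractL_mem (hb : Submodule.span ℂ (Set.range b) = ⊤)
    (hd : ∀ i, b i ∈ homog (parity (g := g)) (d i)) (hf1 : ∀ i, f i 1 = 0)
    (hf : ∀ i j, f i (ι g (b j)) = if i = j then 1 else 0) {J : Submodule ℂ (U g)}
    (h1 : ∀ u ∈ J, counit u = 0) (hJ : ∀ i, ∀ u ∈ J, contractL (f i) u ∈ J) :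
    ∀ u ∈ J, u = 0 := by
  suffices H : ∀ k, ∀ u ∈ J, u ∈ filt (Set.range b) 1 k → u = 0 by
    intro u hu
    obtain ⟨k, hk⟩ := exists_mem_filt hb u
    exact H k u hu hk
  intro k
  induction k with
  | zero =>
    intro u hu hk
    obtain ⟨c, rfl⟩ := Submodule.mem_one.mp hk
    have := h1 _ hu
    rw [AlgHom.commutes] at this
    have hc : c = 0 := this
    rw [hc, map_zero]
  | succ k ih =>
    intro u hu hk
    have h2 : ∀ i, contractL (f i) u = 0 := fun i =>
      ih _ (hJ i u hu) (contractL_mem_filtPred hb hd (hf1 i) (k + 1) u hk)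
    -- All contractions of `u` vanish by induction, so the Euler operator kills `u`. As it also
    -- multiplies `u` by `k + 1` modulo degree `k`, the element `u` itself has degree at most `k`.
    have h3 := euler_sub_mem hb hd hf1 hf (k + 1) u hk
    have h4 : euler b d f u = 0 := by simp [euler_apply, h2]
    rw [h4, zero_sub] at h3
    have hne : ((k + 1 : ℕ) : ℂ) ≠ 0 := Nat.cast_ne_zero.mpr (Nat.succ_ne_zero k)
    have h5 := (Submodule.smul_mem_iff _ hne).mp (neg_mem_iff.mp h3)
    exact ih u hu h5

end Density

end U

end Filtration

/-! ### Anticommuting families and products of top degree. -/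

section Grassmann

variable {R : Type} [Ring R] [Algebra ℂ R] {κ : Type}

/-- The product of a list of elements of a family. -/
def listProd (e : κ → R) (l : List κ) : R := (l.map e).prod

@[simp] theorem listProd_nil (e : κ → R) : listProd e [] = 1 := rfl

@[simp] theorem listProd_cons (e : κ → R) (i : κ) (l : List κ) :
    listProd e (i :: l) = e i * listProd e l := by simp [listProd]

@[simp] theorem listProd_append (e : κ → R) (l l' : List κ) :
    listProd e (l ++ l') = listProd e l * listProd e l' := by simp [listProd]

theorem span_range_pow_le (e : κ → R) (k : ℕ) : Submodule.span ℂ (Set.range e) ^ k ≤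
    Submodule.span ℂ (listProd e '' {l | l.length = k}) := by
  induction k with
  | zero =>
    rw [pow_zero]
    refine Submodule.one_le.mpr (Submodule.subset_span ⟨[], rfl, rfl⟩)
  | succ k ih =>
    rw [pow_succ']
    refine (mul_le_mul' le_rfl ih).trans ?_
    rw [Submodule.span_mul_span, Submodule.span_le]
    rintro _ ⟨_, ⟨i, rfl⟩, _, ⟨l, hl, rfl⟩, rfl⟩
    exact Submodule.subset_span ⟨i :: l, by simpa using hl, by simp⟩

theorem listProd_mem_pow (e : κ → R) (l : List κ) :
    listProd e l ∈ Submodule.span ℂ (Set.range e) ^ l.length := by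
  induction l with
  | nil => simpa using ⟨1, map_one _⟩
  | cons i l ih =>
    rw [listProd_cons, List.length_cons, pow_succ']
    exact Submodule.mul_mem_mul (Submodule.subset_span ⟨i, rfl⟩) ih

/-- The members of the family anticommute. -/
def Anticomm (e : κ → R) : Prop := ∀ i j, e i * e j = -(e j * e i)

variable {e : κ → R}

theorem Anticomm.sq (he : Anticomm e) (i : κ) : e i * e i = 0 := by
  have h := he i i
  have h2 : (2 : ℂ) • (e i * e i) = 0 := by
    rw [two_smul]
    nth_rewrite 1 [h]
    simp
  simpa using h2

theorem Anticomm.op (he : Anticomm e) : Anticomm fun i => MulOpposite.op (e i) := fun i j => by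
  rw [← MulOpposite.op_mul, he j i, MulOpposite.op_neg, MulOpposite.op_mul]

theorem Anticomm.perm (he : Anticomm e) {l l' : List κ} (h : l.Perm l') :
    listProd e l = listProd e l' ∨ listProd e l = -listProd e l' := by
  induction h with
  | nil => exact Or.inl rfl
  | cons i _ ih =>
    rcases ih with ih | ih
    · exact Or.inl (by simp [ih])
    · exact Or.inr (by simp [ih])
  | swap i j l =>
    refine Or.inr ?_
    simp only [listProd_cons, ← mul_assoc]
    rw [he j i, neg_mul]
  | trans _ _ ih1 ih2 =>
    rcases ih1 with ih1 | ih1 <;> rcases ih2 with ih2 | ih2 <;> simp [ih1, ih2]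

theorem Anticomm.listProd_eq_zero_of_perm (he : Anticomm e) {l l' : List κ} (h : l.Perm l')
    (h0 : listProd e l' = 0) : listProd e l = 0 := by
  rcases he.perm h with h | h <;> simp [h, h0]

theorem Anticomm.mul_listProd_eq_zero (he : Anticomm e) [DecidableEq κ] {i : κ} {l : List κ}
    (hi : i ∈ l) : e i * listProd e l = 0 := by
  rw [← listProd_cons]
  refine he.listProd_eq_zero_of_perm ((List.perm_cons_erase hi).cons i) ?_
  simp only [listProd_cons]
  rw [← mul_assoc, he.sq, zero_mul]

theorem Anticomm.listProd_eq_zero (he : Anticomm e) [DecidableEq κ] {l : List κ}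
    (hl : ¬l.Nodup) : listProd e l = 0 := by
  induction l with
  | nil => exact absurd List.nodup_nil hl
  | cons i l ih =>
    rw [List.nodup_cons, not_and_or, not_not] at hl
    by_cases hi : i ∈ l
    · exact he.mul_listProd_eq_zero hi
    · rw [listProd_cons, ih (hl.resolve_left hi), mul_zero]

variable [Fintype κ] [DecidableEq κ]

/-- The list contains every element exactly once. -/
def Complete (l : List κ) : Prop := l.Nodup ∧ ∀ i, i ∈ l

theorem complete_univ : Complete (Finset.univ : Finset κ).toList :=
  ⟨Finset.nodup_toList _, fun i => by simp⟩

theorem Complete.perm {l l' : List κ} (h : Complete l) (h' : Complete l') : l.Perm l' :=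
  (List.perm_ext_iff_of_nodup h.1 h'.1).mpr fun i => ⟨fun _ => h'.2 i, fun _ => h.2 i⟩

theorem Complete.reverse {l : List κ} (h : Complete l) : Complete l.reverse :=
  ⟨List.nodup_reverse.mpr h.1, fun i => List.mem_reverse.mpr (h.2 i)⟩

theorem Complete.length {l : List κ} (h : Complete l) : l.length = Fintype.card κ := by
  have := (h.perm complete_univ).length_eq
  simpa using this

theorem complete_of_length {l : List κ} (hl : l.Nodup) (hc : l.length = Fintype.card κ) :
    Complete l := by
  refine ⟨hl, fun i => ?_⟩
  have h1 : l.toFinset = Finset.univ := by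
    apply Finset.eq_univ_of_card
    rw [List.toFinset_card_of_nodup hl, hc]
  have h2 : i ∈ l.toFinset := h1 ▸ Finset.mem_univ i
  exact List.mem_toFinset.mp h2

theorem Anticomm.listProd_eq_zero_of_card_lt (he : Anticomm e) {l : List κ}
    (hl : Fintype.card κ < l.length) : listProd e l = 0 := by
  refine he.listProd_eq_zero fun hn => ?_
  have h1 := Finset.card_le_univ l.toFinset
  rw [List.toFinset_card_of_nodup hn] at h1
  omega

theorem Anticomm.listProd_mem_span (he : Anticomm e) {L : List κ} (hL : Complete L) {l : List κ}
    (hl : l.length = Fintype.card κ) : listProd e l ∈ Submodule.span ℂ {listProd e L} := by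
  by_cases hn : l.Nodup
  · rcases he.perm ((complete_of_length hn hl).perm hL) with h | h
    · rw [h]
      exact Submodule.mem_span_singleton_self _
    · rw [h]
      exact neg_mem (Submodule.mem_span_singleton_self _)
  · rw [he.listProd_eq_zero hn]
    exact zero_mem _

theorem Anticomm.pow_card_le (he : Anticomm e) {L : List κ} (hL : Complete L) :
    Submodule.span ℂ (Set.range e) ^ Fintype.card κ ≤ Submodule.span ℂ {listProd e L} := by
  refine (span_range_pow_le e _).trans (Submodule.span_le.mpr ?_)
  rintro _ ⟨l, hl, rfl⟩
  exact he.listProd_mem_span hL hl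

/-- A derivation that maps the span of an anticommuting family into itself acts on the product of
all members by the trace. -/
theorem Anticomm.derivation_listProd (he : Anticomm e) {D : R →ₗ[ℂ] R}
    (hD : ∀ x y, D (x * y) = D x * y + x * D y) {m : κ → κ → ℂ}
    (hm : ∀ i, D (e i) = ∑ j, m i j • e j) {L : List κ} (hL : Complete L) :
    D (listProd e L) = (∑ i, m i i) • listProd e L := by
  have hD1 : D 1 = 0 := by
    have := hD 1 1
    simpa using this
  have key : ∀ l l' : List κ, Complete (l ++ l') → listProd e l * D (listProd e l') =
      (l'.map fun i => m i i).sum • listProd e (l ++ l') := by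
    intro l l'
    induction l' generalizing l with
    | nil => intro _; simp [hD1]
    | cons i l' ih =>
      intro h
      have e1 : l ++ i :: l' = (l ++ [i]) ++ l' := by simp
      have h2 := ih (l ++ [i]) (e1 ▸ h)
      rw [← e1] at h2
      -- Replacing the factor `e i` by `D (e i)`, only the diagonal coefficient survives: any other
      -- `e j` already occurs elsewhere in the product.
      have h3 : listProd e l * (D (e i) * listProd e l') = m i i • listProd e (l ++ i :: l') := by
        rw [hm, Finset.sum_mul, Finset.mul_sum, Finset.sum_eq_single i]
        · simp
        · intro j _ hji
          have hj : j ∈ l ++ l' := by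
            have := h.2 j
            simp only [List.mem_append, List.mem_cons] at this ⊢
            tauto
          have h4 : listProd e (l ++ j :: l') = 0 :=
            he.listProd_eq_zero_of_perm List.perm_middle
              (by rw [listProd_cons, he.mul_listProd_eq_zero hj])
          rw [smul_mul_assoc, mul_smul_comm, ← listProd_cons, ← listProd_append, h4, smul_zero]
        · simp
      rw [listProd_cons, hD, mul_add, h3, ← mul_assoc]
      have h5 : listProd e l * e i = listProd e (l ++ [i]) := by simp
      rw [h5, h2, List.map_cons, List.sum_cons, add_smul]
  have h := key [] L hL
  rw [listProd_nil, one_mul, List.nil_append] at h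
  rw [h]
  congr 1
  rw [← Finset.sum_map_toList, ((hL.perm complete_univ).map fun i => m i i).sum_eq]

theorem Anticomm.pow_pred_le (he : Anticomm e) {L : List κ} (hL : Complete L) {k : ℕ}
    (hk : k + 1 = Fintype.card κ) : Submodule.span ℂ (Set.range e) ^ k ≤
      Submodule.span ℂ (Set.range fun i => listProd e (L.erase i)) := by
  refine (span_range_pow_le e _).trans (Submodule.span_le.mpr ?_)
  rintro _ ⟨l, hl, rfl⟩
  rw [Set.mem_ofPred_eq] at hl
  by_cases hn : l.Nodup
  · obtain ⟨i, hi⟩ : ∃ i, i ∉ l := by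
      by_contra! h
      have := Complete.length (l := l) ⟨hn, h⟩
      omega
    have h1 : (i :: l).Perm L := (complete_of_length (List.nodup_cons.mpr ⟨hi, hn⟩)
      (by rw [List.length_cons, hl, hk])).perm hL
    have h2 : l.Perm (L.erase i) := (List.cons_perm_iff_perm_erase.mp h1).2
    have h3 : listProd e (L.erase i) ∈
        Submodule.span ℂ (Set.range fun i => listProd e (L.erase i)) :=
      Submodule.subset_span ⟨i, rfl⟩
    rcases he.perm h2 with h | h
    · rw [h]
      exact h3
    · rw [h]
      exact neg_mem h3
  · rw [he.listProd_eq_zero hn]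
    exact zero_mem _

theorem Anticomm.mul_listProd_erase (he : Anticomm e) {L : List κ} (hL : Complete L) (i j : κ) :
    ∃ c : ℂ, (i = j → c ≠ 0) ∧ (i ≠ j → c = 0) ∧
      e i * listProd e (L.erase j) = c • listProd e L := by
  by_cases hij : i = j
  · subst hij
    have h1 : (i :: L.erase i).Perm L := (List.perm_cons_erase (hL.2 i)).symm
    rcases he.perm h1 with h | h
    · exact ⟨1, by simp, by simp, by simpa using h⟩
    · exact ⟨-1, by simp, by simp, by simpa using h⟩
  · refine ⟨0, fun h => absurd h hij, fun _ => rfl, ?_⟩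
    rw [zero_smul, he.mul_listProd_eq_zero]
    exact (List.mem_erase_of_ne hij).mpr (hL.2 i)

/-- Nondegeneracy of the product of elements of degree one and of degree one less than the top. -/
theorem Anticomm.eq_zero_of_mul_mem (he : Anticomm e) {L : List κ} (hL : Complete L) {k : ℕ}
    (hk : k + 1 = Fintype.card κ) {N : Submodule ℂ R} {v : R}
    (hv : listProd e L * v ∉ N) {w : R} (hw : w ∈ Submodule.span ℂ (Set.range e) ^ k)
    (h : ∀ i, e i * w * v ∈ N) : w = 0 := by
  obtain ⟨c, rfl⟩ := (Submodule.mem_span_range_iff_exists_fun ℂ).mp (he.pow_pred_le hL hk hw)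
  refine Finset.sum_eq_zero fun i _ => ?_
  choose a ha1 ha0 ha using fun j => he.mul_listProd_erase hL i j
  have h1 := h i
  rw [Finset.mul_sum, Finset.sum_eq_single i, mul_smul_comm, ha, smul_smul, smul_mul_assoc] at h1
  · by_cases hc : c i = 0
    · rw [hc, zero_smul]
    · exact absurd ((Submodule.smul_mem_iff _ (mul_ne_zero hc (ha1 i rfl))).mp h1) hv
  · intro j _ hj
    rw [mul_smul_comm, ha, ha0 j (Ne.symm hj), zero_smul, smul_zero]
  · simp

/-- In a left module generated by a vector `v` on which `H` acts by scalars, commuting an element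
`x` past a product of anticommuting elements. -/
theorem mul_mem_of_mem_pow {H : Set R} {N : Ideal R} {x v : R}
    (hx : ∀ i, x * e i + e i * x ∈ H)
    (hH : ∀ h ∈ H, ∀ i, h * e i - e i * h ∈ Submodule.span ℂ (Set.range e))
    (hHv : ∀ h ∈ H, ∃ c : ℂ, h * v - c • v ∈ N) (hxv : x * v ∈ N) (k : ℕ) :
    ∀ w ∈ Submodule.span ℂ (Set.range e) ^ (k + 1), ∃ w' ∈ Submodule.span ℂ (Set.range e) ^ k,
      x * w * v - w' * v ∈ N := by
  have hN : ∀ {y : R} (z : R), y ∈ N → z * y ∈ N := fun z hy => N.mul_mem_left z hy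
  have hNs : ∀ {y : R} (c : ℂ), y ∈ N → c • y ∈ N := fun c hy => by
    rw [Algebra.smul_def]
    exact hN _ hy
  -- Elements of `H` preserve the degree modulo `N`: moving `h` to the right replaces factors by
  -- their commutators with `h`, and a scalar remains at `v`.
  have hC : ∀ h ∈ H, ∀ k, ∀ w ∈ Submodule.span ℂ (Set.range e) ^ k,
      ∃ w' ∈ Submodule.span ℂ (Set.range e) ^ k, h * w * v - w' * v ∈ N := by
    intro h hh k
    induction k with
    | zero =>
      intro w hw
      rw [pow_zero] at hw
      obtain ⟨a, rfl⟩ := Submodule.mem_one.mp hw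
      obtain ⟨c, hc⟩ := hHv h hh
      refine ⟨algebraMap ℂ R (a * c), by rw [pow_zero]; exact Submodule.mem_one.mpr ⟨_, rfl⟩, ?_⟩
      have e1 : h * algebraMap ℂ R a * v - algebraMap ℂ R (a * c) * v = a • (h * v - c • v) := by
        rw [← Algebra.commutes, smul_sub, smul_smul, Algebra.smul_def, Algebra.smul_def, mul_assoc]
      rw [e1]
      exact hNs a hc
    | succ k ih =>
      intro w hw
      rw [pow_succ'] at hw
      induction hw using Submodule.mul_induction_on' with
      | mem_mul_mem m hm w hw =>
        have h1 : h * m - m * h ∈ Submodule.span ℂ (Set.range e) := by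
          induction hm using Submodule.span_induction with
          | mem m hm =>
            obtain ⟨i, rfl⟩ := hm
            exact hH h hh i
          | zero => simp
          | add m m' _ _ hm hm' =>
            rw [mul_add, add_mul, add_sub_add_comm]
            exact add_mem hm hm'
          | smul c m _ hm =>
            rw [mul_smul_comm, smul_mul_assoc, ← smul_sub]
            exact Submodule.smul_mem _ _ hm
        obtain ⟨w', hw', h2⟩ := ih w hw
        refine ⟨m * w' + (h * m - m * h) * w, ?_, ?_⟩
        · rw [pow_succ']
          exact add_mem (Submodule.mul_mem_mul hm hw') (Submodule.mul_mem_mul h1 hw)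
        · have e1 : h * (m * w) * v - (m * w' + (h * m - m * h) * w) * v =
              m * (h * w * v - w' * v) := by noncomm_ring
          rw [e1]
          exact hN _ h2
      | add w1 _ w2 _ h1 h2 =>
        obtain ⟨w1', hw1', h1⟩ := h1
        obtain ⟨w2', hw2', h2⟩ := h2
        refine ⟨w1' + w2', add_mem hw1' hw2', ?_⟩
        have e1 : h * (w1 + w2) * v - (w1' + w2') * v =
          (h * w1 * v - w1' * v) + (h * w2 * v - w2' * v) := by noncomm_ring
        rw [e1]
        exact add_mem h1 h2
  -- For a factor `m = e i` one uses `x * e i = (x * e i + e i * x) - e i * x`; the bracketed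
  -- element lies in `H` and keeps the degree of `w`. The condition on `w'` expresses that its
  -- degree is one less than that of `w`, in a form that still makes sense for `k = 0`, where `w' =
  -- 0`.
  have step : ∀ k, ∀ w ∈ Submodule.span ℂ (Set.range e) ^ k,
      (∃ w', (∀ i, e i * w' ∈ Submodule.span ℂ (Set.range e) ^ k) ∧ x * w * v - w' * v ∈ N) →
      ∀ m ∈ Submodule.span ℂ (Set.range e), ∃ w' ∈ Submodule.span ℂ (Set.range e) ^ k,
        x * (m * w) * v - w' * v ∈ N := by
    rintro k w hw ⟨w', hw', h1⟩ m hm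
    induction hm using Submodule.span_induction with
    | mem m hm =>
      obtain ⟨i, rfl⟩ := hm
      obtain ⟨w'', hw'', h2⟩ := hC _ (hx i) k w hw
      refine ⟨w'' - e i * w', sub_mem hw'' (hw' i), ?_⟩
      have e1 : x * (e i * w) * v - (w'' - e i * w') * v =
          ((x * e i + e i * x) * w * v - w'' * v) - e i * (x * w * v - w' * v) := by noncomm_ring
      rw [e1]
      exact sub_mem h2 (hN _ h1)
    | zero => exact ⟨0, zero_mem _, by simp⟩
    | add m1 m2 _ _ h1 h2 =>
      obtain ⟨w1', hw1', h1⟩ := h1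
      obtain ⟨w2', hw2', h2⟩ := h2
      refine ⟨w1' + w2', add_mem hw1' hw2', ?_⟩
      have e1 : x * ((m1 + m2) * w) * v - (w1' + w2') * v =
        (x * (m1 * w) * v - w1' * v) + (x * (m2 * w) * v - w2' * v) := by noncomm_ring
      rw [e1]
      exact add_mem h1 h2
    | smul c m _ h1 =>
      obtain ⟨w1', hw1', h1⟩ := h1
      refine ⟨c • w1', Submodule.smul_mem _ _ hw1', ?_⟩
      have e1 : x * ((c • m) * w) * v - (c • w1') * v = c • (x * (m * w) * v - w1' * v) := by
        simp only [smul_mul_assoc, mul_smul_comm, smul_sub]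
      rw [e1]
      exact hNs c h1
  have sum : ∀ k, ∀ w1 w2 : R, (∃ w' ∈ Submodule.span ℂ (Set.range e) ^ k,
      x * w1 * v - w' * v ∈ N) → (∃ w' ∈ Submodule.span ℂ (Set.range e) ^ k,
      x * w2 * v - w' * v ∈ N) → ∃ w' ∈ Submodule.span ℂ (Set.range e) ^ k,
      x * (w1 + w2) * v - w' * v ∈ N := by
    rintro k w1 w2 ⟨w1', hw1', h1⟩ ⟨w2', hw2', h2⟩
    refine ⟨w1' + w2', add_mem hw1' hw2', ?_⟩
    have e1 : x * (w1 + w2) * v - (w1' + w2') * v =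
      (x * w1 * v - w1' * v) + (x * w2 * v - w2' * v) := by noncomm_ring
    rw [e1]
    exact add_mem h1 h2
  induction k with
  | zero =>
    intro w hw
    rw [pow_succ'] at hw
    induction hw using Submodule.mul_induction_on' with
    | mem_mul_mem m hm w hw =>
      refine step 0 w hw ⟨0, by simp, ?_⟩ m hm
      rw [pow_zero] at hw
      obtain ⟨a, rfl⟩ := Submodule.mem_one.mp hw
      rw [zero_mul, sub_zero, ← Algebra.commutes, mul_assoc]
      exact hN _ hxv
    | add w1 _ w2 _ h1 h2 => exact sum 0 w1 w2 h1 h2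
  | succ k ih =>
    intro w hw
    rw [pow_succ'] at hw
    induction hw using Submodule.mul_induction_on' with
    | mem_mul_mem m hm w hw =>
      obtain ⟨w', hw', h1⟩ := ih w hw
      refine step (k + 1) w hw ⟨w', fun i => ?_, h1⟩ m hm
      rw [pow_succ']
      exact Submodule.mul_mem_mul (Submodule.subset_span ⟨i, rfl⟩) hw'
    | add w1 _ w2 _ h1 h2 => exact sum (k + 1) w1 w2 h1 h2

/-- If `H` annihilates the top product applied to `v`, then so does `x`. -/
theorem Anticomm.mul_listProd_mul_mem (he : Anticomm e) [Nonempty κ] {L : List κ}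
    (hL : Complete L) {H : Set R} {N : Ideal R} {x v : R}
    (hx : ∀ i, x * e i + e i * x ∈ H)
    (hH : ∀ h ∈ H, ∀ i, h * e i - e i * h ∈ Submodule.span ℂ (Set.range e))
    (hHv : ∀ h ∈ H, ∃ c : ℂ, h * v - c • v ∈ N) (hxv : x * v ∈ N)
    (hHE : ∀ h ∈ H, h * (listProd e L * v) ∈ N) (hE : listProd e L * v ∉ N) :
    x * (listProd e L * v) ∈ N := by
  obtain ⟨k, hk⟩ : ∃ k, k + 1 = Fintype.card κ :=
    ⟨Fintype.card κ - 1, Nat.sub_add_cancel Fintype.card_pos⟩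
  have hEm : listProd e L ∈ Submodule.span ℂ (Set.range e) ^ (k + 1) := by
    rw [hk, ← hL.length]
    exact listProd_mem_pow e L
  obtain ⟨w, hw, h1⟩ := mul_mem_of_mem_pow hx hH hHv hxv k _ hEm
  -- Modulo `N`, `e i * w * v` equals `(x * e i + e i * x)` applied to the top vector, minus `x * (e
  -- i * listProd e L) * v`. The first lies in `N` by `hHE`, and the second is zero since a factor
  -- repeats. Nondegeneracy in degree one below the top applies because the top vector is outside
  -- `N`.
  have hw0 : w = 0 := by
    refine he.eq_zero_of_mul_mem hL hk (N := N.restrictScalars ℂ) (v := v) hE hw fun i => ?_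
    have e1 : e i * w * v = (x * e i + e i * x) * (listProd e L * v) -
        x * (e i * listProd e L) * v - e i * (x * listProd e L * v - w * v) := by noncomm_ring
    have e2 : e i * listProd e L = 0 := he.mul_listProd_eq_zero (hL.2 i)
    rw [e2, mul_zero, zero_mul, sub_zero] at e1
    rw [e1]
    exact sub_mem (hHE _ (hx i)) (N.mul_mem_left _ h1)
  rw [hw0, zero_mul, sub_zero, mul_assoc] at h1
  exact h1

end Grassmann

/-! ### Star representations and the normalized invariant integral. -/

section Haar

open scoped Matrix ComplexOrder

/-- A space of matrices that is stable under products and adjoints has a unit element. -/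
theorem exists_unit_of_star {κ : Type} [Fintype κ] [DecidableEq κ]
    (S : Submodule ℂ (Matrix κ κ ℂ)) (hmul : ∀ x ∈ S, ∀ y ∈ S, x * y ∈ S)
    (hstar : ∀ x ∈ S, xᴴ ∈ S) : ∃ p ∈ S, ∀ x ∈ S, p * x = x ∧ x * p = x := by
  let T : S →ₗ[ℂ] Module.Dual ℂ S := LinearMap.mk₂ ℂ (fun x y : S => Matrix.trace (x.1 * y.1))
    (fun x y z => by simp [add_mul]) (fun c x y => by simp)
    (fun x y z => by simp [mul_add]) (fun c x y => by simp)
  -- Pairing `x` with its adjoint shows that the trace form is nondegenerate on `S`. Hence the trace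
  -- itself is represented by an element `p` of `S`, the candidate for the unit.
  have hT : Function.Injective T := by
    rw [injective_iff_map_eq_zero]
    intro x hx
    have h := LinearMap.congr_fun hx ⟨x.1ᴴ, hstar _ x.2⟩
    have h2 : Matrix.trace (x.1 * x.1ᴴ) = 0 := h
    exact Subtype.ext (Matrix.trace_mul_conjTranspose_self_eq_zero_iff.mp h2)
  have hT' : Function.Surjective T :=
    (LinearMap.injective_iff_surjective_of_finrank_eq_finrank
      (Subspace.dual_finrank_eq (K := ℂ) (V := S)).symm).mp hT
  obtain ⟨p, hp⟩ := hT' (Matrix.traceLinearMap κ ℂ ℂ ∘ₗ S.subtype)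
  have hp1 : ∀ y ∈ S, Matrix.trace (p.1 * y) = Matrix.trace y := fun y hy =>
    LinearMap.congr_fun hp ⟨y, hy⟩
  have hp2 : ∀ x ∈ S, p.1 * x = x := by
    intro x hx
    -- Put `y = x - p * x`. The matrix `y * yᴴ` equals `x * yᴴ - p * (x * yᴴ)`, whose trace is zero
    -- by the choice of `p`; hence `y = 0`.
    have h1 : (x - p.1 * x) * (x - p.1 * x)ᴴ ∈ S := by
      have h2 := S.sub_mem hx (hmul _ p.2 _ hx)
      exact hmul _ h2 _ (hstar _ h2)
    have h2 : x * (x - p.1 * x)ᴴ ∈ S := hmul _ hx _ (hstar _ (S.sub_mem hx (hmul _ p.2 _ hx)))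
    have h3 : Matrix.trace ((x - p.1 * x) * (x - p.1 * x)ᴴ) = 0 := by
      rw [sub_mul, Matrix.trace_sub, mul_assoc, hp1 _ h2, sub_self]
    exact (sub_eq_zero.mp (Matrix.trace_mul_conjTranspose_self_eq_zero_iff.mp h3)).symm
  have hp3 : ∀ x ∈ S, x * p.1ᴴ = x := by
    intro x hx
    have := congrArg Matrix.conjTranspose (hp2 _ (hstar x hx))
    simpa using this
  have hp4 : p.1ᴴ = p.1 := by
    rw [← hp2 _ (hstar _ p.2), hp3 _ p.2]
  exact ⟨p.1, p.2, fun x hx => ⟨hp2 x hx, by have := hp3 x hx; rwa [hp4] at this⟩⟩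

variable {g : Type} [AddCommGroup g] [Module ℂ g] [LieSuperalgebra g]

/-- A matrix representation that intertwines `st` with the adjoint. -/
def IsStarRep (st : g → g) {κ : Type} [Fintype κ] [DecidableEq κ]
    (ρ : U g →ₐ[ℂ] Matrix κ κ ℂ) : Prop := ∀ x, ρ (ι g (st x)) = (ρ (ι g x))ᴴ

/-- A linear form that factors through a star representation. -/
def IsUnitary (st : g → g) (a : Module.Dual ℂ (U g)) : Prop :=
  ∃ (κ : Type) (_ : Fintype κ) (_ : DecidableEq κ) (ρ : U g →ₐ[ℂ] Matrix κ κ ℂ),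
    IsStarRep st ρ ∧ ∀ u, ρ u = 0 → a u = 0

/-- The map `st` is an arbitrary function on `g`, so no star operation on `U(g)` is at hand. An
element with the adjoint image is found word by word, with compatible counit; this suffices to see
that the image of the augmentation ideal is stable under adjoints. -/
theorem IsStarRep.exists_star {st : g → g} {κ : Type} [Fintype κ] [DecidableEq κ]
    {ρ : U g →ₐ[ℂ] Matrix κ κ ℂ} (hρ : IsStarRep st ρ) (u : U g) :
    ∃ u', ρ u' = (ρ u)ᴴ ∧ counit u' = star (counit u) := by
  have hu : u ∈ Algebra.adjoin ℂ (Set.range (ι g)) := by rw [adjoin_range_ι]; trivial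
  induction hu using Algebra.adjoin_induction with
  | mem u hu =>
    obtain ⟨x, rfl⟩ := hu
    exact ⟨_, hρ x, by simp⟩
  | algebraMap r =>
    refine ⟨algebraMap ℂ _ (star r), ?_, ?_⟩
    · simp [Algebra.algebraMap_eq_smul_one]
    · simp
  | add u v _ _ hu hv =>
    obtain ⟨u', hu1, hu2⟩ := hu
    obtain ⟨v', hv1, hv2⟩ := hv
    exact ⟨u' + v', by simp [hu1, hv1], by simp [hu2, hv2]⟩
  | mul u v _ _ hu hv =>
    obtain ⟨u', hu1, hu2⟩ := hu
    obtain ⟨v', hv1, hv2⟩ := hv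
    exact ⟨v' * u', by simp [hu1, hv1], by simp [hu2, hv2, mul_comm]⟩

/-- `u` acts on `a` as the projection onto the invariants. -/
def IsAverage (a : Module.Dual ℂ (U g)) (u : U g) : Prop :=
  counit u = 1 ∧ (∀ x, a (x * u) = counit x * a u) ∧ ∀ x, a (u * x) = counit x * a u

/-- The image of the augmentation ideal is a matrix algebra stable under adjoints; let `ρ u` be its
unit. Then `1 - u` has counit `1`, and in the representation it is killed from both sides by the
augmentation ideal. The element depends on `ρ` only, so it serves all coefficients of `ρ` at once.
-/
theorem IsStarRep.exists_average {st : g → g} {κ : Type} [Fintype κ] [DecidableEq κ]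
    {ρ : U g →ₐ[ℂ] Matrix κ κ ℂ} (hρ : IsStarRep st ρ) :
    ∃ u, ∀ a : Module.Dual ℂ (U g), (∀ u, ρ u = 0 → a u = 0) → IsAverage a u := by
  obtain ⟨p, ⟨u, hu, rfl⟩, hp⟩ := exists_unit_of_star
    ((LinearMap.ker (counit (g := g)).toLinearMap).map ρ.toLinearMap)
    (by
      rintro _ ⟨x, hx, rfl⟩ _ ⟨y, hy, rfl⟩
      have hx' : counit x = 0 := hx
      exact ⟨x * y, by simp [hx'], by simp⟩)
    (by
      rintro _ ⟨x, hx, rfl⟩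
      obtain ⟨x', h1, h2⟩ := hρ.exists_star x
      have hx' : counit x = 0 := hx
      exact ⟨x', by simp [h2, hx'], h1⟩)
  have hu0 : counit u = 0 := hu
  refine ⟨1 - u, fun a ha => ⟨by simp [hu0], fun x => ?_, fun x => ?_⟩⟩
  · have h1 : ρ ((x - algebraMap ℂ _ (counit x)) * (1 - u)) = 0 := by
      have := (hp _ ⟨x - algebraMap ℂ _ (counit x), by simp, rfl⟩).2
      rw [AlgHom.toLinearMap_apply, AlgHom.toLinearMap_apply] at this
      rw [map_mul, map_sub ρ 1, map_one, mul_sub, this, mul_one, sub_self]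
    have h2 := ha _ h1
    rw [sub_mul, map_sub, ← Algebra.smul_def, map_smul, sub_eq_zero] at h2
    exact h2
  · have h1 : ρ ((1 - u) * (x - algebraMap ℂ _ (counit x))) = 0 := by
      have := (hp _ ⟨x - algebraMap ℂ _ (counit x), by simp, rfl⟩).1
      rw [AlgHom.toLinearMap_apply, AlgHom.toLinearMap_apply] at this
      rw [map_mul, map_sub ρ 1, map_one, sub_mul, this, one_mul, sub_self]
    have h2 := ha _ h1
    rw [mul_sub, map_sub, ← Algebra.commutes, ← Algebra.smul_def, map_smul, sub_eq_zero] at h2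
    exact h2

/-- The direct sum of two matrix representations. -/
def sumRep {κ κ' : Type} [Fintype κ] [DecidableEq κ] [Fintype κ'] [DecidableEq κ']
    (ρ : U g →ₐ[ℂ] Matrix κ κ ℂ) (ρ' : U g →ₐ[ℂ] Matrix κ' κ' ℂ) :
    U g →ₐ[ℂ] Matrix (κ ⊕ κ') (κ ⊕ κ') ℂ where
  toFun u := Matrix.fromBlocks (ρ u) 0 0 (ρ' u)
  map_one' := by simp
  map_mul' u v := by simp [Matrix.fromBlocks_multiply]
  map_zero' := by simp
  map_add' u v := by simp [Matrix.fromBlocks_add]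
  commutes' c := by
    simp [Algebra.algebraMap_eq_smul_one, ← Matrix.fromBlocks_one, Matrix.fromBlocks_smul]

theorem sumRep_apply {κ κ' : Type} [Fintype κ] [DecidableEq κ] [Fintype κ'] [DecidableEq κ']
    (ρ : U g →ₐ[ℂ] Matrix κ κ ℂ) (ρ' : U g →ₐ[ℂ] Matrix κ' κ' ℂ) (u : U g) :
    sumRep ρ ρ' u = Matrix.fromBlocks (ρ u) 0 0 (ρ' u) := rfl

/-- The direct sum of two star representations is a star representation. A common representation
yields a common average, which is what makes the integral additive. -/
theorem IsUnitary.exists_common {st : g → g} {a b : Module.Dual ℂ (U g)} (ha : IsUnitary st a)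
    (hb : IsUnitary st b) :
    ∃ (κ : Type) (_ : Fintype κ) (_ : DecidableEq κ) (ρ : U g →ₐ[ℂ] Matrix κ κ ℂ),
      IsStarRep st ρ ∧ (∀ u, ρ u = 0 → a u = 0) ∧ ∀ u, ρ u = 0 → b u = 0 := by
  obtain ⟨κ, _, _, ρ, hρ, ha⟩ := ha
  obtain ⟨κ', _, _, ρ', hρ', hb⟩ := hb
  refine ⟨κ ⊕ κ', inferInstance, inferInstance, sumRep ρ ρ', fun x => ?_, fun u hu => ?_,
    fun u hu => ?_⟩
  · simp [sumRep_apply, hρ x, hρ' x, Matrix.fromBlocks_conjTranspose]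
  · rw [sumRep_apply, ← Matrix.fromBlocks_zero, Matrix.fromBlocks_inj] at hu
    exact ha u hu.1
  · rw [sumRep_apply, ← Matrix.fromBlocks_zero, Matrix.fromBlocks_inj] at hu
    exact hb u hu.2.2.2

theorem IsUnitary.exists_average {st : g → g} {a b : Module.Dual ℂ (U g)} (ha : IsUnitary st a)
    (hb : IsUnitary st b) : ∃ u, IsAverage a u ∧ IsAverage b u := by
  obtain ⟨κ, _, _, ρ, hρ, ha, hb⟩ := ha.exists_common hb
  obtain ⟨u, hu⟩ := hρ.exists_average
  exact ⟨u, hu a ha, hu b hb⟩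

theorem IsUnitary.add {st : g → g} {a b : Module.Dual ℂ (U g)} (ha : IsUnitary st a)
    (hb : IsUnitary st b) : IsUnitary st (a + b) := by
  obtain ⟨κ, _, _, ρ, hρ, ha, hb⟩ := ha.exists_common hb
  exact ⟨κ, _, _, ρ, hρ, fun u hu => by simp [ha u hu, hb u hu]⟩

theorem isUnitary_algebraMap (st : g → g) (c : ℂ) :
    IsUnitary st (algebraMap ℂ (Module.Dual ℂ (U g)) c) := by
  refine ⟨Unit, inferInstance, inferInstance, (Algebra.ofId ℂ _).comp counit, fun x => by simp,
    fun u hu => ?_⟩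
  have h := congrFun (congrFun hu ()) ()
  have h2 : counit u = 0 := by simpa [Algebra.ofId_apply, Matrix.algebraMap_matrix_apply] using h
  rw [Algebra.algebraMap_eq_smul_one, LinearMap.smul_apply, one_apply, h2, smul_zero]

section Tensor

variable {κ κ' : Type} [Fintype κ] [DecidableEq κ] [Fintype κ'] [DecidableEq κ']
  (hg : ∀ x : g, parity x = x)

open scoped Kronecker

/-- The tensor product of two matrix representations of a Lie algebra. -/
def tensorRep (ρ : U g →ₐ[ℂ] Matrix κ κ ℂ) (ρ' : U g →ₐ[ℂ] Matrix κ' κ' ℂ) :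
    U g →ₐ[ℂ] Matrix (κ × κ') (κ × κ') ℂ :=
  lift (g := g)
    { toFun := fun x => ρ (ι g x) ⊗ₖ (1 : Matrix κ' κ' ℂ) + (1 : Matrix κ κ ℂ) ⊗ₖ ρ' (ι g x)
      map_add' := fun x y => by
        simp only [map_add, Matrix.add_kronecker, Matrix.kronecker_add]
        abel
      map_smul' := fun c x => by
        simp only [map_smul, Matrix.smul_kronecker, Matrix.kronecker_smul, RingHom.id_apply,
          smul_add] }
    fun α β x hx y hy => by
      have hodd : ∀ z : g, z ∈ homog parity 1 → z = 0 := fun z hz => by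
        refine eq_zero_of_mem_homog_id ?_
        rw [mem_homog] at hz ⊢
        rw [hg] at hz
        exact hz
      rcases zmod_two_cases α with rfl | rfl
      · rcases zmod_two_cases β with rfl | rfl
        · simp only [LinearMap.coe_mk, AddHom.coe_mk]
          rw [← ι_rel hx hy]
          simp only [zero_mul, sgn_zero, one_smul, map_sub, map_mul, add_mul, mul_add,
            ← Matrix.mul_kronecker_mul, one_mul, mul_one]
          ext i j
          simp only [Matrix.sub_apply, Matrix.add_apply, Matrix.kroneckerMap_apply]
          ring
        · simp [hodd y hy]
      · simp [hodd x hx]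

theorem tensorRep_ι (ρ : U g →ₐ[ℂ] Matrix κ κ ℂ) (ρ' : U g →ₐ[ℂ] Matrix κ' κ' ℂ) (x : g) :
    tensorRep hg ρ ρ' (ι g x) =
      ρ (ι g x) ⊗ₖ (1 : Matrix κ' κ' ℂ) + (1 : Matrix κ κ ℂ) ⊗ₖ ρ' (ι g x) := by
  simp [tensorRep]

/-- The matrix elements of a representation. -/
def coeff (ρ : U g →ₐ[ℂ] Matrix κ κ ℂ) (i j : κ) : Module.Dual ℂ (U g) :=
  Matrix.entryLinearMap ℂ ℂ i j ∘ₗ ρ.toLinearMap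

@[simp] theorem coeff_apply (ρ : U g →ₐ[ℂ] Matrix κ κ ℂ) (i j : κ) (u : U g) :
    coeff ρ i j u = ρ u i j := rfl

theorem translR_coeff (ρ : U g →ₐ[ℂ] Matrix κ κ ℂ) (i j : κ) (x : U g) :
    translR x (coeff ρ i j) = ∑ m, ρ x m j • coeff ρ i m := by
  ext u
  simp [Matrix.mul_apply, mul_comm]

theorem translL_coeff (ρ : U g →ₐ[ℂ] Matrix κ κ ℂ) (i j : κ) (x : U g) :
    translL x (coeff ρ i j) = ∑ m, ρ x i m • coeff ρ m j := by
  ext u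
  simp [Matrix.mul_apply]

/-- By this, products of forms factoring through star representations factor through their tensor
product. As `g` is purely even, no signs occur, and the two sides obey the same rule under right
translation. -/
theorem coeff_mul_coeff (ρ : U g →ₐ[ℂ] Matrix κ κ ℂ) (ρ' : U g →ₐ[ℂ] Matrix κ' κ' ℂ) (i j : κ)
    (k l : κ') : coeff ρ i j * coeff ρ' k l = coeff (tensorRep hg ρ ρ') (i, k) (j, l) := by
  have H := dual_eq_zero_of_translR (g := g) (S := {F | ∃ i j k l,
    F = coeff ρ i j * coeff ρ' k l - coeff (tensorRep hg ρ ρ') (i, k) (j, l)}) ?_ ?_ _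
    ⟨i, j, k, l, rfl⟩
  · exact sub_eq_zero.mp H
  · rintro _ ⟨i, j, k, l, rfl⟩
    simp only [LinearMap.sub_apply, mul_apply_one, coeff_apply, map_one, Matrix.one_apply,
      Prod.mk.injEq]
    split_ifs <;> simp_all
  · rintro α x hx _ ⟨i, j, k, l, rfl⟩
    have hd : dtw α (coeff ρ i j) = coeff ρ i j ∨ x = 0 := by
      rcases zmod_two_cases α with rfl | rfl
      · exact Or.inl (dtw_zero _)
      · refine Or.inr (eq_zero_of_mem_homog_id ?_)
        rw [mem_homog] at hx ⊢
        rw [hg] at hx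
        exact hx
    rcases hd with hd | rfl
    · have e : translR (ι g x)
          (coeff ρ i j * coeff ρ' k l - coeff (tensorRep hg ρ ρ') (i, k) (j, l)) =
          ∑ m, ρ (ι g x) m j •
            (coeff ρ i m * coeff ρ' k l - coeff (tensorRep hg ρ ρ') (i, k) (m, l)) +
          ∑ m, ρ' (ι g x) m l •
            (coeff ρ i j * coeff ρ' k m - coeff (tensorRep hg ρ ρ') (i, k) (j, m)) := by
        have h1 : translR (ι g x) (coeff (tensorRep hg ρ ρ') (i, k) (j, l)) =
            ∑ m, ρ (ι g x) m j • coeff (tensorRep hg ρ ρ') (i, k) (m, l) +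
            ∑ m, ρ' (ι g x) m l • coeff (tensorRep hg ρ ρ') (i, k) (j, m) := by
          rw [translR_coeff, Fintype.sum_prod_type]
          simp only [tensorRep_ι, Matrix.add_apply, Matrix.kroneckerMap_apply, add_smul,
            Finset.sum_add_distrib, Matrix.one_apply, mul_ite, mul_one, mul_zero, ite_smul,
            zero_smul, ite_mul, one_mul, zero_mul, Finset.sum_ite_eq', Finset.mem_univ, if_true]
          congr 1
          rw [Finset.sum_comm]
          simp
        rw [map_sub, translR_mul hx, hd, translR_coeff, translR_coeff, h1, Finset.sum_mul,
          Finset.mul_sum]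
        simp only [smul_mul_assoc, mul_smul_comm, smul_sub, Finset.sum_sub_distrib]
        abel
      rw [e]
      exact add_mem (sum_mem fun m _ => Submodule.smul_mem _ _
        (Submodule.subset_span ⟨_, _, _, _, rfl⟩)) (sum_mem fun m _ => Submodule.smul_mem _ _
        (Submodule.subset_span ⟨_, _, _, _, rfl⟩))
    · have : translR (ι g 0) = 0 := by
        ext f u
        simp
      rw [this]
      exact zero_mem _

theorem exists_eq_sum_coeff {ρ : U g →ₐ[ℂ] Matrix κ κ ℂ} {a : Module.Dual ℂ (U g)}
    (ha : ∀ u, ρ u = 0 → a u = 0) : ∃ c : κ → κ → ℂ, a = ∑ i, ∑ j, c i j • coeff ρ i j := by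
  have h1 : a ∈ LinearMap.range ρ.toLinearMap.dualMap := by
    rw [LinearMap.range_dualMap_eq_dualAnnihilator_ker, Submodule.mem_dualAnnihilator]
    intro u hu
    exact ha u hu
  obtain ⟨φ, rfl⟩ := h1
  refine ⟨fun i j => φ (Matrix.single i j 1), ?_⟩
  ext u
  have h2 := congrArg φ (Matrix.matrix_eq_sum_single (ρ u))
  simp only [map_sum] at h2
  simp only [LinearMap.dualMap_apply, AlgHom.toLinearMap_apply, LinearMap.sum_apply,
    LinearMap.smul_apply, coeff_apply, smul_eq_mul]
  rw [h2]
  refine Finset.sum_congr rfl fun i _ => Finset.sum_congr rfl fun j _ => ?_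
  rw [mul_comm, ← smul_eq_mul, ← map_smul, Matrix.smul_single, smul_eq_mul, mul_one]

end Tensor

theorem IsUnitary.mul {st : g → g} (hg : ∀ x : g, parity x = x) {a b : Module.Dual ℂ (U g)}
    (ha : IsUnitary st a) (hb : IsUnitary st b) : IsUnitary st (a * b) := by
  obtain ⟨κ, _, _, ρ, hρ, ha⟩ := ha
  obtain ⟨κ', _, _, ρ', hρ', hb⟩ := hb
  refine ⟨κ × κ', inferInstance, inferInstance, tensorRep hg ρ ρ', fun x => ?_, fun u hu => ?_⟩
  · simp [tensorRep_ι, hρ x, hρ' x, Matrix.conjTranspose_kronecker]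
  · obtain ⟨c, rfl⟩ := exists_eq_sum_coeff ha
    obtain ⟨d, rfl⟩ := exists_eq_sum_coeff hb
    simp only [Finset.sum_mul, Finset.mul_sum, smul_mul_assoc, mul_smul_comm,
      coeff_mul_coeff hg, LinearMap.sum_apply, LinearMap.smul_apply, coeff_apply, hu]
    simp

/-- Both values are equal to `a (u * v)`. -/
theorem IsAverage.unique {a : Module.Dual ℂ (U g)} {u v : U g} (hu : IsAverage a u)
    (hv : IsAverage a v) : a u = a v := by
  have h1 := hu.2.2 v
  rw [hv.1, one_mul] at h1
  have h2 := hv.2.1 u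
  rw [hu.1, one_mul] at h2
  rw [← h1, h2]

/-- The integral of `a` is `a u` for any average `u` of `a`; independence of `u` and common averages
of two forms make this linear and invariant. For uniqueness, translating `a` by its average gives
the constant `a u`, so an invariant `I` satisfies `I a = a u * I 1`. -/
theorem SubHopfSuperalgebra.exists_haar (A : SubHopfSuperalgebra g)
    (hA : ∀ a ∈ A.toSubmodule, ∀ b ∈ A.toSubmodule, ∃ u, IsAverage a u ∧ IsAverage b u) :
    ∃ I₀ : Module.Dual ℂ A.toSubmodule, (∀ x a, I₀ (A.transL x a) = counit x * I₀ a) ∧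
      (∀ x a, I₀ (A.transR x a) = counit x * I₀ a) ∧ I₀ A.one = 1 ∧
      ∀ I : Module.Dual ℂ A.toSubmodule, (∀ x a, I (A.transL x a) = counit x * I a) →
        I = I A.one • I₀ := by
  choose w hw using fun a : A.toSubmodule => hA a.1 a.2 a.1 a.2
  have hw' : ∀ (a : A.toSubmodule) u, IsAverage a.1 u → a.1 (w a) = a.1 u :=
    fun a u hu => (hw a).1.unique hu
  let I₀ : Module.Dual ℂ A.toSubmodule :=
    { toFun := fun a => a.1 (w a)
      map_add' := fun a b => by
        obtain ⟨u, hu, hv⟩ := hA a.1 a.2 b.1 b.2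
        rw [hw' a u hu, hw' b u hv, hw' (a + b) u]
        · rfl
        · refine ⟨hu.1, fun x => ?_, fun x => ?_⟩
          · simp [hu.2.1 x, hv.2.1 x, mul_add]
          · simp [hu.2.2 x, hv.2.2 x, mul_add]
      map_smul' := fun c a => by
        have hu := (hw a).1
        rw [hw' (c • a) (w a)]
        · rfl
        · refine ⟨hu.1, fun x => ?_, fun x => ?_⟩
          · simp [hu.2.1 x, mul_left_comm]
          · simp [hu.2.2 x, mul_left_comm] }
  have hI : ∀ (a : A.toSubmodule) u, IsAverage a.1 u → I₀ a = a.1 u := hw'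
  refine ⟨I₀, fun x a => ?_, fun x a => ?_, ?_, fun I h => ?_⟩
  · obtain ⟨u, hu, hv⟩ := hA a.1 a.2 _ (A.transL x a).2
    rw [hI _ u hu, hI _ u hv, SubHopfSuperalgebra.transL_apply, hu.2.1]
  · obtain ⟨u, hu, hv⟩ := hA a.1 a.2 _ (A.transR x a).2
    rw [hI _ u hu, hI _ u hv, SubHopfSuperalgebra.transR_apply, hu.2.2]
  · exact (hw A.one).1.1
  · ext a
    obtain ⟨u, hu, -⟩ := hA a.1 a.2 a.1 a.2
    have h1 := h u a
    have h2 : A.transL u a = a.1 u • A.one := by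
      apply Subtype.ext
      ext x
      rw [SubHopfSuperalgebra.transL_apply, hu.2.2]
      simp [SubHopfSuperalgebra.one, dualOne_apply, mul_comm]
    rw [h2, map_smul, hu.1, one_mul] at h1
    rw [← h1, LinearMap.smul_apply, hI a u hu, smul_eq_mul, smul_eq_mul, mul_comm]

end Haar

/-! ### The Hopf superalgebra generated by a stable finite-dimensional space of forms. -/

section Generated

variable {g : Type} [AddCommGroup g] [Module ℂ g] [LieSuperalgebra g]

theorem generatedSubalgebra_eq (S : Set (Module.Dual ℂ (U g))) :
    generatedSubalgebra S = Subalgebra.toSubmodule (Algebra.adjoin ℂ S) := by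
  apply le_antisymm
  · exact sInf_le ⟨Algebra.subset_adjoin, one_mem (Algebra.adjoin ℂ S),
      fun f hf h hh => mul_mem (S := Subalgebra ℂ _) hf hh⟩
  · refine le_sInf fun M hM => ?_
    rintro f (hf' : f ∈ Algebra.adjoin ℂ S)
    induction hf' using Algebra.adjoin_induction with
    | mem f hf => exact hM.1 hf
    | algebraMap r =>
      rw [Algebra.algebraMap_eq_smul_one]
      exact M.smul_mem _ hM.2.1
    | add f h _ _ hf hh => exact add_mem hf hh
    | mul f h _ _ hf hh => exact hM.2.2 _ hf _ hh

/-- Stability of a space of linear forms under parity, translations and the antipode. -/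
structure IsStable (V : Submodule ℂ (Module.Dual ℂ (U g))) : Prop where
  dtw : ∀ f ∈ V, dtw 1 f ∈ V
  translL : ∀ x : g, ∀ f ∈ V, translL (ι g x) f ∈ V
  translR : ∀ x : g, ∀ f ∈ V, translR (ι g x) f ∈ V
  antipode : ∀ f ∈ V, dualAntipode f ∈ V

theorem U.translL_add (x y : U g) (f : Module.Dual ℂ (U g)) :
    translL (x + y) f = translL x f + translL y f := by
  ext u
  simp [add_mul]

theorem U.translR_add (x y : U g) (f : Module.Dual ℂ (U g)) :
    translR (x + y) f = translR x f + translR y f := by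
  ext u
  simp [mul_add]

theorem dtw_mem_of {V : Submodule ℂ (Module.Dual ℂ (U g))} (hV : ∀ f ∈ V, dtw 1 f ∈ V)
    (α : ZMod 2) : ∀ f ∈ V, dtw α f ∈ V := by
  rcases zmod_two_cases α with rfl | rfl
  · intro f hf
    rwa [dtw_zero]
  · exact hV

namespace IsStable

variable {V : Submodule ℂ (Module.Dual ℂ (U g))}

theorem algebraMap_mem_of (M : Subalgebra ℂ (Module.Dual ℂ (U g)))
    (F : Module.Dual ℂ (U g) →ₗ[ℂ] Module.Dual ℂ (U g)) (hF : F 1 ∈ M) (r : ℂ) :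
    F (algebraMap ℂ _ r) ∈ M := by
  rw [Algebra.algebraMap_eq_smul_one, map_smul]
  exact M.smul_mem hF r

theorem dtw_mem (hV : IsStable V) : ∀ f ∈ Algebra.adjoin ℂ (V : Set (Module.Dual ℂ (U g))),
    U.dtw 1 f ∈ Algebra.adjoin ℂ (V : Set (Module.Dual ℂ (U g))) := by
  intro f hf
  induction hf using Algebra.adjoin_induction with
  | mem f hf => exact Algebra.subset_adjoin (hV.dtw f hf)
  | algebraMap r =>
    exact algebraMap_mem_of _ _ (by rw [dtw_map_one]; exact one_mem _) r
  | add f h _ _ hf hh => rw [map_add]; exact add_mem hf hh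
  | mul f h _ _ hf hh => rw [dtw_mul]; exact mul_mem hf hh

theorem dtw_mem' (hV : IsStable V) (α : ZMod 2) :
    ∀ f ∈ Algebra.adjoin ℂ (V : Set (Module.Dual ℂ (U g))),
    U.dtw α f ∈ Algebra.adjoin ℂ (V : Set (Module.Dual ℂ (U g))) :=
  dtw_mem_of (V := Subalgebra.toSubmodule (Algebra.adjoin ℂ (V : Set (Module.Dual ℂ (U g)))))
    hV.dtw_mem α

theorem antipode_mem (hV : IsStable V) : ∀ f ∈ Algebra.adjoin ℂ (V : Set (Module.Dual ℂ (U g))),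
    dualAntipode f ∈ Algebra.adjoin ℂ (V : Set (Module.Dual ℂ (U g))) := by
  intro f hf
  induction hf using Algebra.adjoin_induction with
  | mem f hf => exact Algebra.subset_adjoin (hV.antipode f hf)
  | algebraMap r =>
    exact algebraMap_mem_of _ _ (by rw [dualAntipode_one]; exact one_mem _) r
  | add f h _ _ hf hh => rw [map_add]; exact add_mem hf hh
  | mul f h _ _ hf hh => rw [dualAntipode_mul]; exact mul_mem hf hh

theorem translL_mem (hV : IsStable V) (x : g) :
    ∀ f ∈ Algebra.adjoin ℂ (V : Set (Module.Dual ℂ (U g))),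
    U.translL (ι g x) f ∈ Algebra.adjoin ℂ (V : Set (Module.Dual ℂ (U g))) := by
  have key : ∀ α, ∀ x ∈ homog (parity (g := g)) α,
      ∀ f ∈ Algebra.adjoin ℂ (V : Set (Module.Dual ℂ (U g))),
      U.translL (ι g x) f ∈ Algebra.adjoin ℂ (V : Set (Module.Dual ℂ (U g))) := by
    intro α x hx f hf
    induction hf using Algebra.adjoin_induction with
    | mem f hf => exact Algebra.subset_adjoin (hV.translL x f hf)
    | algebraMap r =>
      exact algebraMap_mem_of _ _ (by rw [translL_one]; exact zero_mem _) r
    | add f h _ _ hf hh => rw [map_add]; exact add_mem hf hh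
    | mul f h hf1 hh1 hf hh =>
      rw [translL_mul hx]
      exact add_mem (mul_mem hf (hV.dtw_mem' α h hh1)) (mul_mem hf1 hh)
  intro f hf
  rw [← sum_proj parity x, map_add, translL_add]
  exact add_mem (key 0 _ (proj_mem parity_parity 0 x) f hf)
    (key 1 _ (proj_mem parity_parity 1 x) f hf)

/-- Finite-dimensional subspaces stable under right translations are closed under sums and products.
Stability under parity has to be carried along, because right translation twists the first factor of
a product. -/
theorem exists_finite (hV : IsStable V) [FiniteDimensional ℂ V] :
    ∀ a ∈ Algebra.adjoin ℂ (V : Set (Module.Dual ℂ (U g))),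
      ∃ N : Submodule ℂ (Module.Dual ℂ (U g)),
        N ≤ Subalgebra.toSubmodule (Algebra.adjoin ℂ (V : Set (Module.Dual ℂ (U g)))) ∧ a ∈ N ∧
        N.FG ∧ (∀ x : g, ∀ f ∈ N, U.translR (ι g x) f ∈ N) ∧ ∀ f ∈ N, U.dtw 1 f ∈ N := by
  intro a ha
  induction ha using Algebra.adjoin_induction with
  | mem a ha =>
    exact ⟨V, fun f hf => Algebra.subset_adjoin hf, ha,
      (Submodule.fg_iff_finiteDimensional V).mpr inferInstance, hV.translR, hV.dtw⟩
  | algebraMap r =>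
    refine ⟨Submodule.span ℂ {1}, ?_, ?_, Submodule.fg_span_singleton _, ?_, ?_⟩
    · rw [Submodule.span_singleton_le_iff_mem]
      exact one_mem (Algebra.adjoin ℂ (V : Set (Module.Dual ℂ (U g))))
    · rw [Algebra.algebraMap_eq_smul_one]
      exact Submodule.smul_mem _ _ (Submodule.mem_span_singleton_self _)
    · intro x f hf
      obtain ⟨c, rfl⟩ := Submodule.mem_span_singleton.mp hf
      rw [map_smul, translR_one, smul_zero]
      exact zero_mem _
    · intro f hf
      obtain ⟨c, rfl⟩ := Submodule.mem_span_singleton.mp hf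
      rw [map_smul, dtw_map_one]
      exact hf
  | add a b _ _ ha hb =>
    obtain ⟨N, h1, h2, h3, h4, h5⟩ := ha
    obtain ⟨N', h1', h2', h3', h4', h5'⟩ := hb
    refine ⟨N ⊔ N', sup_le h1 h1', add_mem (Submodule.mem_sup_left h2)
      (Submodule.mem_sup_right h2'), h3.sup h3', ?_, ?_⟩
    · intro x f hf
      obtain ⟨y, hy, z, hz, rfl⟩ := Submodule.mem_sup.mp hf
      rw [map_add]
      exact add_mem (Submodule.mem_sup_left (h4 x y hy)) (Submodule.mem_sup_right (h4' x z hz))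
    · intro f hf
      obtain ⟨y, hy, z, hz, rfl⟩ := Submodule.mem_sup.mp hf
      rw [map_add]
      exact add_mem (Submodule.mem_sup_left (h5 y hy)) (Submodule.mem_sup_right (h5' z hz))
  | mul a b _ _ ha hb =>
    obtain ⟨N, h1, h2, h3, h4, h5⟩ := ha
    obtain ⟨N', h1', h2', h3', h4', h5'⟩ := hb
    refine ⟨N * N',
      Submodule.mul_le.mpr fun m hm n hn => mul_mem (S := Subalgebra ℂ _) (h1 hm) (h1' hn),
      Submodule.mul_mem_mul h2 h2', h3.mul h3', ?_, ?_⟩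
    · have key : ∀ α, ∀ x ∈ homog (parity (g := g)) α, ∀ f ∈ N * N',
          U.translR (ι g x) f ∈ N * N' := by
        intro α x hx f hf
        induction hf using Submodule.mul_induction_on' with
        | mem_mul_mem m hm n hn =>
          rw [translR_mul hx]
          exact add_mem (Submodule.mul_mem_mul (h4 x m hm) hn)
            (Submodule.mul_mem_mul (dtw_mem_of h5 α m hm) (h4' x n hn))
        | add y _ z _ hy hz => rw [map_add]; exact add_mem hy hz
      intro x f hf
      rw [← sum_proj parity x, map_add, translR_add]
      exact add_mem (key 0 _ (proj_mem parity_parity 0 x) f hf)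
        (key 1 _ (proj_mem parity_parity 1 x) f hf)
    · intro f hf
      induction hf using Submodule.mul_induction_on' with
      | mem_mul_mem m hm n hn =>
        rw [dtw_mul]
        exact Submodule.mul_mem_mul (h5 m hm) (h5' n hn)
      | add y _ z _ hy hz => rw [map_add]; exact add_mem hy hz

/-- The sub-Hopf-superalgebra generated by a stable finite-dimensional space of linear forms. -/
def adjoinHopf (hV : IsStable V) [FiniteDimensional ℂ V] : SubHopfSuperalgebra g :=
  subHopfOfStable (Subalgebra.toSubmodule (Algebra.adjoin ℂ (V : Set (Module.Dual ℂ (U g)))))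
    (fun a ha => by rw [← dtw_one]; exact hV.dtw_mem a ha)
    (one_mem (Algebra.adjoin ℂ (V : Set (Module.Dual ℂ (U g)))))
    (fun a ha b hb => mul_mem (S := Subalgebra ℂ _) ha hb) hV.translL_mem
    (fun a ha => by
      obtain ⟨N, h1, h2, h3, h4, _⟩ := hV.exists_finite a ha
      exact ⟨N, h1, h2, (Submodule.fg_iff_finiteDimensional N).mp h3, h4⟩)
    hV.antipode_mem

/-- The image of a stable space under restriction to the even part. -/
theorem map_evenRestriction (hV : IsStable V) : IsStable (V.map (evenRestriction g)) where
  dtw := by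
    rintro _ ⟨f, hf, rfl⟩
    have h : U.dtw 1 (evenRestriction g f) = evenRestriction g f := by
      have h1 : parityHom (g := evenPart g) = AlgHom.id ℂ _ := by
        apply algHom_ext
        intro x
        simp [parityHom, parity_evenPart]
      ext u
      rw [dtw_apply, tw_one, h1, AlgHom.id_apply]
    rw [h]
    exact ⟨f, hf, rfl⟩
  translL := by
    rintro x _ ⟨f, hf, rfl⟩
    rw [translL_evenRestriction, evenInclusion_ι]
    exact ⟨_, hV.translL x f hf, rfl⟩
  translR := by
    rintro x _ ⟨f, hf, rfl⟩
    rw [translR_evenRestriction, evenInclusion_ι]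
    exact ⟨_, hV.translR x f hf, rfl⟩
  antipode := by
    rintro _ ⟨f, hf, rfl⟩
    refine ⟨_, hV.antipode f hf, ?_⟩
    ext u
    simp [dualAntipode_apply, evenRestriction_apply, evenInclusion_antipode]

theorem map_evenRestriction_adjoin (V : Submodule ℂ (Module.Dual ℂ (U g))) :
    Subalgebra.toSubmodule (Algebra.adjoin ℂ
      (V.map (evenRestriction g) : Set (Module.Dual ℂ (U (evenPart g))))) =
    (Subalgebra.toSubmodule (Algebra.adjoin ℂ (V : Set (Module.Dual ℂ (U g))))).map
      (evenRestriction g) := by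
  have h := AlgHom.map_adjoin (evenRestrictionHom g) (V : Set (Module.Dual ℂ (U g)))
  have h2 : ((V.map (evenRestriction g) : Submodule ℂ _) : Set (Module.Dual ℂ (U (evenPart g)))) =
      evenRestrictionHom g '' V := rfl
  rw [h2, ← h]
  rfl

end IsStable

/-- The homogeneous coordinates of a finite-dimensional Lie superalgebra. -/
theorem exists_homog_coord (g : Type) [AddCommGroup g] [Module ℂ g] [LieSuperalgebra g]
    [FiniteDimensional ℂ g] : ∃ (κ : Type) (_ : Fintype κ) (_ : DecidableEq κ) (b : κ → g)
      (d : κ → ZMod 2) (c : κ → Module.Dual ℂ g), Submodule.span ℂ (Set.range b) = ⊤ ∧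
      (∀ i, b i ∈ homog (parity (g := g)) (d i)) ∧
      ∀ i j, c i (b j) = if i = j then 1 else 0 := by
  let B := fun α : ZMod 2 => Module.finBasis ℂ (homog (parity (g := g)) α)
  let pr := fun α : ZMod 2 => (proj (parity (g := g)) α).codRestrict
    (homog (parity (g := g)) α) (proj_mem parity_parity α)
  refine ⟨Σ α : ZMod 2, Fin (Module.finrank ℂ (homog (parity (g := g)) α)), inferInstance,
    inferInstance, fun i => B i.1 i.2, fun i => i.1, fun i => (B i.1).coord i.2 ∘ₗ pr i.1,
    ?_, fun i => (B i.1 i.2).2, ?_⟩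
  · rw [eq_top_iff]
    intro x _
    have hα : ∀ α, proj parity α x ∈ Submodule.span ℂ (Set.range fun i : (Σ α : ZMod 2,
        Fin (Module.finrank ℂ (homog (parity (g := g)) α))) => (B i.1 i.2 : g)) := by
      intro α
      have h := congrArg Subtype.val ((B α).sum_repr (pr α x))
      have h2 : ((pr α x : homog (parity (g := g)) α) : g) = proj parity α x := rfl
      rw [← h2, ← h, Submodule.coe_sum]
      exact sum_mem fun i _ => Submodule.smul_mem _ _ (Submodule.subset_span ⟨⟨α, i⟩, rfl⟩)
    rw [← sum_proj parity x]
    exact add_mem (hα 0) (hα 1)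
  · rintro ⟨α, i⟩ ⟨β, j⟩
    have h1 : pr α (B β j) = if h : α = β then (h ▸ B β j) else 0 := by
      apply Subtype.ext
      change proj parity α (B β j : g) = _
      rw [proj_of_mem (B β j).2]
      split_ifs with h
      · subst h; rfl
      · rfl
    rw [LinearMap.comp_apply, h1]
    by_cases h : α = β
    · subst h
      simp [Finsupp.single_apply, eq_comm]
    · simp [h]

end Generated

/-! ### Block matrices in `osp(2|2n)` and the weights of its odd part. -/

section OspMatrices

open Matrix

variable {n : ℕ}

theorem matParity_entry (X : Mat n) (a b : Idx n) :
    matParity n X a b = sgn (deg a) * X a b * sgn (deg b) := by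
  rw [matParity_apply, parityMatrix, mul_diagonal, diagonal_mul]

theorem entry_eq_zero {α : ZMod 2} {X : Mat n} (hX : X ∈ homog (matParity n) α) {a b : Idx n}
    (h : deg a + deg b = α + 1) : X a b = 0 := by
  have h1 : matParity n X a b = (sgn α • X) a b := by rw [mem_homog.mp hX]
  rw [matParity_entry, Matrix.smul_apply, smul_eq_mul] at h1
  have h2 : sgn (deg a) * sgn (deg b) = -sgn α := by
    rw [← sgn_add, h, sgn_add, sgn_one]
    ring
  have h3 : sgn α * X a b = 0 := by
    have : (2 : ℂ) * (sgn α * X a b) = 0 := by linear_combination X a b * h2 - h1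
    simpa using this
  have h4 := sgn_mul_self α
  calc X a b = sgn α * (sgn α * X a b) := by rw [← mul_assoc, h4, one_mul]
    _ = 0 := by rw [h3, mul_zero]

theorem mem_homog_osp {α : ZMod 2} {x : osp n} :
    x ∈ homog (parity (g := osp n)) α ↔ (x : Mat n) ∈ homog (matParity n) α := by
  rw [mem_homog, mem_homog]
  exact Subtype.ext_iff

theorem coe_bracket {α β : ZMod 2} {x y : osp n} (hx : x ∈ homog (parity (g := osp n)) α)
    (hy : y ∈ homog (parity (g := osp n)) β) :
    (bracket x y : Mat n) = (x : Mat n) * y - sgn (α * β) • ((y : Mat n) * x) :=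
  superCommutator_apply (mem_homog_osp.mp hx) (mem_homog_osp.mp hy)

theorem bracket_mem_homog {g : Type} [AddCommGroup g] [Module ℂ g] [LieSuperalgebra g]
    {α β : ZMod 2} {x y : g} (hx : x ∈ homog (parity (g := g)) α)
    (hy : y ∈ homog (parity (g := g)) β) : bracket x y ∈ homog (parity (g := g)) (α + β) := by
  rw [mem_homog, parity_bracket, mem_homog.mp hx, mem_homog.mp hy]
  simp [sgn_add, smul_smul, mul_comm]

variable (n) in
/-- The index set of the odd part of the standard basis. -/
abbrev OddIdx : Type := Fin n ⊕ Fin n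

/-- The symmetric part of the form. -/
def symmForm : Matrix (Fin 2) (Fin 2) ℂ := !![0, 1; 1, 0]

theorem form_eq : form n = fromBlocks (symmForm) 0 0 (J (Fin n) ℂ) := rfl

/-- The odd operator in `osp(2|2n)` with a given upper right block. -/
def oddMat (Y : Matrix (Fin 2) (OddIdx n) ℂ) : Mat n :=
  fromBlocks 0 Y (-(J (Fin n) ℂ * Yᵀ * symmForm)) 0

theorem J_mul_J : J (Fin n) ℂ * J (Fin n) ℂ = -1 := J_squared _ _

theorem parityMatrix_eq : parityMatrix n = fromBlocks 1 0 0 (-1) := by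
  ext a b
  rcases a with a | a <;> rcases b with b | b <;>
    simp [parityMatrix, diagonal_apply, deg, sgn_zero, sgn_one, Matrix.one_apply, apply_ite]

theorem oddMat_mem_homog (Y : Matrix (Fin 2) (OddIdx n) ℂ) :
    oddMat Y ∈ homog (matParity n) 1 := by
  rw [mem_homog, matParity_apply, parityMatrix_eq, oddMat, sgn_one]
  simp [fromBlocks_multiply, fromBlocks_neg]

theorem diagonal_sgn_one : (diagonal fun a : Idx n => sgn (1 * deg a)) = parityMatrix n := by
  simp [parityMatrix]

theorem oddMat_mem_osp (Y : Matrix (Fin 2) (OddIdx n) ℂ) : oddMat Y ∈ osp n := by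
  rw [mem_osp_of_homog (oddMat_mem_homog Y), diagonal_sgn_one, parityMatrix_eq, form_eq, oddMat,
    fromBlocks_transpose]
  have hs : symmFormᵀ = symmForm := by ext i j; fin_cases i <;> fin_cases j <;> rfl
  have h1 : J (Fin n) ℂ * (J (Fin n) ℂ * Yᵀ * symmForm) = -(Yᵀ * symmForm) := by
    rw [← Matrix.mul_assoc, ← Matrix.mul_assoc, J_mul_J]
    simp
  have h2 : symmForm * (Y * J (Fin n) ℂ) * J (Fin n) ℂ = -(symmForm * Y) := by
    rw [Matrix.mul_assoc, Matrix.mul_assoc, J_mul_J]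
    simp
  simp [fromBlocks_multiply, fromBlocks_neg, h1, h2, hs]

theorem eq_oddMat {X : Mat n} (hX : X ∈ osp n) (h1 : X ∈ homog (matParity n) 1) :
    X = oddMat X.toBlocks₁₂ := by
  have h11 : X.toBlocks₁₁ = 0 := by
    ext i j
    exact entry_eq_zero h1 (by simp [deg]; rfl)
  have h22 : X.toBlocks₂₂ = 0 := by
    ext i j
    exact entry_eq_zero h1 (by simp [deg])
  have hX' := hX
  rw [mem_osp_of_homog h1, diagonal_sgn_one, parityMatrix_eq, form_eq,
    ← fromBlocks_toBlocks X, h11, h22, fromBlocks_transpose] at hX'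
  simp only [fromBlocks_multiply, fromBlocks_neg, fromBlocks_inj] at hX'
  have h3 := hX'.2.2.1
  simp only [Matrix.transpose_zero, Matrix.zero_mul, Matrix.mul_zero, add_zero, zero_add,
    Matrix.neg_mul, Matrix.one_mul, neg_neg] at h3
  rw [oddMat]
  nth_rewrite 1 [← fromBlocks_toBlocks X]
  rw [h11, h22, Matrix.mul_assoc, h3, ← Matrix.mul_assoc, J_mul_J]
  simp

/-- The upper block preserves a split symmetric form on the plane, which leaves only `diagonal ![c,
-c]`; the lower block is symplectic, hence traceless. This vanishing trace is what later makes top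
products invariant or semi-invariant under the even part. -/
theorem exists_even_blocks {X : Mat n} (hX : X ∈ osp n) (h0 : X ∈ homog (matParity n) 0) :
    ∃ (c : ℂ) (s : Matrix (OddIdx n) (OddIdx n) ℂ), s.trace = 0 ∧
      X = fromBlocks (diagonal ![c, -c]) 0 0 s := by
  have h12 : X.toBlocks₁₂ = 0 := by
    ext i j
    exact entry_eq_zero h0 (by simp [deg])
  have h21 : X.toBlocks₂₁ = 0 := by
    ext i j
    exact entry_eq_zero h0 (by simp [deg])
  have hX' := hX
  have hd : (diagonal fun a : Idx n => sgn (0 * deg a)) = 1 := by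
    simp [sgn_zero]
  rw [mem_osp_of_homog h0, hd, form_eq,
    ← fromBlocks_toBlocks X, h12, h21, fromBlocks_transpose] at hX'
  simp only [fromBlocks_multiply, fromBlocks_neg, fromBlocks_inj, Matrix.transpose_zero,
    Matrix.zero_mul, Matrix.mul_zero, add_zero, zero_add, Matrix.one_mul] at hX'
  obtain ⟨h3, -, -, h4⟩ := hX'
  refine ⟨X.toBlocks₁₁ 0 0, X.toBlocks₂₂, ?_, ?_⟩
  · have h5 := congrArg (fun Z => trace (J (Fin n) ℂ * Z)) h4
    rw [Matrix.mul_neg, ← Matrix.mul_assoc (J (Fin n) ℂ) (J (Fin n) ℂ), J_mul_J, trace_neg,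
      Matrix.neg_mul, Matrix.one_mul, trace_neg, neg_neg, trace_mul_comm, Matrix.mul_assoc, J_mul_J,
      Matrix.mul_neg, Matrix.mul_one, trace_neg, trace_transpose] at h5
    have : (2 : ℂ) * X.toBlocks₂₂.trace = 0 := by linear_combination -h5
    simpa using this
  · nth_rewrite 1 [← fromBlocks_toBlocks X]
    rw [h12, h21]
    congr 1
    have e := fun i j => congrFun (congrFun h3 i) j
    simp only [symmForm, Matrix.mul_apply, Fin.sum_univ_two, Matrix.neg_apply,
      Matrix.transpose_apply] at e
    have e00 := e 0 0
    have e01 := e 0 1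
    have e11 := e 1 1
    simp at e00 e01 e11
    ext i j
    fin_cases i <;> fin_cases j
    · simp
    · simp
      have : (2 : ℂ) * X.toBlocks₁₁ 0 1 = 0 := by linear_combination e11
      simpa using this
    · simp
      have : (2 : ℂ) * X.toBlocks₁₁ 1 0 = 0 := by linear_combination e00
      simpa using this
    · simp
      linear_combination e01

theorem center_eq : center n = fromBlocks (diagonal ![1, -1]) 0 0 0 := by
  rw [center, ← diagonal_zero, fromBlocks_diagonal]
  rfl

theorem even_comm_center {X : Mat n} (hX : X ∈ osp n) (h0 : X ∈ homog (matParity n) 0) :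
    center n * X = X * center n := by
  obtain ⟨c, s, -, rfl⟩ := exists_even_blocks hX h0
  rw [center_eq]
  simp [fromBlocks_multiply, mul_comm]

/-- An odd element of `osp(2|2n)` is determined by its upper right block. Assuming membership of the
commutator, it suffices to compute that block and there is no need to treat the lower left one. -/
theorem even_mul_oddMat (d : Fin 2 → ℂ) (s : Matrix (OddIdx n) (OddIdx n) ℂ)
    (Y : Matrix (Fin 2) (OddIdx n) ℂ) (h : fromBlocks (diagonal d) 0 0 s * oddMat Y -
      oddMat Y * fromBlocks (diagonal d) 0 0 s ∈ osp n) :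
    fromBlocks (diagonal d) 0 0 s * oddMat Y - oddMat Y * fromBlocks (diagonal d) 0 0 s =
      oddMat (diagonal d * Y - Y * s) := by
  have h1 : fromBlocks (diagonal d) 0 0 s * oddMat Y - oddMat Y * fromBlocks (diagonal d) 0 0 s =
      fromBlocks 0 (diagonal d * Y - Y * s) (-(s * (J (Fin n) ℂ * Yᵀ * symmForm)) +
        J (Fin n) ℂ * Yᵀ * symmForm * diagonal d) 0 := by
    simp [oddMat, fromBlocks_multiply, sub_eq_add_neg, fromBlocks_neg, fromBlocks_add]
  have h2 : fromBlocks (diagonal d) 0 0 s * oddMat Y - oddMat Y * fromBlocks (diagonal d) 0 0 s ∈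
      homog (matParity n) 1 := by
    rw [h1, mem_homog, matParity_apply, parityMatrix_eq, sgn_one]
    simp [fromBlocks_multiply, fromBlocks_neg]
  rw [eq_oddMat h h2]
  congr 1
  rw [h1, toBlocks_fromBlocks₁₂]

theorem oddMat_add (Y Y' : Matrix (Fin 2) (OddIdx n) ℂ) :
    oddMat (Y + Y') = oddMat Y + oddMat Y' := by
  simp [oddMat, fromBlocks_add, Matrix.mul_add, Matrix.add_mul, add_comm]

theorem oddMat_smul (c : ℂ) (Y : Matrix (Fin 2) (OddIdx n) ℂ) :
    oddMat (c • Y) = c • oddMat Y := by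
  simp [oddMat, fromBlocks_smul]

variable (n) in
/-- The linear map that sends the upper right block to the odd element of `osp(2|2n)`. -/
def oddElt : Matrix (Fin 2) (OddIdx n) ℂ →ₗ[ℂ] osp n where
  toFun Y := ⟨oddMat Y, oddMat_mem_osp Y⟩
  map_add' Y Y' := Subtype.ext (oddMat_add Y Y')
  map_smul' c Y := Subtype.ext (oddMat_smul c Y)

theorem coe_oddElt (Y : Matrix (Fin 2) (OddIdx n) ℂ) : (oddElt n Y : Mat n) = oddMat Y := rfl

theorem oddElt_mem (Y : Matrix (Fin 2) (OddIdx n) ℂ) :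
    oddElt n Y ∈ homog (parity (g := osp n)) 1 := mem_homog_osp.mpr (oddMat_mem_homog Y)

theorem eq_oddElt {x : osp n} (hx : x ∈ homog (parity (g := osp n)) 1) :
    x = oddElt n (x : Mat n).toBlocks₁₂ :=
  Subtype.ext (eq_oddMat x.2 (mem_homog_osp.mp hx))

variable (n) in
/-- The standard basis of the odd part of `osp(2|2n)`. -/
def oddBasis (p : Fin 2 × OddIdx n) : osp n := oddElt n (single p.1 p.2 1)

theorem oddBasis_mem (p : Fin 2 × OddIdx n) :
    oddBasis n p ∈ homog (parity (g := osp n)) 1 := oddElt_mem _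

theorem oddElt_eq_sum (Y : Matrix (Fin 2) (OddIdx n) ℂ) :
    oddElt n Y = ∑ i, ∑ ν, Y i ν • oddBasis n (i, ν) := by
  nth_rewrite 1 [matrix_eq_sum_single Y]
  simp only [map_sum, oddBasis, ← map_smul, smul_single, smul_eq_mul, mul_one]

theorem center_mul_oddMat (Y : Matrix (Fin 2) (OddIdx n) ℂ) :
    center n * oddMat Y - oddMat Y * center n =
      fromBlocks 0 (diagonal ![(1 : ℂ), -1] * Y)
        (J (Fin n) ℂ * Yᵀ * symmForm * diagonal ![(1 : ℂ), -1]) 0 := by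
  simp [center_eq, oddMat, fromBlocks_multiply, sub_eq_add_neg, fromBlocks_neg, fromBlocks_add]

theorem oddBasis_mem_oddPart (i : Fin 2) (ν : OddIdx n) :
    oddBasis n (i, ν) ∈ oddPart n (![1, -1] i) := by
  refine ⟨oddBasis_mem _, ?_⟩
  have e : (oddBasis n (i, ν) : Mat n) = oddMat (single i ν 1) := rfl
  rw [e, center_mul_oddMat, oddMat, fromBlocks_smul, smul_zero, smul_zero]
  congr 1
  · ext j κ
    rw [diagonal_mul, Matrix.smul_apply, smul_eq_mul, single_apply]
    split_ifs with h
    · rw [h.1]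
    · simp
  · rw [smul_neg, ← Matrix.mul_smul, Matrix.mul_assoc, Matrix.mul_assoc, Matrix.mul_assoc,
      ← Matrix.mul_neg, ← Matrix.mul_neg]
    congr 1
    ext κ j
    simp only [symmForm, Matrix.mul_apply, Fin.sum_univ_two, transpose_apply, single_apply,
      diagonal_apply, Matrix.neg_apply, Matrix.smul_apply]
    fin_cases i <;> fin_cases j <;> simp

/-- The center multiplies the two rows of the upper right block by `1` and `-1`, so each weight
space consists of the elements supported in a single row. -/
theorem oddPart_eq (i : Fin 2) :
    oddPart n (![1, -1] i) = Submodule.span ℂ (Set.range fun ν => oddBasis n (i, ν)) := by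
  apply le_antisymm
  · intro x hx
    have h1 := eq_oddElt hx.1
    have h2 := hx.2
    rw [h1, coe_oddElt, center_mul_oddMat, oddMat, fromBlocks_smul, fromBlocks_inj] at h2
    have h3 : ∀ j, j ≠ i → ∀ ν, (x : Mat n).toBlocks₁₂ j ν = 0 := by
      intro j hj ν
      have h4 := congrFun (congrFun h2.2.1 j) ν
      rw [diagonal_mul, Matrix.smul_apply, smul_eq_mul] at h4
      have h5 : (2 : ℂ) * (x : Mat n).toBlocks₁₂ j ν = 0 := by
        fin_cases i <;> fin_cases j
        · exact absurd rfl hj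
        · simp at h4 ⊢
          have : (2 : ℂ) * (x : Mat n).toBlocks₁₂ 1 ν = 0 := by linear_combination -h4
          simpa using this
        · simp at h4 ⊢
          have : (2 : ℂ) * (x : Mat n).toBlocks₁₂ 0 ν = 0 := by linear_combination h4
          simpa using this
        · exact absurd rfl hj
      simpa using h5
    rw [h1, oddElt_eq_sum, Finset.sum_eq_single i]
    · exact sum_mem fun ν _ => Submodule.smul_mem _ _ (Submodule.subset_span ⟨ν, rfl⟩)
    · intro j _ hj
      exact Finset.sum_eq_zero fun ν _ => by rw [h3 j hj, zero_smul]
    · simp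
  · rw [Submodule.span_le]
    rintro _ ⟨ν, rfl⟩
    exact oddBasis_mem_oddPart i ν

end OspMatrices

/-! ### The odd generators of the enveloping algebra. -/

section OspEnveloping

open Matrix

variable {n : ℕ}

variable (n) in
/-- The standard odd generators of `U(osp(2|2n))`. -/
def oddGen (p : Fin 2 × OddIdx n) : U (osp n) := ι (osp n) (oddBasis n p)

theorem oddGen_mul_add (p q : Fin 2 × OddIdx n) :
    oddGen n p * oddGen n q + oddGen n q * oddGen n p ∈ ι (osp n) '' evenPart (osp n) := by
  have h := ι_rel (oddBasis_mem (n := n) p) (oddBasis_mem q)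
  rw [mul_one (1 : ZMod 2), sgn_one, neg_smul, one_smul, sub_neg_eq_add] at h
  refine ⟨bracket (oddBasis n p) (oddBasis n q), ?_, h.symm⟩
  have h0 := bracket_mem_homog (oddBasis_mem (n := n) p) (oddBasis_mem q)
  rw [show (1 : ZMod 2) + 1 = 0 from rfl] at h0
  exact h0

/-- The bracket of two odd elements of equal weight `±1` has weight `±2` for the center. It is also
even, and even elements commute with the center; so it is zero. -/
theorem anticomm_oddGen (i : Fin 2) : Anticomm fun ν => oddGen n (i, ν) := by
  intro ν κ
  have hb : bracket (oddBasis n (i, ν)) (oddBasis n (i, κ)) = 0 := by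
    have hev := bracket_mem_homog (oddBasis_mem (n := n) (i, ν)) (oddBasis_mem (i, κ))
    rw [show (1 : ZMod 2) + 1 = 0 from rfl] at hev
    have h1 := even_comm_center (bracket (oddBasis n (i, ν)) (oddBasis n (i, κ))).2
      (mem_homog_osp.mp hev)
    have h2 := coe_bracket (oddBasis_mem (n := n) (i, ν)) (oddBasis_mem (i, κ))
    rw [mul_one (1 : ZMod 2), sgn_one, neg_smul, one_smul, sub_neg_eq_add] at h2
    have h3 := (oddBasis_mem_oddPart (n := n) i ν).2
    have h4 := (oddBasis_mem_oddPart (n := n) i κ).2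
    have e : ∀ C X Y : Mat n, ∀ c : ℂ, C * X - X * C = c • X → C * Y - Y * C = c • Y →
        C * (X * Y) - X * Y * C = (2 * c) • (X * Y) := by
      intro C X Y c hX hY
      have : C * (X * Y) - X * Y * C = (C * X - X * C) * Y + X * (C * Y - Y * C) := by noncomm_ring
      rw [this, hX, hY, smul_mul_assoc, mul_smul_comm]
      module
    have h5 : (2 * ![(1 : ℂ), -1] i) • (bracket (oddBasis n (i, ν)) (oddBasis n (i, κ)) : Mat n) =
        0 := by
      rw [h2, smul_add, ← e _ _ _ _ h3 h4, ← e _ _ _ _ h4 h3]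
      rw [h2, mul_add, add_mul] at h1
      rw [sub_add_sub_comm, h1, sub_self]
    have h6 : (2 * ![(1 : ℂ), -1] i) ≠ 0 := by fin_cases i <;> simp
    exact Subtype.ext ((smul_eq_zero.mp h5).resolve_left h6)
  have h := ι_rel (oddBasis_mem (n := n) (i, ν)) (oddBasis_mem (i, κ))
  rw [hb, map_zero, mul_one (1 : ZMod 2), sgn_one, neg_smul, one_smul, sub_neg_eq_add] at h
  exact eq_neg_of_add_eq_zero_left h

/-- The action of the even part on the standard odd generators. -/
theorem exists_ad_coeff {h : osp n} (hh : h ∈ evenPart (osp n)) : ∃ (c : ℂ)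
    (s : Matrix (OddIdx n) (OddIdx n) ℂ), s.trace = 0 ∧
      (h : Mat n) = fromBlocks (diagonal ![c, -c]) 0 0 s ∧ ∀ i ν,
      ι (osp n) h * oddGen n (i, ν) - oddGen n (i, ν) * ι (osp n) h =
        ∑ κ, ((if ν = κ then ![c, -c] i else 0) - s ν κ) • oddGen n (i, κ) := by
  obtain ⟨c, s, hs, hX⟩ := exists_even_blocks h.2 (mem_homog_osp.mp hh)
  refine ⟨c, s, hs, hX, fun i ν => ?_⟩
  have h1 := ι_rel hh (oddBasis_mem (i, ν))
  rw [zero_mul, sgn_zero, one_smul] at h1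
  have h2 : bracket h (oddBasis n (i, ν)) =
      ∑ κ, ((if ν = κ then ![c, -c] i else 0) - s ν κ) • oddBasis n (i, κ) := by
    have h3 := coe_bracket hh (oddBasis_mem (i, ν))
    rw [zero_mul, sgn_zero, one_smul, hX] at h3
    have h4 := (bracket h (oddBasis n (i, ν))).2
    rw [h3] at h4
    have h5 : bracket h (oddBasis n (i, ν)) =
        oddElt n (diagonal ![c, -c] * single i ν (1 : ℂ) - single i ν (1 : ℂ) * s) :=
      Subtype.ext (h3.trans (even_mul_oddMat _ s _ h4))
    rw [h5, oddElt_eq_sum, Finset.sum_eq_single i]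
    · refine Finset.sum_congr rfl fun κ _ => ?_
      congr 1
      rw [Matrix.sub_apply, diagonal_mul, single_mul_apply_same, one_mul, single_apply]
      simp
    · intro j _ hj
      refine Finset.sum_eq_zero fun κ _ => ?_
      rw [Matrix.sub_apply, diagonal_mul, single_mul_apply_of_ne _ _ _ _ _ hj, single_apply,
        if_neg (fun h => hj h.1.symm), mul_zero, sub_zero, zero_smul]
    · simp
  unfold oddGen
  rw [h1, h2, map_sum]
  simp only [map_smul]

end OspEnveloping

/-! ### Matrix elements: the two coordinate algebras, density, and the compact form. -/

section MatrixElements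

open Matrix

variable {n : ℕ}

variable (n) in
/-- The powers of the parity matrix. -/
def parityPow (α : ZMod 2) : Mat n := diagonal fun a => sgn (α * deg a)

theorem parityPow_add (α β : ZMod 2) : parityPow n (α + β) = parityPow n α * parityPow n β := by
  rw [parityPow, parityPow, parityPow, diagonal_mul_diagonal]
  simp [add_mul, sgn_add]

theorem parityPow_zero : parityPow n 0 = 1 := by simp [parityPow, sgn_zero]

theorem parityPow_one : parityPow n 1 = parityMatrix n := diagonal_sgn_one

theorem parityPow_mul_self (α : ZMod 2) : parityPow n α * parityPow n α = 1 := by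
  simp [parityPow, sgn_mul_self]

theorem form_mul_form : form n * form n = parityMatrix n := by
  have hs : symmForm * symmForm = 1 := by
    ext i j
    fin_cases i <;> fin_cases j <;> simp [symmForm, Matrix.mul_apply]
  rw [form_eq, parityMatrix_eq, fromBlocks_multiply]
  simp [J_mul_J, hs]

theorem form_mul_parityPow (α : ZMod 2) :
    form n * parityPow n α = parityPow n α * form n := by
  rcases zmod_two_cases α with rfl | rfl
  · simp [parityPow_zero]
  · rw [parityPow_one, ← form_mul_form, mul_assoc]

theorem vectorRep_ι (x : osp n) : vectorRep n (ι (osp n) x) = x := lift_ι _ _ x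

theorem vectorRep_tw (α : ZMod 2) (u : U (osp n)) :
    vectorRep n (tw α u) = parityPow n α * vectorRep n u * parityPow n α := by
  rcases zmod_two_cases α with rfl | rfl
  · simp [parityPow_zero]
  · rw [tw_one, parityPow_one, ← matParity_apply]
    let F : Mat n →ₐ[ℂ] Mat n := AlgHom.ofLinearMap (matParity n)
      (by rw [matParity_apply, mul_one, parityMatrix_mul_self]) matParity_mul
    have h : (vectorRep n).comp parityHom = F.comp (vectorRep n) := by
      apply algHom_ext
      intro x
      have h1 : parityHom (ι (osp n) x) = ι (osp n) (parity x) := lift_ι _ _ x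
      rw [AlgHom.comp_apply, AlgHom.comp_apply, h1, vectorRep_ι, vectorRep_ι]
      rfl
    exact DFunLike.congr_fun h u

theorem t_eq_coeff (a b : Idx n) : t a b = coeff (vectorRep n) a b := rfl

theorem t_apply (a b : Idx n) (u : U (osp n)) : t a b u = vectorRep n u a b := rfl

theorem dtw_t (a b : Idx n) : dtw 1 (t a b) = sgn (deg a + deg b) • t a b := by
  ext u
  rw [dtw_apply, t_apply, vectorRep_tw, parityPow_one, ← matParity_apply, matParity_entry,
    LinearMap.smul_apply, t_apply, sgn_add, smul_eq_mul]
  ring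

theorem t_mem_dualGr (a b : Idx n) : t a b ∈ dualGr (deg a + deg b) := by
  have h := dtw_t a b
  rw [dtw_one] at h
  exact mem_homog.mpr h

variable (n) in
/-- The supertranspose `X ↦ D ^ [X] Xᵀ`. -/
def superTranspose : Mat n →ₗ[ℂ] Mat n :=
  ∑ α, LinearMap.mulLeft ℂ (parityPow n α) ∘ₗ
    (transposeLinearEquiv (Idx n) (Idx n) ℂ ℂ).toLinearMap ∘ₗ proj (matParity n) α

theorem superTranspose_apply {α : ZMod 2} {X : Mat n} (hX : X ∈ homog (matParity n) α) :
    superTranspose n X = parityPow n α * Xᵀ := by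
  simp only [superTranspose, LinearMap.sum_apply, LinearMap.comp_apply, proj_of_mem hX]
  rw [Finset.sum_eq_single α]
  · simp
  · intro β _ hβ
    simp [hβ]
  · simp

variable (n) in
/-- The super adjoint with respect to the form. -/
def superAdjoint : Mat n →ₗ[ℂ] Mat n :=
  LinearMap.mulLeft ℂ (parityMatrix n * form n) ∘ₗ LinearMap.mulRight ℂ (form n) ∘ₗ
    superTranspose n

theorem superAdjoint_apply (X : Mat n) :
    superAdjoint n X = parityMatrix n * form n * (superTranspose n X * form n) := rfl

theorem superAdjoint_one : superAdjoint n 1 = 1 := by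
  have h1 : (1 : Mat n) ∈ homog (matParity n) 0 := by
    rw [mem_homog, matParity_apply, mul_one, parityMatrix_mul_self, sgn_zero, one_smul]
  rw [superAdjoint_apply, superTranspose_apply h1, transpose_one, mul_one, parityPow_zero, one_mul,
    mul_assoc, form_mul_form, parityMatrix_mul_self]

theorem superAdjoint_mul {α : ZMod 2} {x : osp n} (hx : x ∈ homog (parity (g := osp n)) α)
    (M : Mat n) : superAdjoint n (x * M) =
      -(parityPow n α * superAdjoint n M * parityPow n α * x) := by
  suffices h : superAdjoint n ∘ₗ LinearMap.mulLeft ℂ (x : Mat n) =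
      -(LinearMap.mulRight ℂ (x : Mat n) ∘ₗ LinearMap.mulRight ℂ (parityPow n α) ∘ₗ
        LinearMap.mulLeft ℂ (parityPow n α) ∘ₗ superAdjoint n) from LinearMap.congr_fun h M
  refine ext_homog matParity_matParity fun β M hM => ?_
  have hx' := mem_homog_osp.mp hx
  have h1 : (x : Mat n)ᵀ * form n = -(parityPow n α * (form n * x)) :=
    (mem_osp_of_homog hx').mp x.2
  change superAdjoint n (x * M) = -(parityPow n α * superAdjoint n M * parityPow n α * x)
  rw [superAdjoint_apply, superAdjoint_apply, superTranspose_apply hM,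
    superTranspose_apply (mul_mem_homog matParity_mul hx' hM), transpose_mul]
  simp only [mul_assoc]
  rw [h1, parityPow_add]
  have hc : ∀ Z : Mat n, parityPow n α * (parityMatrix n * Z) =
      parityMatrix n * (parityPow n α * Z) := fun Z => by
    rw [← mul_assoc, ← mul_assoc, ← parityPow_one, ← parityPow_add, add_comm, parityPow_add]
  have hf : ∀ Z : Mat n, parityPow n α * (form n * Z) = form n * (parityPow n α * Z) := fun Z => by
    rw [← mul_assoc, ← mul_assoc, form_mul_parityPow]
  simp only [mul_neg, mul_assoc]
  rw [hc, hf, hf]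

/-- Both sides satisfy the same recursion under left multiplication by elements of `osp(2|2n)`, on
which the super adjoint is `-1`. Consequently the antipode sends matrix elements to linear
combinations of matrix elements. -/
theorem vectorRep_antipode (u : U (osp n)) :
    vectorRep n (antipode u) = superAdjoint n (vectorRep n u) := by
  suffices h : LinearMap.eqLocus ((vectorRep n).toLinearMap ∘ₗ antipode)
      (superAdjoint n ∘ₗ (vectorRep n).toLinearMap) = ⊤ by
    have : u ∈ LinearMap.eqLocus ((vectorRep n).toLinearMap ∘ₗ antipode)
      (superAdjoint n ∘ₗ (vectorRep n).toLinearMap) := h ▸ trivial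
    exact this
  apply eq_top_of_mul_left
  · change vectorRep n (antipode 1) = superAdjoint n (vectorRep n 1)
    rw [antipode_one, map_one, superAdjoint_one]
  · intro α x hx w hw
    have hw' : vectorRep n (antipode w) = superAdjoint n (vectorRep n w) := hw
    change vectorRep n (antipode (ι (osp n) x * w)) =
      superAdjoint n (vectorRep n (ι (osp n) x * w))
    rw [antipode_ι_mul hx, map_neg, map_mul, vectorRep_tw, hw', map_mul, vectorRep_ι,
      superAdjoint_mul hx]

variable (n) in
/-- The space of the matrix elements of the vector representation. -/
def matrixElements : Submodule ℂ (Module.Dual ℂ (U (osp n))) :=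
  Submodule.span ℂ (Set.range fun p : Idx n × Idx n => t p.1 p.2)

instance : FiniteDimensional ℂ (matrixElements n) :=
  FiniteDimensional.span_of_finite ℂ (Set.finite_range _)

theorem t_mem (a b : Idx n) : t a b ∈ matrixElements n := Submodule.subset_span ⟨(a, b), rfl⟩

theorem comp_vectorRep_mem (φ : Module.Dual ℂ (Mat n)) :
    φ ∘ₗ (vectorRep n).toLinearMap ∈ matrixElements n := by
  have h : φ ∘ₗ (vectorRep n).toLinearMap = ∑ a, ∑ b, φ (single a b 1) • t a b := by
    ext u
    have h1 : vectorRep n u = ∑ a, ∑ b, vectorRep n u a b • single a b (1 : ℂ) := by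
      nth_rewrite 1 [matrix_eq_sum_single (vectorRep n u)]
      simp [smul_single]
    rw [LinearMap.comp_apply, AlgHom.toLinearMap_apply, h1]
    simp only [map_sum, map_smul, LinearMap.sum_apply, LinearMap.smul_apply, smul_eq_mul, t_apply]
    exact Finset.sum_congr rfl fun a _ => Finset.sum_congr rfl fun b _ => mul_comm _ _
  rw [h]
  exact sum_mem fun a _ => sum_mem fun b _ => Submodule.smul_mem _ _ (t_mem a b)

theorem map_mem_matrixElements {F : Module.Dual ℂ (U (osp n)) →ₗ[ℂ] Module.Dual ℂ (U (osp n))}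
    (hF : ∀ a b, F (t a b) ∈ matrixElements n) :
    ∀ f ∈ matrixElements n, F f ∈ matrixElements n := by
  intro f hf
  have h : matrixElements n ≤ (matrixElements n).comap F := by
    refine Submodule.span_le.mpr ?_
    rintro _ ⟨p, rfl⟩
    exact hF _ _
  exact h hf

variable (n) in
theorem isStable_matrixElements : IsStable (matrixElements n) where
  dtw := map_mem_matrixElements fun a b => by
    rw [dtw_t]
    exact Submodule.smul_mem _ _ (t_mem a b)
  translL x := map_mem_matrixElements fun a b => by
    rw [t_eq_coeff, translL_coeff]
    exact sum_mem fun c _ => Submodule.smul_mem _ _ (t_mem c b)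
  translR x := map_mem_matrixElements fun a b => by
    rw [t_eq_coeff, translR_coeff]
    exact sum_mem fun c _ => Submodule.smul_mem _ _ (t_mem a c)
  antipode := map_mem_matrixElements fun a b => by
    have h : dualAntipode (t a b) = (Matrix.entryLinearMap ℂ ℂ a b ∘ₗ superAdjoint n) ∘ₗ
        (vectorRep n).toLinearMap := by
      ext u
      rw [dualAntipode_apply, t_apply, vectorRep_antipode]
      rfl
    rw [h]
    exact comp_vectorRep_mem _

variable (n) in
/-- The Hopf superalgebra generated by the matrix elements of the vector representation. -/
def coordHopf : SubHopfSuperalgebra (osp n) := (isStable_matrixElements n).adjoinHopf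

theorem coordHopf_toSubmodule : (coordHopf n).toSubmodule = Subalgebra.toSubmodule
    (Algebra.adjoin ℂ (matrixElements n : Set (Module.Dual ℂ (U (osp n))))) := rfl

theorem coordHopf_eq_generated : (coordHopf n).toSubmodule =
    generatedSubalgebra (Set.range fun p : Idx n × Idx n => t p.1 p.2) := by
  rw [generatedSubalgebra_eq, coordHopf_toSubmodule, matrixElements, Algebra.adjoin_span]

theorem matrixElements_le : matrixElements n ≤ (coordHopf n).toSubmodule :=
  Algebra.subset_adjoin

theorem mul_mem_coordHopf {a b : Module.Dual ℂ (U (osp n))} (ha : a ∈ (coordHopf n).toSubmodule)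
    (hb : b ∈ (coordHopf n).toSubmodule) : a * b ∈ (coordHopf n).toSubmodule :=
  (coordHopf n).mul_mem a ha b hb

theorem one_mem_coordHopf : 1 ∈ (coordHopf n).toSubmodule := (coordHopf n).one_mem

variable (n) in
theorem isDense_coordHopf : (coordHopf n).IsDense := by
  obtain ⟨κ, _, _, b, d, c, hb, hd, hc⟩ := exists_homog_coord (osp n)
  -- Coordinates on `osp n` are extended to all matrices and pulled back along the vector
  -- representation. Subtracting a multiple of the counit makes them vanish at `1` without changing
  -- their values on `g`.
  choose φ hφ using fun i => LinearMap.exists_extend (c i)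
  let f : κ → Module.Dual ℂ (U (osp n)) := fun i =>
    φ i ∘ₗ (vectorRep n).toLinearMap - φ i 1 • 1
  have hf : ∀ i, f i ∈ (coordHopf n).toSubmodule := fun i =>
    sub_mem (matrixElements_le (comp_vectorRep_mem _)) (Submodule.smul_mem _ _ one_mem_coordHopf)
  -- The annihilator of the coordinate algebra; density says that it is zero.
  let J : Submodule ℂ (U (osp n)) := ⨅ a ∈ (coordHopf n).toSubmodule, LinearMap.ker a
  have hJ : ∀ u, u ∈ J ↔ ∀ a ∈ (coordHopf n).toSubmodule, a u = 0 := fun u => by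
    simp [J, Submodule.mem_iInf]
  have key := eq_zero_of_contractL_mem (f := f) (J := J) hb hd
    (fun i => by simp [f, U.one_apply])
    (fun i j => by
      have h1 := LinearMap.congr_fun (hφ i) (b j)
      rw [hc] at h1
      simp only [f, LinearMap.sub_apply, LinearMap.comp_apply, AlgHom.toLinearMap_apply,
        vectorRep_ι, LinearMap.smul_apply, U.one_apply, counit_ι, smul_zero, sub_zero]
      exact h1)
    (fun u hu => (hJ u).mp hu 1 one_mem_coordHopf)
    (fun i u hu => (hJ _).mpr fun a ha => by
      rw [apply_contractL, dualMul_eq]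
      exact (hJ u).mp hu _ (mul_mem_coordHopf (hf i) ha))
  intro x hx
  by_contra! h
  exact hx (key x ((hJ x).mpr h))

variable (n) in
/-- The image of the coordinate algebra under restriction to the even part. -/
def evenCoordHopf : SubHopfSuperalgebra (evenPart (osp n)) :=
  (isStable_matrixElements n).map_evenRestriction.adjoinHopf

theorem evenCoordHopf_toSubmodule : (evenCoordHopf n).toSubmodule =
    (coordHopf n).toSubmodule.map (evenRestriction (osp n)) :=
  IsStable.map_evenRestriction_adjoin (matrixElements n)

/-- The Gram matrix is real with adjoint `form n * parityMatrix n`, and even matrices commute with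
the parity matrix; so the adjoint of the invariance condition for `x` is the condition for `xᴴ`.
This is the compact real form on which the averaging rests. -/
theorem conjTranspose_mem {x : Mat n} (hx : x ∈ osp n) (h0 : x ∈ homog (matParity n) 0) :
    xᴴ ∈ osp n ∧ xᴴ ∈ homog (matParity n) 0 := by
  have hD : (parityMatrix n)ᴴ = parityMatrix n := by
    rw [parityMatrix_eq]
    simp [fromBlocks_conjTranspose]
  have hB : (form n)ᴴ = form n * parityMatrix n := by
    have hs : symmFormᴴ = symmForm := by ext i j; fin_cases i <;> fin_cases j <;> simp [symmForm]
    have hJ : (J (Fin n) ℂ)ᴴ = -J (Fin n) ℂ := by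
      simp [J, fromBlocks_conjTranspose, fromBlocks_neg]
    rw [form_eq, parityMatrix_eq, fromBlocks_conjTranspose, fromBlocks_multiply, hs, hJ]
    simp
  have h1 := mem_homog.mp h0
  rw [matParity_apply, sgn_zero, one_smul] at h1
  have h2 : xᴴ ∈ homog (matParity n) 0 := by
    rw [mem_homog, matParity_apply, sgn_zero, one_smul]
    nth_rewrite 2 [← h1]
    rw [conjTranspose_mul, conjTranspose_mul, hD, mul_assoc]
  refine ⟨?_, h2⟩
  have h3 := (mem_osp_of_homog h0).mp hx
  rw [mem_osp_of_homog h2]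
  have hd : (diagonal fun a : Idx n => sgn (0 * deg a)) = 1 := by simp [sgn_zero]
  rw [hd, one_mul] at h3 ⊢
  have h4 := congrArg conjTranspose h3
  rw [conjTranspose_neg, conjTranspose_mul, conjTranspose_mul, hB] at h4
  have h5 : xᵀᴴ = xᴴᵀ := rfl
  have h6 : xᴴᵀ * parityMatrix n = parityMatrix n * xᴴᵀ := by
    have h7 := mem_homog.mp h2
    rw [matParity_apply, sgn_zero, one_smul] at h7
    have h8 : parityMatrix n * xᴴ = xᴴ * parityMatrix n := by
      nth_rewrite 2 [← h7]
      rw [mul_assoc, parityMatrix_mul_self, mul_one]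
    have h9 := congrArg transpose h8
    rw [transpose_mul, transpose_mul, parityMatrix, diagonal_transpose] at h9
    exact h9
  have hDD := parityMatrix_mul_self n
  have h7 : form n * xᴴᵀ = -(xᴴ * form n) := by
    rw [h5, mul_assoc, ← h6] at h4
    have h8 := congrArg (fun Z => Z * parityMatrix n) h4
    simpa only [neg_mul, mul_assoc, hDD, mul_one] using h8
  have h8 : parityMatrix n * xᴴ = xᴴ * parityMatrix n := by
    have h9 := mem_homog.mp h2
    rw [matParity_apply, sgn_zero, one_smul] at h9
    nth_rewrite 2 [← h9]
    rw [mul_assoc, hDD, mul_one]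
  calc xᴴᵀ * form n = parityMatrix n * (form n * (form n * xᴴᵀ)) * form n := by
        rw [← mul_assoc (form n), form_mul_form, ← mul_assoc, hDD, one_mul]
    _ = -(parityMatrix n * form n * xᴴ * (form n * form n)) := by
        rw [h7]
        simp only [mul_neg, neg_mul, mul_assoc]
    _ = -(form n * xᴴ) := by
        rw [form_mul_form, mul_assoc, ← h8, ← mul_assoc, ← parityPow_one, ← form_mul_parityPow,
          mul_assoc (form n), parityPow_mul_self, mul_one]

variable (n) in
/-- The compact real structure of the even part. -/
def evenStar (x : evenPart (osp n)) : evenPart (osp n) :=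
  have h := conjTranspose_mem x.1.2 (mem_homog_osp.mp x.2)
  ⟨⟨(x : Mat n)ᴴ, h.1⟩, mem_homog_osp.mpr h.2⟩

variable (n) in
theorem isStarRep_vectorRep :
    IsStarRep (evenStar n) ((vectorRep n).comp (evenInclusion (osp n))) := by
  intro x
  rw [AlgHom.comp_apply, AlgHom.comp_apply, evenInclusion_ι, evenInclusion_ι, vectorRep_ι,
    vectorRep_ι]
  rfl

/-- The vector representation restricted to the even part intertwines `evenStar` with the adjoint,
and forms factoring through star representations make up an algebra. -/
theorem isUnitary_of_mem {a : Module.Dual ℂ (U (evenPart (osp n)))}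
    (ha : a ∈ (evenCoordHopf n).toSubmodule) : IsUnitary (evenStar n) a := by
  replace ha : a ∈ Algebra.adjoin ℂ ((matrixElements n).map (evenRestriction (osp n)) :
      Set (Module.Dual ℂ (U (evenPart (osp n))))) := ha
  induction ha using Algebra.adjoin_induction with
  | mem a ha =>
    obtain ⟨f, hf, rfl⟩ := ha
    refine ⟨_, inferInstance, inferInstance, _, isStarRep_vectorRep n, fun u hu => ?_⟩
    have h : matrixElements n ≤ LinearMap.ker
        (Module.Dual.eval ℂ (U (osp n)) (evenInclusion (osp n) u)) := by
      refine Submodule.span_le.mpr ?_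
      rintro _ ⟨p, rfl⟩
      exact congrFun (congrFun hu p.1) p.2
    exact h hf
  | algebraMap c => exact isUnitary_algebraMap _ c
  | add a b _ _ ha hb => exact ha.add hb
  | mul a b _ _ ha hb => exact ha.mul parity_evenPart hb

variable (n) in
theorem exists_haar_evenCoordHopf : ∃ I₀ : Module.Dual ℂ (evenCoordHopf n).toSubmodule,
    (∀ x a, I₀ ((evenCoordHopf n).transL x a) = counit x * I₀ a) ∧
      (∀ x a, I₀ ((evenCoordHopf n).transR x a) = counit x * I₀ a) ∧
      I₀ (evenCoordHopf n).one = 1 ∧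
      ∀ I : Module.Dual ℂ (evenCoordHopf n).toSubmodule,
        (∀ x a, I ((evenCoordHopf n).transL x a) = counit x * I a) →
        I = I (evenCoordHopf n).one • I₀ :=
  (evenCoordHopf n).exists_haar fun _ ha _ hb =>
    (isUnitary_of_mem ha).exists_average (isUnitary_of_mem hb)

theorem evenCoordHopf_parity : (evenCoordHopf n).parity = LinearMap.id := by
  have h1 : parityHom (g := evenPart (osp n)) = AlgHom.id ℂ _ := by
    apply algHom_ext
    intro x
    exact lift_ι _ _ x
  ext a u
  change a.1 (parityHom u) = a.1 u
  rw [h1]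
  rfl

end MatrixElements

/-! ### Pairing products of forms with products of elements of the Lie superalgebra. -/

section Evaluation

variable {g : Type} [AddCommGroup g] [Module ℂ g] [LieSuperalgebra g]

namespace U

theorem dtw_mem_vanishing {s : Set g} {B : Submodule ℂ (U g)}
    (hs : ∀ x ∈ s, ∃ α, x ∈ homog (parity (g := g)) α) (hB : ∀ α, ∀ u ∈ B, tw α u ∈ B) {d : ℕ}
    (α : ZMod 2) {f : Module.Dual ℂ (U g)} (hf : f ∈ vanishing s B d) :
    dtw α f ∈ vanishing s B d :=
  fun k hk u hu => hf k hk _ (tw_mem_filt hs hB k α u hu)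

variable (g) in
/-- The set of the homogeneous elements. -/
def homogSet : Set g := {x | ∃ α, x ∈ homog (parity (g := g)) α}

theorem mem_vanishing_of_apply_one {s : Set g} {f : Module.Dual ℂ (U g)} (hf : f 1 = 0) :
    f ∈ vanishing s 1 1 := by
  rw [mem_vanishing_one]
  intro u hu
  obtain ⟨c, rfl⟩ := Submodule.mem_one.mp hu
  rw [Algebra.algebraMap_eq_smul_one, map_smul, hf, smul_zero]

theorem mul_mem_vanishing_homogSet {c d : ℕ} {f h : Module.Dual ℂ (U g)}
    (hf : f ∈ vanishing (homogSet g) 1 c) (hh : h ∈ vanishing (homogSet g) 1 d) :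
    f * h ∈ vanishing (homogSet g) 1 (c + d) :=
  mul_mem_vanishing (fun _ hx => hx) tw_mem_one mul_apply_one_span hf hh

variable {κ : Type} {φ : κ → Module.Dual ℂ (U g)}

theorem listProd_mem_vanishing (h1 : ∀ p, φ p 1 = 0) (l : List κ) :
    listProd φ l ∈ vanishing (homogSet g) 1 l.length := by
  have h := list_prod_mem_vanishing (s := homogSet g) (fun _ hx => hx) tw_mem_one
    mul_apply_one_span (l.map φ) (by
      intro f hf
      obtain ⟨p, -, rfl⟩ := List.mem_map.mp hf
      exact mem_vanishing_of_apply_one (h1 p))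
  rwa [List.length_map] at h

/-- In general a translation lowers the order of vanishing by one. It does not if `y` is killed by
every factor, since each translated factor then still vanishes at `1`. -/
theorem translL_listProd_mem_vanishing (h1 : ∀ p, φ p 1 = 0) {α : ZMod 2} {y : g}
    (hy : y ∈ homog (parity (g := g)) α) (l : List κ) (hl : ∀ p ∈ l, φ p (ι g y) = 0) :
    translL (ι g y) (listProd φ l) ∈ vanishing (homogSet g) 1 l.length := by
  induction l with
  | nil =>
    rw [listProd_nil, translL_one]
    exact zero_mem _
  | cons p l ih =>
    rw [listProd_cons, translL_mul hy, List.length_cons, add_comm]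
    refine add_mem (mul_mem_vanishing_homogSet (mem_vanishing_of_apply_one ?_)
      (dtw_mem_vanishing (fun _ hx => hx) tw_mem_one α (listProd_mem_vanishing h1 l)))
      (mul_mem_vanishing_homogSet (mem_vanishing_of_apply_one (h1 p))
        (ih fun q hq => hl q (List.mem_cons_of_mem p hq)))
    rw [translL_apply, mul_one, hl p List.mem_cons_self]

theorem listProd_ι_mem_filt {s : Set g} {B : Submodule ℂ (U g)} {x : κ → g} (hx : ∀ p, x p ∈ s)
    {k : ℕ} {v : U g} (hv : v ∈ filt s B k) (l : List κ) :
    listProd (fun p => ι g (x p)) l * v ∈ filt s B (k + l.length) := by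
  induction l with
  | nil => simpa using hv
  | cons p l ih =>
    rw [listProd_cons, mul_assoc, List.length_cons, ← add_assoc]
    exact ι_mul_mem_filt (hx p) ih

/-- The pairing of the product of linear forms dual to a family of elements of `g` with the product
of these elements. -/
theorem listProd_apply_listProd [DecidableEq κ] (h1 : ∀ p, φ p 1 = 0) {x : κ → g} {α : ZMod 2}
    (hx : ∀ p, x p ∈ homog (parity (g := g)) α) {c : κ → ℂ}
    (hφ : ∀ p q, φ p (ι g (x q)) = if p = q then c p else 0) (l : List κ) (hl : l.Nodup) :
    listProd φ l.reverse (listProd (fun p => ι g (x p)) l) = (l.map c).prod := by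
  induction l with
  | nil => simp [one_apply]
  | cons p l ih =>
    rw [List.nodup_cons] at hl
    have hlen : (listProd (fun p => ι g (x p)) l) ∈ filt (homogSet g) 1 l.length := by
      have := listProd_ι_mem_filt (s := homogSet g) (B := 1) (k := 0) (x := x)
        (fun p => ⟨α, hx p⟩) (v := 1) (Submodule.one_le.mp le_rfl) l
      rwa [mul_one, zero_add] at this
    -- The part of the translate that falls on the earlier factors: these kill `x p`, since `p` is
    -- not in `l`, so the product vanishes to an order exceeding the length of `l`.
    have h2 : translL (ι g (x p)) (listProd φ l.reverse) * dtw α (φ p) ∈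
        vanishing (homogSet g) 1 (l.reverse.length + 1) := by
      refine mul_mem_vanishing_homogSet (translL_listProd_mem_vanishing h1 (hx p) _ ?_) ?_
      · intro q hq
        rw [hφ, if_neg]
        rintro rfl
        exact hl.1 (List.mem_reverse.mp hq)
      · exact dtw_mem_vanishing (fun _ hx => hx) tw_mem_one α (mem_vanishing_of_apply_one (h1 p))
    -- The part that falls on the last factor `φ p`: it may be replaced by the constant `c p`, the
    -- difference vanishing to too high an order. The reversed order puts `φ p` last, where
    -- translation produces no twist, so no sign appears.
    have h3 : listProd φ l.reverse * (translL (ι g (x p)) (φ p) - c p • 1) ∈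
        vanishing (homogSet g) 1 (l.reverse.length + 1) := by
      refine mul_mem_vanishing_homogSet (listProd_mem_vanishing h1 _)
        (mem_vanishing_of_apply_one ?_)
      simp [hφ, one_apply]
    rw [List.length_reverse] at h2 h3
    have h4 := h2 _ (Nat.lt_succ_self _) _ hlen
    have h5 := h3 _ (Nat.lt_succ_self _) _ hlen
    rw [mul_sub, mul_smul_comm, mul_one, LinearMap.sub_apply, sub_eq_zero] at h5
    rw [List.reverse_cons, listProd_append, listProd_cons, listProd_nil, mul_one, listProd_cons,
      ← translL_apply, translL_mul (hx p), LinearMap.add_apply, h4, h5, zero_add,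
      LinearMap.smul_apply, ih hl.2, List.map_cons, List.prod_cons, smul_eq_mul]

end U

theorem dualDegreePart_range {κ : Type} [Fintype κ] [DecidableEq κ]
    {φ : κ → Module.Dual ℂ (U g)} (hφ : Anticomm φ) {L : List κ} (hL : Complete L) :
    dualDegreePart (Set.range φ) (Fintype.card κ) = Submodule.span ℂ {listProd φ L} := by
  apply le_antisymm
  · refine Submodule.span_le.mpr ?_
    rintro _ ⟨l, hl, hlS, rfl⟩
    have : l ∈ Set.range (List.map φ) := by
      rw [Set.range_list_map]
      exact hlS
    obtain ⟨l', rfl⟩ := this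
    rw [dualProd_eq]
    exact hφ.listProd_mem_span hL (by simpa using hl)
  · rw [Submodule.span_singleton_le_iff_mem]
    refine Submodule.subset_span ⟨L.map φ, by rw [List.length_map, hL.length], ?_, ?_⟩
    · intro f hf
      obtain ⟨p, -, rfl⟩ := List.mem_map.mp hf
      exact ⟨p, rfl⟩
    · rw [dualProd_eq]
      rfl

end Evaluation

/-! ### Spanning by ordered products of odd generators. -/

section Spanning

variable {R : Type} [Ring R] [Algebra ℂ R] {κ : Type}

theorem listProd_map {κ' : Type} (e : κ' → R) (f : κ → κ') (l : List κ) :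
    listProd e (l.map f) = listProd (fun i => e (f i)) l := by
  rw [listProd, List.map_map]
  rfl

/-- The span of the elements of a subspace multiplied by products of members of a family. -/
def leftSpan (e : κ → R) (V : Submodule ℂ R) : Submodule ℂ R :=
  Submodule.span ℂ {u | ∃ l, ∃ v ∈ V, u = listProd e l * v}

variable {e : κ → R} {V : Submodule ℂ R}

theorem le_leftSpan : V ≤ leftSpan e V :=
  fun v hv => Submodule.subset_span ⟨[], v, hv, by simp⟩

theorem mul_mem_leftSpan {x : R} (h : ∀ l, ∀ v ∈ V, x * (listProd e l * v) ∈ leftSpan e V) :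
    ∀ u ∈ leftSpan e V, x * u ∈ leftSpan e V := by
  intro u hu
  have : leftSpan e V ≤ (leftSpan e V).comap (LinearMap.mulLeft ℂ x) := by
    refine Submodule.span_le.mpr ?_
    rintro _ ⟨l, v, hv, rfl⟩
    exact h l v hv
  exact this hu

theorem family_mul_mem_leftSpan (i : κ) : ∀ u ∈ leftSpan e V, e i * u ∈ leftSpan e V :=
  mul_mem_leftSpan fun l v hv => Submodule.subset_span ⟨i :: l, v, hv, by simp [mul_assoc]⟩

theorem span_mul_mem_leftSpan {x : R} (hx : x ∈ Submodule.span ℂ (Set.range e)) :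
    ∀ u ∈ leftSpan e V, x * u ∈ leftSpan e V := by
  intro u hu
  have : Submodule.span ℂ (Set.range e) ≤ (leftSpan e V).comap (LinearMap.mulRight ℂ u) := by
    refine Submodule.span_le.mpr ?_
    rintro _ ⟨i, rfl⟩
    exact family_mul_mem_leftSpan i u hu
  exact this hx

theorem even_mul_mem_leftSpan {h : R}
    (hh : ∀ i, h * e i - e i * h ∈ Submodule.span ℂ (Set.range e)) (hV : ∀ v ∈ V, h * v ∈ V) :
    ∀ u ∈ leftSpan e V, h * u ∈ leftSpan e V := by
  refine mul_mem_leftSpan fun l v hv => ?_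
  induction l with
  | nil =>
    rw [listProd_nil, one_mul]
    exact le_leftSpan (hV v hv)
  | cons i l ih =>
    have e1 : h * (listProd e (i :: l) * v) = e i * (h * (listProd e l * v)) +
        (h * e i - e i * h) * (listProd e l * v) := by
      rw [listProd_cons]
      noncomm_ring
    rw [e1]
    exact add_mem (family_mul_mem_leftSpan i _ ih)
      (span_mul_mem_leftSpan (hh i) _ (Submodule.subset_span ⟨l, v, hv, rfl⟩))

theorem odd_mul_mem_leftSpan {x : R}
    (hx : ∀ i, ∀ u ∈ leftSpan e V, (x * e i + e i * x) * u ∈ leftSpan e V)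
    (hV : ∀ v ∈ V, x * v ∈ V) : ∀ u ∈ leftSpan e V, x * u ∈ leftSpan e V := by
  refine mul_mem_leftSpan fun l v hv => ?_
  induction l with
  | nil =>
    rw [listProd_nil, one_mul]
    exact le_leftSpan (hV v hv)
  | cons i l ih =>
    have e1 : x * (listProd e (i :: l) * v) = (x * e i + e i * x) * (listProd e l * v) -
        e i * (x * (listProd e l * v)) := by
      rw [listProd_cons]
      noncomm_ring
    rw [e1]
    exact sub_mem (hx i _ (Submodule.subset_span ⟨l, v, hv, rfl⟩)) (family_mul_mem_leftSpan i _ ih)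

/-- Products longer than the family vanish by anticommutativity, so the family can raise the degree
by at most its cardinality. -/
theorem leftSpan_le_filt {g : Type} [AddCommGroup g] [Module ℂ g] [LieSuperalgebra g]
    [Fintype κ] [DecidableEq κ] {s : Set g} {B : Submodule ℂ (U g)} {x : κ → g}
    (hx : ∀ p, x p ∈ s) (he : Anticomm fun p => ι g (x p)) {k : ℕ} {V : Submodule ℂ (U g)}
    (hV : V ≤ filt s B k) :
    leftSpan (fun p => ι g (x p)) V ≤ filt s B (k + Fintype.card κ) := by
  refine Submodule.span_le.mpr ?_
  rintro _ ⟨l, v, hv, rfl⟩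
  by_cases hl : Fintype.card κ < l.length
  · rw [he.listProd_eq_zero_of_card_lt hl, zero_mul]
    exact zero_mem _
  · exact monotone_nat_of_le_succ filt_le_succ (Nat.add_le_add_left (not_lt.mp hl) k)
      (listProd_ι_mem_filt hx (hV hv) l)

end Spanning

/-! ### Odd matrix elements: anticommutation, vanishing of long products, duality with the odd
generators. -/

section OddMatrixElements

open Matrix

variable {n : ℕ}

theorem even_comm_oddGen {h : osp n} (hh : h ∈ evenPart (osp n)) (i : Fin 2) (ν : OddIdx n) :
    ι (osp n) h * oddGen n (i, ν) - oddGen n (i, ν) * ι (osp n) h ∈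
      Submodule.span ℂ (Set.range fun ν => oddGen n (i, ν)) := by
  obtain ⟨c, s, -, -, h1⟩ := exists_ad_coeff hh
  rw [h1]
  exact sum_mem fun κ _ => Submodule.smul_mem _ _ (Submodule.subset_span ⟨κ, rfl⟩)

variable (n) in
/-- The image of the enveloping algebra of the even part. -/
def evenRange : Submodule ℂ (U (osp n)) :=
  LinearMap.range (evenInclusion (osp n)).toLinearMap

theorem ι_mul_mem_evenRange {h : osp n} (hh : h ∈ evenPart (osp n)) :
    ∀ u ∈ evenRange n, ι (osp n) h * u ∈ evenRange n := by
  rintro _ ⟨u, rfl⟩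
  refine ⟨ι (evenPart (osp n)) ⟨h, hh⟩ * u, ?_⟩
  simp [evenInclusion_ι]

theorem ι_odd_eq_sum {x : osp n} (hx : x ∈ homog (parity (g := osp n)) 1) :
    ∃ y : Fin 2 → OddIdx n → ℂ, ι (osp n) x = ∑ i, ∑ ν, y i ν • oddGen n (i, ν) := by
  refine ⟨(x : Mat n).toBlocks₁₂, ?_⟩
  nth_rewrite 1 [eq_oddElt hx]
  rw [oddElt_eq_sum]
  simp only [map_sum, map_smul]
  rfl

/-- The spanning half of the PBW theorem, with weight `1` first, then weight `-1`, then the even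
part. The subspace contains `1` and is stable under left multiplication by `g`; a generator of
weight `-1` moves past those of weight `1` at the cost of anticommutators in the even part. -/
theorem leftSpan_eq_top : leftSpan (fun ν => oddGen n (0, ν))
    (leftSpan (fun ν => oddGen n (1, ν)) (evenRange n)) = ⊤ := by
  have h1 : ∀ h ∈ evenPart (osp n), ∀ u ∈ leftSpan (fun ν => oddGen n (1, ν)) (evenRange n),
      ι (osp n) h * u ∈ leftSpan (fun ν => oddGen n (1, ν)) (evenRange n) := fun h hh =>
    even_mul_mem_leftSpan (even_comm_oddGen hh 1) (ι_mul_mem_evenRange hh)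
  have h2 : ∀ h ∈ evenPart (osp n), ∀ u ∈ leftSpan (fun ν => oddGen n (0, ν))
      (leftSpan (fun ν => oddGen n (1, ν)) (evenRange n)), ι (osp n) h * u ∈
      leftSpan (fun ν => oddGen n (0, ν)) (leftSpan (fun ν => oddGen n (1, ν)) (evenRange n)) :=
    fun h hh => even_mul_mem_leftSpan (even_comm_oddGen hh 0) (h1 h hh)
  have h3 : ∀ i ν, ∀ u ∈ leftSpan (fun ν => oddGen n (0, ν))
      (leftSpan (fun ν => oddGen n (1, ν)) (evenRange n)), oddGen n (i, ν) * u ∈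
      leftSpan (fun ν => oddGen n (0, ν)) (leftSpan (fun ν => oddGen n (1, ν)) (evenRange n)) := by
    intro i ν
    rcases Fin.exists_fin_two.mp ⟨i, rfl⟩ with rfl | rfl
    · exact family_mul_mem_leftSpan (e := fun ν => oddGen n (0, ν)) ν
    · refine odd_mul_mem_leftSpan (fun κ u hu => ?_)
        (family_mul_mem_leftSpan (e := fun ν => oddGen n (1, ν)) ν)
      obtain ⟨h, hh, h4⟩ := oddGen_mul_add (n := n) (1, ν) (0, κ)
      rw [← h4]
      exact h2 h hh u hu
  apply eq_top_of_mul_left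
  · exact le_leftSpan (le_leftSpan ⟨1, by simp⟩)
  · intro α x hx w hw
    rcases zmod_two_cases α with rfl | rfl
    · exact h2 x hx w hw
    · obtain ⟨y, hy⟩ := ι_odd_eq_sum hx
      rw [hy]
      simp only [Finset.sum_mul, smul_mul_assoc]
      exact sum_mem fun i _ => sum_mem fun ν _ => Submodule.smul_mem _ _ (h3 i ν w hw)

theorem card_oddIdx : Fintype.card (OddIdx n) = 2 * n := by
  simp [two_mul]

/-- Every element of `U(osp(2|2n))` has degree at most `4n` with respect to the odd part. -/
theorem filt_odd_eq_top :
    filt (homog (parity (g := osp n)) 1 : Set (osp n)) (evenRange n) (4 * n) = ⊤ := by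
  rw [eq_top_iff, ← leftSpan_eq_top]
  have h1 : leftSpan (fun ν => oddGen n (1, ν)) (evenRange n) ≤
      filt (homog (parity (g := osp n)) 1 : Set (osp n)) (evenRange n)
        (0 + Fintype.card (OddIdx n)) :=
    leftSpan_le_filt (x := fun ν => oddBasis n (1, ν)) (fun ν => oddBasis_mem _)
      (anticomm_oddGen 1) le_rfl
  have h2 : leftSpan (fun ν => oddGen n (0, ν))
      (leftSpan (fun ν => oddGen n (1, ν)) (evenRange n)) ≤
      filt (homog (parity (g := osp n)) 1 : Set (osp n)) (evenRange n)
        (0 + Fintype.card (OddIdx n) + Fintype.card (OddIdx n)) :=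
    leftSpan_le_filt (x := fun ν => oddBasis n (0, ν)) (fun ν => oddBasis_mem _)
      (anticomm_oddGen 0) h1
  have h3 : 0 + Fintype.card (OddIdx n) + Fintype.card (OddIdx n) = 4 * n := by
    rw [card_oddIdx]
    omega
  rwa [h3] at h2

theorem mem_oddSet {f : Module.Dual ℂ (U (osp n))} (hf : f ∈ upperOdd n ∪ lowerOdd n) :
    ∃ a b : Idx n, deg a + deg b = 1 ∧ f = t a b := by
  rcases hf with ⟨p, rfl⟩ | ⟨p, rfl⟩
  · exact ⟨_, _, by simp [deg], rfl⟩
  · exact ⟨_, _, by simp [deg], rfl⟩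

theorem odd_mul_odd {f h : Module.Dual ℂ (U (osp n))} (hf : f ∈ upperOdd n ∪ lowerOdd n)
    (hh : h ∈ upperOdd n ∪ lowerOdd n) : f * h = -(h * f) := by
  obtain ⟨a, b, hab, rfl⟩ := mem_oddSet hf
  obtain ⟨a', b', hab', rfl⟩ := mem_oddSet hh
  have h1 := t_mem_dualGr a b
  have h2 := t_mem_dualGr a' b'
  rw [hab] at h1
  rw [hab'] at h2
  rw [dual_superComm h1 h2, mul_one, sgn_one, neg_smul, one_smul]

theorem tw_evenInclusion {g : Type} [AddCommGroup g] [Module ℂ g] [LieSuperalgebra g]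
    (α : ZMod 2) (u : U (evenPart g)) : tw α (evenInclusion g u) = evenInclusion g u := by
  have h : (tw α).comp (evenInclusion g) = evenInclusion g := by
    apply algHom_ext
    intro x
    rw [AlgHom.comp_apply, evenInclusion_ι, tw_ι α x.2, mul_zero, sgn_zero, one_smul]
  exact DFunLike.congr_fun h u

theorem odd_apply_evenInclusion {a b : Idx n} (hab : deg a + deg b = 1)
    (u : U (evenPart (osp n))) : t a b (evenInclusion (osp n) u) = 0 := by
  have h1 := LinearMap.congr_fun (dtw_t a b) (evenInclusion (osp n) u)
  rw [dtw_apply, tw_evenInclusion, hab, sgn_one, neg_smul, one_smul, LinearMap.neg_apply] at h1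
  have h2 : (2 : ℂ) * t a b (evenInclusion (osp n) u) = 0 := by linear_combination h1
  simpa using h2

/-- By parity, odd matrix elements vanish on the image of `U(g₀)`. A product of `4n + 1` of them
therefore vanishes in all degrees up to `4n` of the filtration by the odd part, and there are no
other degrees. -/
theorem dualDegreePart_odd : dualDegreePart (upperOdd n ∪ lowerOdd n) (4 * n + 1) = ⊥ := by
  rw [eq_bot_iff]
  refine Submodule.span_le.mpr ?_
  rintro _ ⟨l, hl, hlS, rfl⟩
  have h := list_prod_mem_vanishing (s := (homog (parity (g := osp n)) 1 : Set (osp n)))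
    (B := evenRange n) (fun x hx => ⟨1, hx⟩) (by
      rintro α _ ⟨u, rfl⟩
      exact ⟨u, (tw_evenInclusion α u).symm⟩) (by
      rintro f h hfh _ ⟨u, rfl⟩
      change evenRestriction (osp n) (f * h) u = 0
      have h0 : ∀ f : Module.Dual ℂ (U (osp n)), (∀ u ∈ evenRange n, f u = 0) →
          evenRestriction (osp n) f = 0 := fun f hf => LinearMap.ext fun u => hf _ ⟨u, rfl⟩
      rw [evenRestriction_mul]
      rcases hfh with hf | hh
      · rw [h0 f hf, zero_mul]
        rfl
      · rw [h0 h hh, mul_zero]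
        rfl) l (by
      intro f hf
      obtain ⟨a, b, hab, rfl⟩ := mem_oddSet (hlS f hf)
      rw [mem_vanishing_one]
      rintro _ ⟨u, rfl⟩
      exact odd_apply_evenInclusion hab u)
  rw [hl] at h
  rw [dualProd_eq, SetLike.mem_coe, Submodule.mem_bot]
  ext u
  exact h (4 * n) (Nat.lt_succ_self _) u (filt_odd_eq_top ▸ trivial)

variable (n) in
/-- The matrix elements `t_iμ`, indexed by the dual elements of the odd basis. -/
def upperFamily (p : Fin 2 × OddIdx n) : Module.Dual ℂ (U (osp n)) :=
  t (Sum.inl p.1) (Sum.inr p.2)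

variable (n) in
/-- The matrix elements `t_μi`, indexed by the dual elements of the odd basis. -/
def lowerFamily (p : Fin 2 × OddIdx n) : Module.Dual ℂ (U (osp n)) :=
  t (Sum.inr p.2.swap) (Sum.inl p.1.rev)

theorem range_upperFamily : Set.range (upperFamily n) = upperOdd n := rfl

theorem range_lowerFamily : Set.range (lowerFamily n) = lowerOdd n := by
  apply le_antisymm
  · rintro _ ⟨p, rfl⟩
    exact ⟨(p.2.swap, p.1.rev), rfl⟩
  · rintro _ ⟨p, rfl⟩
    exact ⟨(p.2.rev, p.1.swap), by simp [lowerFamily]⟩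

theorem anticomm_upperFamily : Anticomm (upperFamily n) := fun p q =>
  odd_mul_odd (Or.inl ⟨p, rfl⟩) (Or.inl ⟨q, rfl⟩)

theorem anticomm_lowerFamily : Anticomm (lowerFamily n) := fun p q =>
  odd_mul_odd (Or.inr (range_lowerFamily ▸ ⟨p, rfl⟩)) (Or.inr (range_lowerFamily ▸ ⟨q, rfl⟩))

theorem upperFamily_apply_one (p : Fin 2 × OddIdx n) : upperFamily n p 1 = 0 := by
  rw [upperFamily, t_apply, map_one]
  exact Matrix.one_apply_ne (by simp)

theorem lowerFamily_apply_one (p : Fin 2 × OddIdx n) : lowerFamily n p 1 = 0 := by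
  rw [lowerFamily, t_apply, map_one]
  exact Matrix.one_apply_ne (by simp)

theorem upperFamily_apply (p q : Fin 2 × OddIdx n) :
    upperFamily n p (ι (osp n) (oddBasis n q)) = if p = q then 1 else 0 := by
  rw [upperFamily, t_apply, vectorRep_ι]
  change oddMat (single q.1 q.2 1) (Sum.inl p.1) (Sum.inr p.2) = _
  rw [oddMat, fromBlocks_apply₁₂, single_apply]
  simp [Prod.ext_iff, eq_comm]

theorem J_swap_apply (ν κ : OddIdx n) :
    J (Fin n) ℂ ν.swap κ = if ν = κ then J (Fin n) ℂ ν.swap ν else 0 := by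
  rcases ν with ν | ν <;> rcases κ with κ | κ <;> simp [J, Matrix.one_apply, apply_ite]

theorem J_swap_ne_zero (ν : OddIdx n) : J (Fin n) ℂ ν.swap ν ≠ 0 := by
  rcases ν with ν | ν <;> simp [J]

/-- The lower left block of an odd element is `-(J * Yᵀ * symmForm)`, and `J` and `symmForm` pair
each index with one partner only. The swapped indices in `lowerFamily` thus make the pairing matrix
diagonal, with nonzero diagonal. -/
theorem lowerFamily_apply (p q : Fin 2 × OddIdx n) :
    lowerFamily n p (ι (osp n) (oddBasis n q)) =
      if p = q then -J (Fin n) ℂ p.2.swap p.2 else 0 := by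
  obtain ⟨i, ν⟩ := p
  obtain ⟨j, κ⟩ := q
  rw [lowerFamily, t_apply, vectorRep_ι]
  change oddMat (single j κ (1 : ℂ)) (Sum.inr ν.swap) (Sum.inl i.rev) = _
  rw [oddMat, fromBlocks_apply₂₁, transpose_single, Matrix.neg_apply, Matrix.mul_assoc]
  have h1 : (J (Fin n) ℂ * (single κ j (1 : ℂ) * symmForm)) ν.swap i.rev =
      J (Fin n) ℂ ν.swap κ * symmForm j i.rev := by
    rw [Matrix.mul_apply, Finset.sum_eq_single κ]
    · rw [single_mul_apply_same, one_mul]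
    · intro b _ hb
      rw [single_mul_apply_of_ne _ _ _ _ _ hb, mul_zero]
    · simp
  have h2 : symmForm j i.rev = if i = j then 1 else 0 := by
    fin_cases i <;> fin_cases j <;> simp [symmForm]
  rw [h1, h2, J_swap_apply]
  by_cases hi : i = j <;> by_cases hν : ν = κ <;> simp [hi, hν]

end OddMatrixElements

/-! ### Top products modulo a one-sided ideal. -/

section TopProducts

variable {R : Type} [Ring R] [Algebra ℂ R] {κ : Type}

theorem apply_eq_zero_of_mem_span {H : Set R} {ψ : R →ₗ[ℂ] ℂ} (hψ : ∀ r, ∀ h ∈ H, ψ (r * h) = 0) :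
    ∀ x ∈ Ideal.span H, ψ x = 0 := by
  intro x hx
  suffices h : ∀ r, ψ (r * x) = 0 by simpa using h 1
  induction hx using Submodule.span_induction with
  | mem h hh => exact fun r => hψ r h hh
  | zero => simp
  | add y z _ _ hy hz => exact fun r => by rw [mul_add, map_add, hy, hz, add_zero]
  | smul c y _ hy => exact fun r => by rw [smul_eq_mul, ← mul_assoc, hy]

/-- This is the commutation argument with `v` the top product of the family `f` and `N` the left
ideal generated by `H`. It is stated for an arbitrary algebra so as to apply in the opposite algebra
too, where it treats right ideals. -/
theorem Anticomm.mul_top_mem [Fintype κ] [DecidableEq κ] {e f : κ → R} (he : Anticomm e)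
    (hf : Anticomm f) {L L' : List κ} (hL : Complete L) (hL' : Complete L') {H : Set R}
    (hef : ∀ i j, f j * e i + e i * f j ∈ H)
    (hHe : ∀ h ∈ H, ∀ i, h * e i - e i * h ∈ Submodule.span ℂ (Set.range e))
    (hHF : ∀ h ∈ H, ∃ c : ℂ, h * listProd f L' - listProd f L' * h = c • listProd f L')
    (hHEF : ∀ h ∈ H, h * (listProd e L * listProd f L') = listProd e L * listProd f L' * h)
    (hne : listProd e L * listProd f L' ∉ Ideal.span H) (j : κ) :
    f j * (listProd e L * listProd f L') ∈ Ideal.span H := by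
  have : Nonempty κ := ⟨j⟩
  have hH : ∀ r, ∀ h ∈ H, r * h ∈ Ideal.span H := fun r h hh =>
    (Ideal.span H).mul_mem_left r (Ideal.subset_span hh)
  refine he.mul_listProd_mul_mem hL (fun i => hef i j) hHe (fun h hh => ?_) ?_ (fun h hh => ?_) hne
  · obtain ⟨c, hc⟩ := hHF h hh
    refine ⟨c, ?_⟩
    rw [← hc, sub_sub_cancel]
    exact hH _ h hh
  · rw [hf.mul_listProd_eq_zero (hL'.2 j)]
    exact zero_mem _
  · rw [hHEF h hh]
    exact hH _ h hh

theorem listProd_op (e : κ → R) (l : List κ) :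
    listProd (fun i => MulOpposite.op (e i)) l = MulOpposite.op (listProd e l.reverse) := by
  induction l with
  | nil => rfl
  | cons i l ih => simp [ih]

end TopProducts

/-! ### The element `Γ` and its products with `osp(2|2n)`. -/

section Gamma

open Matrix

variable {n : ℕ}

variable (n) in
/-- The product of all standard odd generators of a given weight. -/
def topGen (i : Fin 2) : U (osp n) :=
  listProd (fun ν => oddGen n (i, ν)) (Finset.univ : Finset (OddIdx n)).toList

variable (n) in
/-- The product of all standard odd generators. -/
def gammaGen : U (osp n) := topGen n 0 * topGen n 1

theorem topDegree_eq (i : Fin 2) : topDegree n (![1, -1] i) = Submodule.span ℂ {topGen n i} := by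
  have h : (oddPart n (![1, -1] i)).map (ι (osp n)) =
      Submodule.span ℂ (Set.range fun ν => oddGen n (i, ν)) := by
    rw [oddPart_eq, Submodule.map_span, ← Set.range_comp]
    rfl
  rw [topDegree, h, ← card_oddIdx]
  apply le_antisymm ((anticomm_oddGen i).pow_card_le complete_univ)
  rw [Submodule.span_singleton_le_iff_mem, ← complete_univ.length]
  exact listProd_mem_pow _ _

variable (n) in
/-- The list of all indices of the odd basis. -/
def oddPairs : List (Fin 2 × OddIdx n) :=
  (Finset.univ : Finset (OddIdx n)).toList.map (Prod.mk 0) ++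
    (Finset.univ : Finset (OddIdx n)).toList.map (Prod.mk 1)

theorem complete_oddPairs : Complete (oddPairs n) := by
  constructor
  · refine List.Nodup.append ((Finset.nodup_toList _).map (Prod.mk_right_injective 0))
      ((Finset.nodup_toList _).map (Prod.mk_right_injective 1)) ?_
    intro p hp hp'
    obtain ⟨ν, -, rfl⟩ := List.mem_map.mp hp
    obtain ⟨κ, -, h⟩ := List.mem_map.mp hp'
    simp at h
  · rintro ⟨i, ν⟩
    rcases Fin.exists_fin_two.mp ⟨i, rfl⟩ with rfl | rfl <;> simp [oddPairs]

theorem listProd_oddPairs : listProd (oddGen n) (oddPairs n) = gammaGen n := by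
  rw [oddPairs, listProd_append, listProd_map, listProd_map]
  rfl

/-- The basic nonvanishing result: from it follow that `Γ` and both of its factors are nonzero, and
that `Γ` lies in neither of the two ideals generated by the even part. -/
theorem upperFamily_gamma : listProd (upperFamily n) (oddPairs n).reverse (gammaGen n) ≠ 0 := by
  rw [← listProd_oddPairs]
  have h := listProd_apply_listProd upperFamily_apply_one (x := oddBasis n) oddBasis_mem
    (c := fun _ => 1) upperFamily_apply (oddPairs n) complete_oddPairs.1
  refine ne_of_eq_of_ne h (List.prod_ne_zero ?_)
  simp

theorem lowerFamily_gamma : listProd (lowerFamily n) (oddPairs n).reverse (gammaGen n) ≠ 0 := by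
  rw [← listProd_oddPairs]
  have h := listProd_apply_listProd lowerFamily_apply_one (x := oddBasis n) oddBasis_mem
    (c := fun p => -J (Fin n) ℂ p.2.swap p.2) lowerFamily_apply (oddPairs n) complete_oddPairs.1
  refine ne_of_eq_of_ne h (List.prod_ne_zero fun h0 => ?_)
  obtain ⟨p, -, hp⟩ := List.mem_map.mp h0
  exact J_swap_ne_zero p.2 (neg_eq_zero.mp hp)

theorem gammaGen_ne_zero : gammaGen n ≠ 0 := fun h =>
  upperFamily_gamma (n := n) (by rw [h, map_zero])

theorem topGen_ne_zero (i : Fin 2) : topGen n i ≠ 0 := by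
  intro h
  apply gammaGen_ne_zero (n := n)
  rcases Fin.exists_fin_two.mp ⟨i, rfl⟩ with rfl | rfl <;> simp [gammaGen, h]

theorem card_pairs : Fintype.card (Fin 2 × OddIdx n) = 4 * n := by
  rw [Fintype.card_prod, card_oddIdx, Fintype.card_fin]
  omega

theorem dualDegreePart_upper : dualDegreePart (upperOdd n) (4 * n) =
    Submodule.span ℂ {listProd (upperFamily n) (oddPairs n).reverse} := by
  rw [← range_upperFamily, ← card_pairs]
  exact dualDegreePart_range anticomm_upperFamily complete_oddPairs.reverse

theorem dualDegreePart_lower : dualDegreePart (lowerOdd n) (4 * n) =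
    Submodule.span ℂ {listProd (lowerFamily n) (oddPairs n).reverse} := by
  rw [← range_lowerFamily, ← card_pairs]
  exact dualDegreePart_range anticomm_lowerFamily complete_oddPairs.reverse

theorem σ_topGen (i : Fin 2) : σ (osp n) (topGen n i) = topGen n i := by
  have h : ∀ l : List (OddIdx n), tw 1 (listProd (fun ν => oddGen n (i, ν)) l) =
      (-1 : ℂ) ^ l.length • listProd (fun ν => oddGen n (i, ν)) l := by
    intro l
    induction l with
    | nil => simp
    | cons ν l ih =>
      have h1 : tw 1 (oddGen n (i, ν)) = -oddGen n (i, ν) := by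
        rw [oddGen, tw_ι 1 (oddBasis_mem _), mul_one, sgn_one, neg_smul, one_smul]
      rw [listProd_cons, map_mul, h1, ih, List.length_cons, pow_succ, neg_mul, mul_smul_comm,
        mul_neg_one, neg_smul]
  have h2 := h (Finset.univ : Finset (OddIdx n)).toList
  rw [tw_one, complete_univ.length, card_oddIdx, pow_mul, neg_one_sq, one_pow, one_smul] at h2
  exact h2

theorem σ_gammaGen : σ (osp n) (gammaGen n) = gammaGen n := by
  rw [gammaGen, σ_mul, σ_topGen, σ_topGen]

/-- The even part acts on the products of the odd generators by opposite scalars. -/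
theorem exists_even_comm_topGen {h : osp n} (hh : h ∈ evenPart (osp n)) : ∃ c : ℂ, ∀ i,
    ι (osp n) h * topGen n i - topGen n i * ι (osp n) h = ![c, -c] i • topGen n i := by
  obtain ⟨c, s, hs, -, h1⟩ := exists_ad_coeff hh
  -- The scalar is the trace of the action on the generators of weight index `i`. There are `2n` of
  -- them, each contributing `±c`, and the symplectic block contributes its trace, which is zero.
  refine ⟨(2 * n : ℕ) * c, fun i => ?_⟩
  have h2 := (anticomm_oddGen (n := n) i).derivation_listProd
    (D := LinearMap.mulLeft ℂ (ι (osp n) h) - LinearMap.mulRight ℂ (ι (osp n) h))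
    (fun x y => by
      simp only [LinearMap.sub_apply, LinearMap.mulLeft_apply, LinearMap.mulRight_apply]
      noncomm_ring)
    (fun ν => h1 i ν) complete_univ
  refine Eq.trans h2 ?_
  change _ • topGen n i = _
  congr 1
  simp only [if_true, Finset.sum_sub_distrib, Finset.sum_const, Finset.card_univ, card_oddIdx]
  have h3 : ∑ ν, s ν ν = 0 := hs
  rw [h3, sub_zero, nsmul_eq_mul]
  rcases Fin.exists_fin_two.mp ⟨i, rfl⟩ with rfl | rfl <;> simp

theorem even_comm_gammaGen {h : osp n} (hh : h ∈ evenPart (osp n)) :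
    ι (osp n) h * gammaGen n = gammaGen n * ι (osp n) h := by
  obtain ⟨c, hc⟩ := exists_even_comm_topGen hh
  have h0 := hc 0
  have h1 := hc 1
  simp only [cons_val_zero, cons_val_one] at h0 h1
  rw [← sub_eq_zero]
  have e : ι (osp n) h * gammaGen n - gammaGen n * ι (osp n) h =
      (ι (osp n) h * topGen n 0 - topGen n 0 * ι (osp n) h) * topGen n 1 +
        topGen n 0 * (ι (osp n) h * topGen n 1 - topGen n 1 * ι (osp n) h) := by
    rw [gammaGen]
    noncomm_ring
  rw [e, h0, h1, smul_mul_assoc, mul_smul_comm, ← add_smul, add_neg_cancel, zero_smul]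

theorem gammaGen_comm_evenInclusion (y : U (evenPart (osp n))) :
    gammaGen n * evenInclusion (osp n) y = evenInclusion (osp n) y * gammaGen n := by
  suffices h : LinearMap.eqLocus
      (LinearMap.mulLeft ℂ (gammaGen n) ∘ₗ (evenInclusion (osp n)).toLinearMap)
      (LinearMap.mulRight ℂ (gammaGen n) ∘ₗ (evenInclusion (osp n)).toLinearMap) = ⊤ by
    have : y ∈ LinearMap.eqLocus
      (LinearMap.mulLeft ℂ (gammaGen n) ∘ₗ (evenInclusion (osp n)).toLinearMap)
      (LinearMap.mulRight ℂ (gammaGen n) ∘ₗ (evenInclusion (osp n)).toLinearMap) := h ▸ trivial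
    exact this
  apply eq_top_of_mul_left
  · simp [LinearMap.mem_eqLocus]
  · intro α x _ w hw
    have hw' : gammaGen n * evenInclusion (osp n) w = evenInclusion (osp n) w * gammaGen n := hw
    change gammaGen n * evenInclusion (osp n) (ι _ x * w) =
      evenInclusion (osp n) (ι _ x * w) * gammaGen n
    rw [map_mul, evenInclusion_ι, ← mul_assoc, ← even_comm_gammaGen x.2, mul_assoc, hw', mul_assoc]

theorem translR_derivation {h : osp n} (hh : h ∈ evenPart (osp n))
    (f k : Module.Dual ℂ (U (osp n))) : translR (ι (osp n) h) (f * k) =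
      translR (ι (osp n) h) f * k + f * translR (ι (osp n) h) k := by
  rw [translR_mul hh, dtw_zero]

theorem translL_derivation {h : osp n} (hh : h ∈ evenPart (osp n))
    (f k : Module.Dual ℂ (U (osp n))) : translL (ι (osp n) h) (f * k) =
      translL (ι (osp n) h) f * k + f * translL (ι (osp n) h) k := by
  rw [translL_mul hh, dtw_zero]

/-- Right translation acts on the odd index of each `t_iμ` through the symplectic block, so on the
top product it acts by twice the trace of that block. -/
theorem translR_upper {h : osp n} (hh : h ∈ evenPart (osp n)) {L : List (Fin 2 × OddIdx n)}
    (hL : Complete L) : translR (ι (osp n) h) (listProd (upperFamily n) L) = 0 := by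
  obtain ⟨c, s, hs, hX, -⟩ := exists_ad_coeff hh
  have h1 := anticomm_upperFamily.derivation_listProd (translR_derivation hh)
    (m := fun p q => if q.1 = p.1 then s q.2 p.2 else 0) (fun p => by
      rw [upperFamily, t_eq_coeff, translR_coeff, vectorRep_ι, hX, Fintype.sum_sum_type,
        Fintype.sum_prod_type, Finset.sum_eq_single p.1]
      · simp [upperFamily, t_eq_coeff]
      · intro i _ _
        simp
      · simp) hL
  have h3 : ∑ ν, s ν ν = 0 := hs
  rw [h1, Fintype.sum_prod_type]
  simp [h3]

/-- Left translation scales the elements `t_iμ` by `c` for one value of `i` and by `-c` for the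
other; these contributions cancel in the trace. -/
theorem translL_upper {h : osp n} (hh : h ∈ evenPart (osp n)) {L : List (Fin 2 × OddIdx n)}
    (hL : Complete L) : translL (ι (osp n) h) (listProd (upperFamily n) L) = 0 := by
  obtain ⟨c, s, hs, hX, -⟩ := exists_ad_coeff hh
  have h1 := anticomm_upperFamily.derivation_listProd (translL_derivation hh)
    (m := fun p q => if p = q then ![c, -c] p.1 else 0) (fun p => by
      rw [upperFamily, t_eq_coeff, translL_coeff, vectorRep_ι, hX, Fintype.sum_sum_type]
      simp [diagonal_apply, upperFamily, t_eq_coeff]) hL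
  rw [h1, Fintype.sum_prod_type]
  simp

theorem translR_lower {h : osp n} (hh : h ∈ evenPart (osp n)) {L : List (Fin 2 × OddIdx n)}
    (hL : Complete L) : translR (ι (osp n) h) (listProd (lowerFamily n) L) = 0 := by
  obtain ⟨c, s, hs, hX, -⟩ := exists_ad_coeff hh
  have h1 := anticomm_lowerFamily.derivation_listProd (translR_derivation hh)
    (m := fun p q => if p = q then ![c, -c] p.1.rev else 0) (fun p => by
      rw [lowerFamily, t_eq_coeff, translR_coeff, vectorRep_ι, hX, Fintype.sum_sum_type]
      simp [diagonal_apply, lowerFamily, t_eq_coeff]) hL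
  rw [h1, Fintype.sum_prod_type]
  simp

variable (n) in
/-- The generators of the image of the augmentation ideal of the even part. -/
def evenGens : Set (U (osp n)) := ι (osp n) '' evenPart (osp n)

/-- This replaces an appeal to linear independence in the PBW theorem: the top product of the `t_iμ`
vanishes on the left ideal generated by the even part, being killed by its right translations, but
not at `Γ`. -/
theorem gammaGen_notMem_left : gammaGen n ∉ Ideal.span (evenGens n) := by
  intro h
  refine upperFamily_gamma (n := n) (apply_eq_zero_of_mem_span ?_ _ h)
  rintro r _ ⟨x, hx, rfl⟩
  rw [← translR_apply, translR_upper hx complete_oddPairs.reverse]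
  rfl

theorem gammaGen_notMem_right : MulOpposite.op (gammaGen n) ∉
    Ideal.span (MulOpposite.op '' evenGens n) := by
  intro h
  refine upperFamily_gamma (n := n) (apply_eq_zero_of_mem_span
    (ψ := listProd (upperFamily n) (oddPairs n).reverse ∘ₗ
      (MulOpposite.opLinearEquiv ℂ).symm.toLinearMap) ?_ _ h)
  rintro r _ ⟨_, ⟨x, hx, rfl⟩, rfl⟩
  change listProd (upperFamily n) (oddPairs n).reverse (ι (osp n) x * r.unop) = 0
  rw [← translL_apply, translL_upper hx complete_oddPairs.reverse]
  rfl

/-- Left multiplication of `Γ` by elements of `osp(2|2n)`. -/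
theorem ι_mul_gammaGen_mem {α : ZMod 2} {x : osp n} (hx : x ∈ homog (parity (g := osp n)) α) :
    ι (osp n) x * gammaGen n ∈ Ideal.span (evenGens n) := by
  rcases zmod_two_cases α with rfl | rfl
  · rw [even_comm_gammaGen hx]
    exact Ideal.mul_mem_left _ _ (Ideal.subset_span ⟨x, hx, rfl⟩)
  · obtain ⟨y, hy⟩ := ι_odd_eq_sum hx
    rw [hy]
    simp only [Finset.sum_mul, smul_mul_assoc]
    refine sum_mem fun i _ => sum_mem fun ν _ => ?_
    rw [Algebra.smul_def]
    refine Ideal.mul_mem_left _ _ ?_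
    rcases Fin.exists_fin_two.mp ⟨i, rfl⟩ with rfl | rfl
    · have h0 : oddGen n (0, ν) * topGen n 0 = 0 :=
        (anticomm_oddGen (n := n) 0).mul_listProd_eq_zero (by simp)
      rw [gammaGen, ← mul_assoc, h0, zero_mul]
      exact zero_mem _
    -- The substantial case: a generator of weight `-1` meets the product of all generators of
    -- weight `1`.
    · refine (anticomm_oddGen (n := n) 0).mul_top_mem (anticomm_oddGen 1) complete_univ
        complete_univ (fun i j => oddGen_mul_add _ _) ?_ ?_ ?_ gammaGen_notMem_left ν
      · rintro _ ⟨h, hh, rfl⟩ i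
        exact even_comm_oddGen hh 0 i
      · rintro _ ⟨h, hh, rfl⟩
        obtain ⟨c, hc⟩ := exists_even_comm_topGen hh
        exact ⟨_, hc 1⟩
      · rintro _ ⟨h, hh, rfl⟩
        exact even_comm_gammaGen hh

theorem op_listProd_reverse (i : Fin 2) :
    listProd (fun ν => MulOpposite.op (oddGen n (i, ν)))
      (Finset.univ : Finset (OddIdx n)).toList.reverse = MulOpposite.op (topGen n i) := by
  rw [listProd_op, List.reverse_reverse]
  rfl

/-- Right multiplication of `Γ` by elements of `osp(2|2n)`. -/
theorem gammaGen_mul_ι_mem {α : ZMod 2} {x : osp n} (hx : x ∈ homog (parity (g := osp n)) α) :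
    MulOpposite.op (gammaGen n * ι (osp n) x) ∈ Ideal.span (MulOpposite.op '' evenGens n) := by
  rcases zmod_two_cases α with rfl | rfl
  · rw [← even_comm_gammaGen hx, MulOpposite.op_mul]
    exact Ideal.mul_mem_left _ _ (Ideal.subset_span ⟨_, ⟨x, hx, rfl⟩, rfl⟩)
  · obtain ⟨y, hy⟩ := ι_odd_eq_sum hx
    rw [hy]
    simp only [Finset.mul_sum, mul_smul_comm, Finset.op_sum, MulOpposite.op_smul]
    refine sum_mem fun i _ => sum_mem fun ν _ => ?_
    rw [Algebra.smul_def]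
    refine Ideal.mul_mem_left _ _ ?_
    rcases Fin.exists_fin_two.mp ⟨i, rfl⟩ with rfl | rfl
    -- The same argument in the opposite algebra, where the two weights change roles because `Γ`
    -- becomes the product in the other order. The lists are reversed to compensate for the reversal
    -- of products.
    · have key := (anticomm_oddGen (n := n) 1).op.mul_top_mem (anticomm_oddGen (n := n) 0).op
        complete_univ.reverse complete_univ.reverse (H := MulOpposite.op '' evenGens n)
        ?_ ?_ ?_ ?_ ?_ ν
      · rw [op_listProd_reverse, op_listProd_reverse] at key
        simpa only [gammaGen, MulOpposite.op_mul] using key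
      · intro i j
        exact ⟨_, oddGen_mul_add (1, i) (0, j), by simp⟩
      · rintro _ ⟨_, ⟨h, hh, rfl⟩, rfl⟩ i
        have h1 := neg_mem (even_comm_oddGen hh 1 i)
        rw [neg_sub] at h1
        have h2 := Submodule.mem_map_of_mem (f := (MulOpposite.opLinearEquiv ℂ).toLinearMap) h1
        rw [Submodule.map_span, ← Set.range_comp] at h2
        exact h2
      · rintro _ ⟨_, ⟨h, hh, rfl⟩, rfl⟩
        obtain ⟨c, hc⟩ := exists_even_comm_topGen hh
        refine ⟨-![c, -c] 0, ?_⟩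
        rw [op_listProd_reverse, ← MulOpposite.op_mul, ← MulOpposite.op_mul, ← MulOpposite.op_sub,
          ← MulOpposite.op_smul, neg_smul, ← hc 0, neg_sub]
      · rintro _ ⟨_, ⟨h, hh, rfl⟩, rfl⟩
        rw [op_listProd_reverse, op_listProd_reverse, ← MulOpposite.op_mul, ← MulOpposite.op_mul,
          ← MulOpposite.op_mul]
        exact congrArg _ (even_comm_gammaGen hh).symm
      · rw [op_listProd_reverse, op_listProd_reverse, ← MulOpposite.op_mul]
        exact gammaGen_notMem_right
    · have h0 : topGen n 1 * oddGen n (1, ν) = 0 := by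
        have h1 := (anticomm_oddGen (n := n) 1).op.mul_listProd_eq_zero (i := ν)
          (l := (Finset.univ : Finset (OddIdx n)).toList.reverse) (by simp)
        rw [op_listProd_reverse, ← MulOpposite.op_mul] at h1
        exact MulOpposite.op_injective h1
      rw [gammaGen, mul_assoc, h0, mul_zero]
      exact zero_mem _

end Gamma

/-! ### Invariance of the integral and its values on top products. -/

section Integral

open SubHopfSuperalgebra

variable {n : ℕ}

variable (n) in
/-- Restriction to the even part, as a map between the coordinate algebras. -/
def restrictEven : (coordHopf n).toSubmodule →ₗ[ℂ] (evenCoordHopf n).toSubmodule :=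
  restrictToEven (coordHopf n) (evenCoordHopf n) evenCoordHopf_toSubmodule

theorem restrictEven_ext {a b : (coordHopf n).toSubmodule}
    (h : ∀ y, a.1 (evenInclusion (osp n) y) = b.1 (evenInclusion (osp n) y)) :
    restrictEven n a = restrictEven n b :=
  Subtype.ext (LinearMap.ext h)

theorem transL_ext {x : U (osp n)} {a b : (coordHopf n).toSubmodule}
    (h : ∀ u, a.1 (x * u) = b.1 u) : (coordHopf n).transL x a = b :=
  Subtype.ext (LinearMap.ext h)

theorem transR_ext {x : U (osp n)} {a b : (coordHopf n).toSubmodule}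
    (h : ∀ u, a.1 (u * x) = b.1 u) : (coordHopf n).transR x a = b :=
  Subtype.ext (LinearMap.ext h)

variable {I₀ : Module.Dual ℂ (evenCoordHopf n).toSubmodule}

theorem restrictEven_transL (hL : ∀ x a, I₀ ((evenCoordHopf n).transL x a) = counit x * I₀ a)
    {h : osp n} (hh : h ∈ evenPart (osp n)) (a : (coordHopf n).toSubmodule) :
    I₀ (restrictEven n ((coordHopf n).transL (ι (osp n) h) a)) = 0 := by
  have e : restrictEven n ((coordHopf n).transL (ι (osp n) h) a) =
      (evenCoordHopf n).transL (ι (evenPart (osp n)) ⟨h, hh⟩) (restrictEven n a) := by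
    apply Subtype.ext
    ext y
    change a.1 (ι (osp n) h * evenInclusion (osp n) y) =
      a.1 (evenInclusion (osp n) (ι (evenPart (osp n)) ⟨h, hh⟩ * y))
    rw [map_mul (evenInclusion (osp n)), evenInclusion_ι]
  rw [e, hL, counit_ι, zero_mul]

theorem restrictEven_transR (hR : ∀ x a, I₀ ((evenCoordHopf n).transR x a) = counit x * I₀ a)
    {h : osp n} (hh : h ∈ evenPart (osp n)) (a : (coordHopf n).toSubmodule) :
    I₀ (restrictEven n ((coordHopf n).transR (ι (osp n) h) a)) = 0 := by
  have e : restrictEven n ((coordHopf n).transR (ι (osp n) h) a) =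
      (evenCoordHopf n).transR (ι (evenPart (osp n)) ⟨h, hh⟩) (restrictEven n a) := by
    apply Subtype.ext
    ext y
    change a.1 (evenInclusion (osp n) y * ι (osp n) h) =
      a.1 (evenInclusion (osp n) (y * ι (evenPart (osp n)) ⟨h, hh⟩))
    rw [map_mul (evenInclusion (osp n)), evenInclusion_ι]
  rw [e, hR, counit_ι, zero_mul]

variable (I₀) in
/-- The linear form `x ↦ I₀ (𝒫 (a (x ·)))`. -/
def leftPairing (a : (coordHopf n).toSubmodule) : U (osp n) →ₗ[ℂ] ℂ where
  toFun x := I₀ (restrictEven n ((coordHopf n).transL x a))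
  map_add' x y := by
    rw [← map_add, ← map_add]
    refine congrArg _ (congrArg _ (transL_ext fun u => ?_))
    rw [add_mul, map_add]
    rfl
  map_smul' c x := by
    rw [RingHom.id_apply, ← map_smul, ← map_smul]
    refine congrArg _ (congrArg _ (transL_ext fun u => ?_))
    rw [smul_mul_assoc, map_smul]
    rfl

variable (I₀) in
/-- The linear form `x ↦ I₀ (𝒫 (a (· x)))`. -/
def rightPairing (a : (coordHopf n).toSubmodule) : U (osp n) →ₗ[ℂ] ℂ where
  toFun x := I₀ (restrictEven n ((coordHopf n).transR x a))
  map_add' x y := by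
    rw [← map_add, ← map_add]
    refine congrArg _ (congrArg _ (transR_ext fun u => ?_))
    rw [mul_add, map_add]
    rfl
  map_smul' c x := by
    rw [RingHom.id_apply, ← map_smul, ← map_smul]
    refine congrArg _ (congrArg _ (transR_ext fun u => ?_))
    rw [mul_smul_comm, map_smul]
    rfl

variable (I₀) in
/-- The linear form `a ↦ I₀ (𝒫 (a (Γ ·)))`. -/
def gammaForm : Module.Dual ℂ (coordHopf n).toSubmodule :=
  I₀ ∘ₗ restrictEven n ∘ₗ (coordHopf n).transL (gammaGen n)

/-- The element `x Γ` is a sum of terms `r h` with `h` in the even part. For such a term the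
restricted form `a (r h ·)` is a left translate by `h` of `a (r ·)`, which the even integral kills.
-/
theorem gammaForm_transL (hL : ∀ x a, I₀ ((evenCoordHopf n).transL x a) = counit x * I₀ a)
    {α : ZMod 2} {x : osp n} (hx : x ∈ homog (parity (g := osp n)) α)
    (a : (coordHopf n).toSubmodule) :
    gammaForm I₀ ((coordHopf n).transL (ι (osp n) x) a) = 0 := by
  have h := apply_eq_zero_of_mem_span (ψ := leftPairing I₀ a) (H := evenGens n) ?_ _
    (ι_mul_gammaGen_mem hx)
  · refine Eq.trans ?_ h
    refine congrArg I₀ (restrictEven_ext fun y => ?_)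
    change a.1 (ι (osp n) x * (gammaGen n * _)) = a.1 (ι (osp n) x * gammaGen n * _)
    rw [mul_assoc]
  · rintro r _ ⟨k, hk, rfl⟩
    rw [← restrictEven_transL hL hk ((coordHopf n).transL r a)]
    refine congrArg I₀ (congrArg _ (transL_ext fun u => ?_))
    change a.1 (r * _ * u) = a.1 (r * (_ * u))
    rw [mul_assoc]

/-- Since `Γ` commutes with the image of `U(g₀)`, the expression `a (Γ y x)` is `a (y Γ x)`. Now `Γ
x` is a sum of terms `h r` with `h` in the even part, and right invariance of the even integral
applies. -/
theorem gammaForm_transR (hR : ∀ x a, I₀ ((evenCoordHopf n).transR x a) = counit x * I₀ a)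
    {α : ZMod 2} {x : osp n} (hx : x ∈ homog (parity (g := osp n)) α)
    (a : (coordHopf n).toSubmodule) :
    gammaForm I₀ ((coordHopf n).transR (ι (osp n) x) a) = 0 := by
  have h := apply_eq_zero_of_mem_span (ψ := rightPairing I₀ a ∘ₗ
    (MulOpposite.opLinearEquiv ℂ).symm.toLinearMap) (H := MulOpposite.op '' evenGens n) ?_ _
    (gammaGen_mul_ι_mem hx)
  · refine Eq.trans ?_ h
    refine congrArg I₀ (restrictEven_ext fun y => ?_)
    change a.1 (gammaGen n * _ * ι (osp n) x) = a.1 (_ * (gammaGen n * ι (osp n) x))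
    rw [gammaGen_comm_evenInclusion, mul_assoc]
  · rintro r _ ⟨_, ⟨k, hk, rfl⟩, rfl⟩
    change rightPairing I₀ a (ι (osp n) k * r.unop) = 0
    rw [← restrictEven_transR hR hk ((coordHopf n).transR r.unop a)]
    refine congrArg I₀ (congrArg _ (transR_ext fun u => ?_))
    change a.1 (u * (_ * _)) = a.1 (u * _ * _)
    rw [mul_assoc]

theorem gammaForm_parity : gammaForm I₀ ∘ₗ (coordHopf n).parity = gammaForm I₀ := by
  ext a
  refine congrArg I₀ (restrictEven_ext fun y => ?_)
  change a.1 (σ (osp n) (gammaGen n * evenInclusion (osp n) y)) =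
    a.1 (gammaGen n * evenInclusion (osp n) y)
  have h := tw_evenInclusion (g := osp n) 1 y
  rw [tw_one] at h
  have h' : σ (osp n) (evenInclusion (osp n) y) = evenInclusion (osp n) y := h
  rw [σ_mul, σ_gammaGen, h']

theorem gammaForm_isLeftIntegral
    (hL : ∀ x a, I₀ ((evenCoordHopf n).transL x a) = counit x * I₀ a) :
    (coordHopf n).IsLeftIntegral (gammaForm I₀) :=
  ((coordHopf n).isLeftIntegral_iff gammaForm_parity).mpr
    (transL_eq_counit _ fun _ _ hx => gammaForm_transL hL hx)

theorem gammaForm_isRightIntegral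
    (hR : ∀ x a, I₀ ((evenCoordHopf n).transR x a) = counit x * I₀ a) :
    (coordHopf n).IsRightIntegral (gammaForm I₀) :=
  ((coordHopf n).isRightIntegral_iff gammaForm_parity).mpr
    (transR_eq_counit _ fun _ _ hx => gammaForm_transR hR hx)

/-- Invariance under right translation by the even part makes `Θ (Γ y)` equal to `Θ Γ` times the
counit of `y`, so the normalized even integral returns `Θ Γ`. -/
theorem gammaForm_eq (h1 : I₀ (evenCoordHopf n).one = 1) {Θ : (coordHopf n).toSubmodule}
    (hΘ : ∀ h ∈ evenPart (osp n), translR (ι (osp n) h) Θ.1 = 0) :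
    gammaForm I₀ Θ = Θ.1 (gammaGen n) := by
  have key : LinearMap.eqLocus (translL (gammaGen n) Θ.1 ∘ₗ (evenInclusion (osp n)).toLinearMap)
      (Θ.1 (gammaGen n) • (counit (g := evenPart (osp n))).toLinearMap) = ⊤ := by
    apply eq_top_of_mul_right
    · simp [LinearMap.mem_eqLocus]
    · intro α x _ w _
      change Θ.1 (gammaGen n * evenInclusion (osp n) (w * ι _ x)) =
        Θ.1 (gammaGen n) * counit (w * ι _ x)
      rw [map_mul (evenInclusion (osp n)), evenInclusion_ι, ← mul_assoc, ← translR_apply, hΘ _ x.2,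
        map_mul (counit (g := evenPart (osp n))), counit_ι,
        mul_zero, mul_zero]
      rfl
  have e : restrictEven n ((coordHopf n).transL (gammaGen n) Θ) =
      Θ.1 (gammaGen n) • (evenCoordHopf n).one := by
    apply Subtype.ext
    ext y
    have hy : y ∈ LinearMap.eqLocus
        (translL (gammaGen n) Θ.1 ∘ₗ (evenInclusion (osp n)).toLinearMap)
        (Θ.1 (gammaGen n) • (counit (g := evenPart (osp n))).toLinearMap) := key ▸ trivial
    exact hy
  change I₀ (restrictEven n ((coordHopf n).transL (gammaGen n) Θ)) = _
  rw [e, map_smul, h1, smul_eq_mul, mul_one]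

theorem gammaForm_ne_zero (h1 : I₀ (evenCoordHopf n).one = 1) {Θ : (coordHopf n).toSubmodule}
    (hΘ0 : Θ ≠ 0) (hΘ : Θ.1 ∈ dualDegreePart (upperOdd n) (4 * n) ∨
      Θ.1 ∈ dualDegreePart (lowerOdd n) (4 * n)) : gammaForm I₀ Θ ≠ 0 := by
  have main : ∀ T : Module.Dual ℂ (U (osp n)), T (gammaGen n) ≠ 0 →
      (∀ h ∈ evenPart (osp n), translR (ι (osp n) h) T = 0) → Θ.1 ∈ Submodule.span ℂ {T} →
      gammaForm I₀ Θ ≠ 0 := by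
    intro T hT hT' hmem
    obtain ⟨c, hc⟩ := Submodule.mem_span_singleton.mp hmem
    have hc0 : c ≠ 0 := by
      rintro rfl
      exact hΘ0 (Subtype.ext (by rw [← hc, zero_smul]; rfl))
    rw [gammaForm_eq h1 (fun h hh => by rw [← hc, map_smul, hT' h hh, smul_zero]), ← hc]
    exact mul_ne_zero hc0 hT
  rcases hΘ with hΘ | hΘ
  · rw [dualDegreePart_upper] at hΘ
    exact main _ upperFamily_gamma (fun h hh => translR_upper hh complete_oddPairs.reverse) hΘ
  · rw [dualDegreePart_lower] at hΘ
    exact main _ lowerFamily_gamma (fun h hh => translR_lower hh complete_oddPairs.reverse) hΘ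

theorem listProd_upperFamily_mem (l : List (Fin 2 × OddIdx n)) :
    listProd (upperFamily n) l ∈ (coordHopf n).toSubmodule := by
  induction l with
  | nil => exact one_mem_coordHopf
  | cons p l ih =>
    rw [listProd_cons]
    exact mul_mem_coordHopf (matrixElements_le (t_mem _ _)) ih

end Integral

end OSP

open OSP in
theorem theorem4 (n : ℕ) :
    ∃ (A : SubHopfSuperalgebra (osp n)) (Ae : SubHopfSuperalgebra (evenPart (osp n)))
      (hAe : Ae.toSubmodule = A.toSubmodule.map (evenRestriction (osp n))),
      -- `A` is generated by the matrix elements of the vector representation and is dense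
      A.toSubmodule = generatedSubalgebra (Set.range fun p : Idx n × Idx n => t p.1 p.2) ∧
      A.IsDense ∧
      -- the odd matrix elements anticommute
      (∀ f ∈ upperOdd n ∪ lowerOdd n, ∀ h ∈ upperOdd n ∪ lowerOdd n,
        dualMul f h = -dualMul h f) ∧
      -- products of more than `4n` of them vanish
      dualDegreePart (upperOdd n ∪ lowerOdd n) (4 * n + 1) = ⊥ ∧
      -- the spaces of highest degree of the Grassmann algebras involved are lines
      Module.finrank ℂ (dualDegreePart (upperOdd n) (4 * n)) = 1 ∧
      Module.finrank ℂ (dualDegreePart (lowerOdd n) (4 * n)) = 1 ∧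
      Module.finrank ℂ (topDegree n 1) = 1 ∧
      Module.finrank ℂ (topDegree n (-1)) = 1 ∧
      -- `Ae = 𝒫(A)` has a normalized left integral, unique up to scalar multiples
      ∃ I₀ : Module.Dual ℂ Ae.toSubmodule,
        Ae.IsLeftIntegral I₀ ∧ I₀ Ae.one = 1 ∧
        (∀ I : Module.Dual ℂ Ae.toSubmodule, Ae.IsLeftIntegral I → ∃ c : ℂ, I = c • I₀) ∧
        -- the integral on `A`
        ∀ E ∈ topDegree n 1, ∀ F ∈ topDegree n (-1), E ≠ 0 → F ≠ 0 →
          ∀ I : Module.Dual ℂ A.toSubmodule,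
            I = A.formMul (A.nu (E * F)) (I₀ ∘ₗ restrictToEven A Ae hAe) →
            A.IsLeftIntegral I ∧ A.IsRightIntegral I ∧ I ≠ 0 ∧
            ∀ Θ : A.toSubmodule, Θ ≠ 0 →
              ((Θ : Module.Dual ℂ (U (osp n))) ∈ dualDegreePart (upperOdd n) (4 * n) ∨
                (Θ : Module.Dual ℂ (U (osp n))) ∈ dualDegreePart (lowerOdd n) (4 * n)) →
              I Θ ≠ 0 := by
  obtain ⟨I₀, hL, hR, h1, huniq⟩ := exists_haar_evenCoordHopf n
  have hpar : ∀ I : Module.Dual ℂ (evenCoordHopf n).toSubmodule,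
      I ∘ₗ (evenCoordHopf n).parity = I := fun I => by
    rw [evenCoordHopf_parity, LinearMap.comp_id]
  have htop0 := topDegree_eq (n := n) 0
  have htop1 := topDegree_eq (n := n) 1
  simp only [Matrix.cons_val_zero, Matrix.cons_val_one] at htop0 htop1
  refine ⟨coordHopf n, evenCoordHopf n, evenCoordHopf_toSubmodule, coordHopf_eq_generated,
    isDense_coordHopf n, fun f hf h hh => odd_mul_odd hf hh, dualDegreePart_odd, ?_, ?_, ?_, ?_,
    I₀, ((evenCoordHopf n).isLeftIntegral_iff (hpar I₀)).mpr hL, h1, fun I hI =>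
      ⟨_, huniq I (((evenCoordHopf n).isLeftIntegral_iff (hpar I)).mp hI)⟩, ?_⟩
  · rw [dualDegreePart_upper]
    exact finrank_span_singleton fun h => upperFamily_gamma (n := n) (by rw [h]; rfl)
  · rw [dualDegreePart_lower]
    exact finrank_span_singleton fun h => lowerFamily_gamma (n := n) (by rw [h]; rfl)
  · rw [htop0]
    exact finrank_span_singleton (topGen_ne_zero 0)
  · rw [htop1]
    exact finrank_span_singleton (topGen_ne_zero 1)
  · rintro E hE F hF hE0 hF0 I rfl
    rw [htop0] at hE
    rw [htop1] at hF
    obtain ⟨c, rfl⟩ := Submodule.mem_span_singleton.mp hE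
    obtain ⟨d, rfl⟩ := Submodule.mem_span_singleton.mp hF
    have hc : c * d ≠ 0 := mul_ne_zero (left_ne_zero_of_smul hE0) (left_ne_zero_of_smul hF0)
    have hΓ : c • topGen n 0 * d • topGen n 1 = (c * d) • gammaGen n := smul_mul_smul_comm ..
    -- Changing `E` and `F` within their lines only rescales the form, and `ν Γ` acts by left
    -- translation because `Γ` is even.
    have hI : (coordHopf n).formMul ((coordHopf n).nu (c • topGen n 0 * d • topGen n 1))
        (I₀ ∘ₗ restrictToEven (coordHopf n) (evenCoordHopf n) evenCoordHopf_toSubmodule) =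
        (c * d) • gammaForm I₀ := by
      ext a
      rw [hΓ, SubHopfSuperalgebra.formMul_nu _ (by rw [map_smul, σ_gammaGen])]
      exact map_smul (leftPairing I₀ a) (c * d) (gammaGen n)
    rw [hI]
    have hΘ : ∀ Θ : (coordHopf n).toSubmodule, Θ ≠ 0 →
        ((Θ : Module.Dual ℂ (U (osp n))) ∈ dualDegreePart (upperOdd n) (4 * n) ∨
          (Θ : Module.Dual ℂ (U (osp n))) ∈ dualDegreePart (lowerOdd n) (4 * n)) →
        ((c * d) • gammaForm I₀) Θ ≠ 0 := fun Θ h0 h =>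
      mul_ne_zero hc (gammaForm_ne_zero h1 h0 h)
    refine ⟨fun a => ?_, fun a => ?_, fun h0 => ?_, hΘ⟩
    · have h := gammaForm_isLeftIntegral hL a
      rw [TensorProduct.map_smul_right, LinearMap.smul_apply, map_smul, h, LinearMap.smul_apply,
        smul_eq_mul, smul_smul]
    · have h := gammaForm_isRightIntegral hR a
      rw [TensorProduct.map_smul_left, LinearMap.smul_apply, map_smul, h, LinearMap.smul_apply,
        smul_eq_mul, smul_smul]
    -- The form is nonzero because it does not vanish on the top product of the elements `t_iμ`.
    · refine hΘ ⟨_, listProd_upperFamily_mem (oddPairs n).reverse⟩ (fun h => ?_) (Or.inl ?_)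
        (by rw [h0]; rfl)
      · exact upperFamily_gamma (n := n) (LinearMap.congr_fun (congrArg Subtype.val h) _)
      · rw [dualDegreePart_upper]
        exact Submodule.mem_span_singleton_self _
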